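/- A \emph{parallelogram polyomino} is the set of cells of $\mathbb Z\times\mathbb Z$ (up to translation) between two paths with North and East steps that meet only at their starting and ending points. A \emph{periodic parallelogram polyomino} (PPP) is a parallelogram polyomino with a marked cell in its first column whose height $m\ge 1$, counted from the bottom of that column, is at most the size of the last column. Copies of a PPP $P$ are glued along an infinite strip, the marked cell of each copy being placed at the level of the topmost cell of the last column of the preceding copy; rows that are joined by this gluing count as one. The width $w$ of $P$ is its number of columns, its height $h$ is its number of rows, i.e. the number of rows above the marked one, and its semi-perimeter is $sp(P)=w+h$. $P$ is \emph{degenerated} if it is a rectangle whose marked cell is the topmost cell of the first column; a PPP* is a non-degenerated PPP. The \emph{rotation} $r$ moves the first column of a PPP* (of width at least $2$) to the last position, respecting the marking, and marks the former second column at the level of the topmost cell of the former first column; for width $1$, $r(P)=P$. Then $r$ is a bijection of the set of PPPs*, and a \emph{strip} is an orbit of the group generated by $r$. The graph $\Phi(P)$ has as vertices the topmost cells of the columns and the rightmost cells of the rows of $P$; the father of the topmost cell of a column is the rightmost cell of its row, and the father of the rightmost cell of a row is the topmost cell of its column. \emph{Pruning} $P$ means deleting recursively the columns and rows that correspond to leaves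 (vertices without sons) until none is left. For every PPP* $P$ there is exactly one integer $k\ge 1$ such that $P$ can be pruned to a PPP* without leaves that has upper path $N^k(NE)^l$ and lower path $(EN)^lN^k$ for some $l\ge 1$. This integer $k$ is called the \emph{intrinsic thickness} $it(P)$. Both $sp$ and $it$ are invariant under $r$, hence defined on strips. Let $\mathcal A(z)=\sum_T z^{|T|}$, the sum being over all ordered trees $T$, with $|T|$ the number of non-root vertices of $T$. Then \[\mathcal A(z)=\frac{1-\sqrt{1-4z}}{2z}.\] Put $\mathcal G(z)=z^2\mathcal A(z)^4$. For all $k,n$ there are finitely many strips $b$ with $it(b)=k$ and $sp(b)=n$, and, as formal power series, \[ B(z,t):=\sum_{b\ \mathrm{strip}} t^{it(b)}z^{sp(b)} =-\frac{t}{1-t}\sum_{i\ge 1}\frac{\varphi(i)}{i}\log\bigl(1-\mathcal G(z^i)\bigr), \] where $\varphi$ is Euler's totient function. -/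

import Mathlib

open scoped PowerSeries PowerSeries.WithPiTopology

/-- A parallelogram polyomino, normalised by translation so that its two boundary paths start
at the origin.  A path with North and East steps is given by the heights of its successive East
steps: `up i` is the height of the `i`-th East step of the upper path and `low i` that of the
lower path, and both paths end at `(width, up last)`.  Hence column `i` consists of the cells
`(i, y)` with `low i ≤ y < up i`.  The paths meet only at their two endpoints: this says
`low 0 = 0`, and that on each vertical line the lower path stays strictly below the upper one,
that is, `low i < up i` and `low (i + 1) < up i`. -/
structure ParallelogramPolyomino where
  width : ℕ
  width_pos : 0 < width
  low : Fin width → ℤ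
  up : Fin width → ℤ
  low_mono : Monotone low
  up_mono : Monotone up
  low_first : low ⟨0, width_pos⟩ = 0
  low_lt_up : ∀ i j : Fin width, (j : ℕ) ≤ (i : ℕ) + 1 → low j < up i

namespace ParallelogramPolyomino

/-- The index of the first column. -/
def first (P : ParallelogramPolyomino) : Fin P.width := ⟨0, P.width_pos⟩

/-- The index of the last column. -/
def last (P : ParallelogramPolyomino) : Fin P.width :=
  ⟨P.width - 1, Nat.sub_lt P.width_pos one_pos⟩

end ParallelogramPolyomino

/-- A periodic parallelogram polyomino: a parallelogram polyomino with a marked cell in the first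
column.  `mark` is the height of that cell in its column, counted from `1` at the bottom; the cell
is admissible, that is, `mark` is at most the size of the last column. -/
structure PPP extends ParallelogramPolyomino where
  mark : ℤ
  one_le_mark : 1 ≤ mark
  mark_le_first : mark ≤ up toParallelogramPolyomino.first - low toParallelogramPolyomino.first
  mark_le_last : mark ≤ up toParallelogramPolyomino.last - low toParallelogramPolyomino.last

namespace PPP

variable (P : PPP)

/-- The height: the number of rows above the marked one (rows joined by the gluing count as one;
the row of the marked cell is glued to the top row of the last column). -/
def height : ℤ := P.up P.last - P.mark

/-- The semi-perimeter: width plus height. -/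
def semiPerimeter : ℕ := P.width + P.height.toNat

/-- Degenerated: of rectangular shape, with the topmost cell of the first column marked. -/
def IsDegenerate : Prop :=
  (∀ i, P.low i = P.low P.first ∧ P.up i = P.up P.first) ∧ P.mark = P.up P.first

theorem emod_lt (j : ℤ) : (j % (P.width : ℤ)).toNat < P.width := by
  have h := P.width_pos
  have h1 := Int.emod_nonneg j (b := (P.width : ℤ)) (by omega)
  have h2 := Int.emod_lt_of_pos j (b := (P.width : ℤ)) (by omega)
  omega

/-- The column of `P` of which column `j` of the infinite strip is a copy. -/
def col (j : ℤ) : Fin P.width := ⟨(j % (P.width : ℤ)).toNat, P.emod_lt j⟩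

/-- Bottom of column `j` of the infinite strip obtained by gluing copies of `P`: the `q`-th copy
is translated by `q • (width, height)`, so that its marked cell is at the level of the topmost
cell of the last column of the preceding copy. -/
def stripLow (j : ℤ) : ℤ := P.low (P.col j) + j / (P.width : ℤ) * P.height

/-- Top of column `j` of the infinite strip obtained by gluing copies of `P`. -/
def stripUp (j : ℤ) : ℤ := P.up (P.col j) + j / (P.width : ℤ) * P.height

/-- The set of cells (column, row) of the infinite strip obtained by gluing copies of `P`. -/
def strip : Set (ℤ × ℤ) := {c | P.stripLow c.1 ≤ c.2 ∧ c.2 < P.stripUp c.1}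

theorem low_first' : P.low P.first = 0 := P.low_first

theorem height_nonneg : 0 ≤ P.height := by
  have h1 := P.mark_le_first
  have h2 : P.up P.first ≤ P.up P.last := P.up_mono (Fin.mk_le_mk.2 (Nat.zero_le _))
  rw [P.low_first'] at h1
  unfold height
  omega

theorem col_add_width (j : ℤ) (q : ℤ) : P.col (j + q * P.width) = P.col j := by
  simp [col]

theorem stripLow_add_width (j q : ℤ) :
    P.stripLow (j + q * P.width) = P.stripLow j + q * P.height := by
  have h := P.width_pos
  unfold stripLow
  rw [col_add_width, Int.add_mul_ediv_right _ _ (by omega)]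
  ring

theorem stripUp_add_width (j q : ℤ) :
    P.stripUp (j + q * P.width) = P.stripUp j + q * P.height := by
  have h := P.width_pos
  unfold stripUp
  rw [col_add_width, Int.add_mul_ediv_right _ _ (by omega)]
  ring

theorem col_coe (i : Fin P.width) : P.col (i : ℕ) = i := by
  ext
  simp only [col]
  rw [Int.emod_eq_of_lt (by omega) (by omega)]
  simp

theorem stripLow_coe (i : Fin P.width) : P.stripLow (i : ℕ) = P.low i := by
  unfold stripLow
  rw [col_coe, Int.ediv_eq_zero_of_lt (by omega) (by omega)]
  simp

theorem stripUp_coe (i : Fin P.width) : P.stripUp (i : ℕ) = P.up i := by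
  unfold stripUp
  rw [col_coe, Int.ediv_eq_zero_of_lt (by omega) (by omega)]
  simp

theorem stripLow_zero : P.stripLow 0 = 0 := by
  have := P.stripLow_coe P.first
  rw [P.low_first'] at this
  simpa [ParallelogramPolyomino.first] using this

theorem stripUp_zero : P.stripUp 0 = P.up P.first := by
  simpa [ParallelogramPolyomino.first] using P.stripUp_coe P.first

theorem coe_last : (((P.last : Fin P.width) : ℕ) : ℤ) = P.width - 1 := by
  have := P.width_pos
  simp only [ParallelogramPolyomino.last]
  omega

theorem stripLow_last : P.stripLow (P.width - 1) = P.low P.last := by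
  rw [← coe_last, stripLow_coe]

theorem stripUp_last : P.stripUp (P.width - 1) = P.up P.last := by
  rw [← coe_last, stripUp_coe]

theorem stripUp_neg_one : P.stripUp (-1) = P.mark := by
  have h := P.stripUp_add_width (-1) 1
  rw [show (-1 : ℤ) + 1 * P.width = P.width - 1 by ring, stripUp_last] at h
  unfold height at h
  omega

/-- Reduction of an index to the fundamental domain. -/
theorem exists_index (j : ℤ) : ∃ (i : Fin P.width) (q : ℤ), j = (i : ℕ) + q * P.width := by
  have h := P.width_pos
  refine ⟨P.col j, j / P.width, ?_⟩
  have h1 := Int.emod_nonneg j (b := (P.width : ℤ)) (by omega)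
  have h2 := Int.emod_add_mul_ediv j P.width
  simp only [col]
  rw [Int.toNat_of_nonneg h1]
  linarith

theorem strip_step (j : ℤ) : P.stripLow j ≤ P.stripLow (j + 1) ∧
    P.stripUp j ≤ P.stripUp (j + 1) ∧ P.stripLow (j + 1) < P.stripUp j := by
  obtain ⟨i, q, rfl⟩ := P.exists_index j
  rw [show ((i : ℕ) : ℤ) + q * P.width + 1 = ((i : ℕ) + 1 : ℤ) + q * P.width by ring]
  simp only [stripLow_add_width, stripUp_add_width, stripLow_coe, stripUp_coe]
  by_cases hi : (i : ℕ) + 1 < P.width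
  · have e1 := P.stripLow_coe ⟨i + 1, hi⟩
    have e2 := P.stripUp_coe ⟨i + 1, hi⟩
    push_cast at e1 e2
    rw [e1, e2]
    have m1 := P.low_mono (show i ≤ ⟨i + 1, hi⟩ from Fin.mk_le_mk.2 (Nat.le_succ _))
    have m2 := P.up_mono (show i ≤ ⟨i + 1, hi⟩ from Fin.mk_le_mk.2 (Nat.le_succ _))
    have m3 := P.low_lt_up i ⟨i + 1, hi⟩ le_rfl
    exact ⟨by omega, by omega, by omega⟩
  · have hl : i = P.last := by
      ext
      simp only [ParallelogramPolyomino.last]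
      omega
    have hw : ((i : ℕ) + 1 : ℤ) = 0 + 1 * P.width := by
      have := i.2
      omega
    rw [hw, stripLow_add_width, stripUp_add_width, stripLow_zero, stripUp_zero, hl]
    have m1 := P.mark_le_first
    have m2 := P.mark_le_last
    have m3 := P.one_le_mark
    rw [P.low_first'] at m1
    unfold height
    exact ⟨by omega, by omega, by omega⟩

theorem stripLow_mono : Monotone P.stripLow :=
  monotone_int_of_le_succ fun j => (P.strip_step j).1

theorem stripUp_mono : Monotone P.stripUp :=
  monotone_int_of_le_succ fun j => (P.strip_step j).2.1

theorem ext_strip {P Q : PPP} (hw : P.width = Q.width) (hl : P.stripLow = Q.stripLow)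
    (hu : P.stripUp = Q.stripUp) : P = Q := by
  have hm : P.mark = Q.mark := by rw [← stripUp_neg_one, ← stripUp_neg_one, hu]
  have h1 := P.stripLow_coe
  have h2 := P.stripUp_coe
  have h3 := Q.stripLow_coe
  have h4 := Q.stripUp_coe
  rw [hl] at h1
  rw [hu] at h2
  generalize Q.stripLow = f at *
  generalize Q.stripUp = g at *
  obtain ⟨⟨n, hn, lo, u, _, _, _, _⟩, m, _, _, _⟩ := P
  obtain ⟨⟨n', hn', lo', u', _, _, _, _⟩, m', _, _, _⟩ := Q
  simp only at hw
  subst hw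
  have e1 : lo = lo' := funext fun i => (h1 i).symm.trans (h3 i)
  have e2 : u = u' := funext fun i => (h2 i).symm.trans (h4 i)
  simp only at hm
  subst e1 e2 hm
  rfl

/-- The periodic parallelogram polyomino read off the infinite strip of `P` by starting at its
column `s`; the marked cell is at the level of the topmost cell of column `s - 1`. -/
def shift (s : ℤ) : PPP where
  width := P.width
  width_pos := P.width_pos
  low i := P.stripLow (s + (i : ℕ)) - P.stripLow s
  up i := P.stripUp (s + (i : ℕ)) - P.stripLow s
  low_mono i j h := by
    have h' : (i : ℕ) ≤ j := h
    have := P.stripLow_mono (show s + ((i : ℕ) : ℤ) ≤ s + (j : ℕ) by omega)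
    show _ - _ ≤ _ - _
    omega
  up_mono i j h := by
    have h' : (i : ℕ) ≤ j := h
    have := P.stripUp_mono (show s + ((i : ℕ) : ℤ) ≤ s + (j : ℕ) by omega)
    show _ - _ ≤ _ - _
    omega
  low_first := by simp
  low_lt_up i j h := by
    have h1 := P.stripLow_mono (show s + ((j : ℕ) : ℤ) ≤ s + (i : ℕ) + 1 by omega)
    have h2 := (P.strip_step (s + (i : ℕ))).2.2
    omega
  mark := P.stripUp (s - 1) - P.stripLow s
  one_le_mark := by
    have h := (P.strip_step (s - 1)).2.2
    rw [sub_add_cancel] at h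
    omega
  mark_le_first := by
    have h := (P.strip_step (s - 1)).2.1
    rw [sub_add_cancel] at h
    simp [ParallelogramPolyomino.first]
    omega
  mark_le_last := by
    have hw := P.width_pos
    have h1 := P.stripUp_add_width (s - 1) 1
    have h2 := P.stripLow_add_width s 1
    have h3 := (P.strip_step (s + (P.width - 1))).1
    have e1 : s - 1 + 1 * (P.width : ℤ) = s + (P.width - 1) := by ring
    have e2 : s + (P.width - 1) + 1 = s + 1 * (P.width : ℤ) := by ring
    have e3 : ((P.width - 1 : ℕ) : ℤ) = P.width - 1 := by omega
    rw [e1] at h1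
    rw [e2] at h3
    simp only [ParallelogramPolyomino.last, e3]
    omega

@[simp] theorem shift_width (s : ℤ) : (P.shift s).width = P.width := rfl

@[simp] theorem shift_height (s : ℤ) : (P.shift s).height = P.height := by
  have hw := P.width_pos
  have h1 := P.stripUp_add_width (s - 1) 1
  have e1 : s - 1 + 1 * (P.width : ℤ) = s + (P.width - 1) := by ring
  have e3 : ((P.width - 1 : ℕ) : ℤ) = P.width - 1 := by omega
  rw [e1] at h1
  show P.stripUp (s + ((P.width - 1 : ℕ) : ℤ)) - P.stripLow s -
    (P.stripUp (s - 1) - P.stripLow s) = P.height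
  rw [e3]
  omega

theorem shift_stripLow (s j : ℤ) :
    (P.shift s).stripLow j = P.stripLow (s + j) - P.stripLow s := by
  obtain ⟨i, q, rfl⟩ := (P.shift s).exists_index j
  have e := P.stripLow_add_width (s + (i : ℕ)) q
  rw [stripLow_add_width, stripLow_coe, shift_height, ← add_assoc]
  show P.stripLow (s + (i : ℕ)) - P.stripLow s + q * P.height =
    P.stripLow (s + (i : ℕ) + q * P.width) - P.stripLow s
  rw [e]
  ring

theorem shift_stripUp (s j : ℤ) :
    (P.shift s).stripUp j = P.stripUp (s + j) - P.stripLow s := by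
  obtain ⟨i, q, rfl⟩ := (P.shift s).exists_index j
  have e := P.stripUp_add_width (s + (i : ℕ)) q
  rw [stripUp_add_width, stripUp_coe, shift_height, ← add_assoc]
  show P.stripUp (s + (i : ℕ)) - P.stripLow s + q * P.height =
    P.stripUp (s + (i : ℕ) + q * P.width) - P.stripLow s
  rw [e]
  ring

theorem mem_shift_strip (s j y : ℤ) :
    (j, y) ∈ (P.shift s).strip ↔ (j + s, y + P.stripLow s) ∈ P.strip := by
  simp only [strip, Set.mem_ofPred_eq, shift_stripLow, shift_stripUp, add_comm s j]
  constructor <;> rintro ⟨h1, h2⟩ <;> constructor <;> omega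

theorem shift_zero : P.shift 0 = P :=
  ext_strip rfl (by ext j; simp [shift_stripLow, stripLow_zero])
    (by ext j; simp [shift_stripUp, stripLow_zero])

theorem shift_shift (s t : ℤ) : (P.shift s).shift t = P.shift (s + t) :=
  ext_strip rfl (by ext j; simp [shift_stripLow, add_assoc])
    (by ext j; simp [shift_stripUp, shift_stripLow, add_assoc])

theorem isDegenerate_iff : P.IsDegenerate ↔ P.height = 0 := by
  have h1 := P.mark_le_first
  have h2 := P.mark_le_last
  rw [P.low_first'] at h1
  have h4 (i : Fin P.width) : P.first ≤ i := Fin.mk_le_mk.2 (Nat.zero_le _)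
  have h5 (i : Fin P.width) : i ≤ P.last := Fin.mk_le_mk.2 (by have := i.2; omega)
  have h6 := P.low_first'
  constructor
  · rintro ⟨h, hm⟩
    have := (h P.last).2
    unfold height
    omega
  · intro h
    unfold height at h
    have h7 := P.low_mono (h4 P.last)
    have h8 := P.up_mono (h4 P.last)
    refine ⟨fun i => ?_, by omega⟩
    have a := P.low_mono (h4 i)
    have b := P.up_mono (h4 i)
    have c := P.low_mono (h5 i)
    have d := P.up_mono (h5 i)
    exact ⟨by omega, by omega⟩

end PPP

/-- The non-degenerated periodic parallelogram polyominoes. -/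
def PPPStar : Type := {P : PPP // ¬ P.IsDegenerate}

/-- The rotation `r`: the first column is moved to the last position, respecting the marking, and
the former second column is marked at the level of the topmost cell of the former first column. -/
def columnRotation : Equiv.Perm PPPStar where
  toFun P := ⟨P.1.shift 1, by rw [PPP.isDegenerate_iff, PPP.shift_height, ← PPP.isDegenerate_iff]
                              exact P.2⟩
  invFun P := ⟨P.1.shift (-1), by
    rw [PPP.isDegenerate_iff, PPP.shift_height, ← PPP.isDegenerate_iff]
    exact P.2⟩
  left_inv P := Subtype.ext (by simp [PPP.shift_shift, PPP.shift_zero])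
  right_inv P := Subtype.ext (by simp [PPP.shift_shift, PPP.shift_zero])

/-- Strips: the orbits of the group generated by the rotation. -/
abbrev Strip : Type := MulAction.orbitRel.Quotient (Subgroup.zpowers columnRotation) PPPStar

/-! ### The ordered cyclic forest

It is described on the cells of the infinite strip, whose vertices, modulo the translations by the
multiples of `(width, height)`, are the vertices of the ordered cyclic forest of the PPP. Cells are
pairs (column, row). -/

/-- `c` is the topmost cell of its column in `S`. -/
def IsTopmost (S : Set (ℤ × ℤ)) (c : ℤ × ℤ) : Prop := c ∈ S ∧ (c.1, c.2 + 1) ∉ S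

/-- `c` is the rightmost cell of its row in `S`. -/
def IsRightmost (S : Set (ℤ × ℤ)) (c : ℤ × ℤ) : Prop := c ∈ S ∧ (c.1 + 1, c.2) ∉ S

/-- The vertex `f` is the father of the vertex `c`: if `c` is the topmost cell of a column then `f`
is the rightmost cell of the row of `c`, and if `c` is the rightmost cell of a row then `f` is the
topmost cell of the column of `c`. -/
def IsFather (S : Set (ℤ × ℤ)) (f c : ℤ × ℤ) : Prop :=
  (IsTopmost S c ∧ IsRightmost S f ∧ f.2 = c.2) ∨
    (IsRightmost S c ∧ IsTopmost S f ∧ f.1 = c.1)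

/-- A leaf: a vertex without sons. -/
def IsLeaf (S : Set (ℤ × ℤ)) (c : ℤ × ℤ) : Prop :=
  (IsTopmost S c ∨ IsRightmost S c) ∧ ∀ c', ¬ IsFather S c c'

/-- `Q` is obtained from `P` by deleting the column, or the row, corresponding to a leaf of the
ordered cyclic forest.  The maps `c` and `r` enumerate increasingly the remaining columns and rows
of the infinite strip.  (The result is determined up to rotation.) -/
def PruneStep (P Q : PPPStar) : Prop :=
  ∃ s : ℤ × ℤ, IsLeaf P.1.strip s ∧ ∃ c r : ℤ ↪o ℤ,
    (∀ j y, (j, y) ∈ Q.1.strip ↔ (c j, r y) ∈ P.1.strip) ∧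
    ((IsTopmost P.1.strip s ∧
        Q.1.width + 1 = P.1.width ∧ Set.range c = {j | ¬ (P.1.width : ℤ) ∣ j - s.1} ∧
        Q.1.height = P.1.height ∧ Set.range r = Set.univ) ∨
      (IsRightmost P.1.strip s ∧
        Q.1.width = P.1.width ∧ Set.range c = Set.univ ∧
        Q.1.height + 1 = P.1.height ∧ Set.range r = {y | ¬ P.1.height ∣ y - s.2}))

/-- `T` is a trunk (no leaf is left to prune) with upper path `N^k (NE)^l` and lower path
`(EN)^l N^k`, where `l` is the width of `T`. -/
def IsTrunk (T : PPPStar) (k : ℕ) : Prop :=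
  0 < k ∧ (∀ s, ¬ IsLeaf T.1.strip s) ∧
    ∀ i, T.1.low i = (i : ℕ) ∧ T.1.up i = (i : ℕ) + k + 1

/-- The complete pruning of `P` leads to a trunk with parameter `k`. -/
def HasThickness (P : PPPStar) (k : ℕ) : Prop :=
  ∃ T, Relation.ReflTransGen PruneStep P T ∧ IsTrunk T k

/-- The intrinsic thickness of `P`: the integer `k` of the trunk of `P`. -/
noncomputable def PPPStar.thickness (P : PPPStar) : ℕ := sInf {k | HasThickness P k}

/-! ### The statistics are invariant under rotation -/

theorem PruneStep.of_translate {P P' Q : PPPStar} (hw : P'.1.width = P.1.width)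
    (hh : P'.1.height = P.1.height) (a b : ℤ)
    (hS : ∀ j y, (j, y) ∈ P'.1.strip ↔ (j + a, y + b) ∈ P.1.strip) (h : PruneStep P Q) :
    PruneStep P' Q := by
  obtain ⟨⟨x, z⟩, hs, c, r, hcr, h⟩ := h
  have hT (j y : ℤ) : IsTopmost P'.1.strip (j, y) ↔ IsTopmost P.1.strip (j + a, y + b) := by
    simp only [IsTopmost, hS, add_right_comm]
  have hR (j y : ℤ) : IsRightmost P'.1.strip (j, y) ↔ IsRightmost P.1.strip (j + a, y + b) := by
    simp only [IsRightmost, hS, add_right_comm]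
  refine ⟨(x - a, z - b), ⟨?_, ?_⟩, c.trans (OrderIso.addRight (-a)).toOrderEmbedding,
    r.trans (OrderIso.addRight (-b)).toOrderEmbedding, ?_, ?_⟩
  · simpa [hT, hR] using hs.1
  · rintro ⟨j, y⟩ hf
    apply hs.2 (j + a, y + b)
    simp only [IsFather, hT, hR, sub_add_cancel] at hf ⊢
    rcases hf with ⟨h1, h2, h3⟩ | ⟨h1, h2, h3⟩
    · exact Or.inl ⟨h1, h2, by omega⟩
    · exact Or.inr ⟨h1, h2, by omega⟩
  · intro j y
    rw [hcr, hS]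
    simp
  · have key (f : ℤ ↪o ℤ) (d : ℤ) (A : Set ℤ) (hA : Set.range f = A) :
        Set.range (f.trans (OrderIso.addRight (-d)).toOrderEmbedding) = {j | j + d ∈ A} := by
      subst hA
      ext j
      simp only [Set.mem_range, Set.mem_ofPred_eq, RelEmbedding.coe_trans, Function.comp]
      constructor
      · rintro ⟨i, rfl⟩
        exact ⟨i, by simp⟩
      · rintro ⟨i, hi⟩
        exact ⟨i, by simp [hi]⟩
    rcases h with ⟨h1, h2, h3, h4, h5⟩ | ⟨h1, h2, h3, h4, h5⟩
    · refine Or.inl ⟨by simpa [hT] using h1, by omega, ?_, by omega, ?_⟩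
      · rw [key c a _ h3, hw]
        ext j
        simp only [Set.mem_ofPred_eq, sub_sub_eq_add_sub]
      · rw [key r b _ h5]
        simp
    · refine Or.inr ⟨by simpa [hR] using h1, by omega, ?_, by omega, ?_⟩
      · rw [key c a _ h3]
        simp
      · rw [key r b _ h5, hh]
        ext j
        simp only [Set.mem_ofPred_eq, sub_sub_eq_add_sub]

theorem IsTrunk.strip_eq {T : PPPStar} {k : ℕ} (h : IsTrunk T k) :
    ∀ j, T.1.stripLow j = j ∧ T.1.stripUp j = j + k + 1 := by
  obtain ⟨hk, hleaf, hT⟩ := h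
  obtain ⟨P, hP⟩ := T
  simp only at hleaf hT ⊢
  have hw := P.width_pos
  have hpos : 0 < P.height := by
    rw [PPP.isDegenerate_iff] at hP
    have := P.height_nonneg
    omega
  have l0 := P.stripLow_zero
  have u0 : P.stripUp 0 = k + 1 := by
    rw [P.stripUp_zero, (hT _).2]
    simp [ParallelogramPolyomino.first]
  have ll : P.stripLow (-1) = P.width - 1 - P.height := by
    have := P.stripLow_add_width (P.width - 1) (-1)
    rw [show (P.width - 1 : ℤ) + -1 * P.width = -1 by ring, P.stripLow_last, (hT _).1,
      P.coe_last] at this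
    linarith
  have ul : P.stripUp (-1) = P.width + k - P.height := by
    have := P.stripUp_add_width (P.width - 1) (-1)
    rw [show (P.width - 1 : ℤ) + -1 * P.width = -1 by ring, P.stripUp_last, (hT _).2,
      P.coe_last] at this
    linarith
  have s1 := P.strip_step (-1)
  rw [neg_add_cancel, l0, u0] at s1
  obtain ⟨s1, s2, s3⟩ := s1
  have ge : (P.width : ℤ) ≤ P.height := by
    by_contra hlt
    have htop : IsTopmost P.strip (-1, P.stripUp (-1) - 1) := by
      simp only [IsTopmost, PPP.strip, Set.mem_ofPred_eq]
      exact ⟨⟨by omega, by omega⟩, by omega⟩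
    apply hleaf (-1, P.stripUp (-1) - 1)
    refine ⟨Or.inl htop, ?_⟩
    rintro ⟨j, y⟩ (⟨h1, h2, h3⟩ | ⟨h1, h2, h3⟩)
    · simp only [IsRightmost, PPP.strip, Set.mem_ofPred_eq, neg_add_cancel, l0, u0] at h2
      omega
    · simp only at h3
      subst h3
      simp only [IsRightmost, PPP.strip, Set.mem_ofPred_eq, neg_add_cancel, l0, u0] at h1
      omega
  have le : P.height ≤ P.width := by
    by_contra hlt
    obtain ⟨j, hj⟩ : ∃ j : ℤ, IsRightmost P.strip (j, P.stripUp (-1)) := by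
      by_contra hno
      push Not at hno
      have hall : ∀ n : ℕ, ((n : ℤ), P.stripUp (-1)) ∈ P.strip := by
        intro n
        induction n with
        | zero =>
          simp only [PPP.strip, Set.mem_ofPred_eq, Nat.cast_zero, l0, u0]
          omega
        | succ n ih =>
          by_contra hn
          exact hno n ⟨ih, by simpa using hn⟩
      have := hall ((P.stripUp (-1)).toNat.succ * P.width)
      have e := P.stripLow_add_width 0 ((P.stripUp (-1)).toNat.succ)
      rw [zero_add, l0] at e
      simp only [PPP.strip, Set.mem_ofPred_eq] at this
      push_cast at this e
      rw [e] at this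
      have h1 := this.1
      have h2 : (0 : ℤ) ≤ P.stripUp (-1) := by omega
      rw [Int.toNat_of_nonneg h2] at h1
      nlinarith
    refine hleaf (j, P.stripUp (-1)) ⟨Or.inr hj, ?_⟩
    rintro ⟨i, y⟩ (⟨h1, h2, h3⟩ | ⟨h1, h2, h3⟩)
    · simp only at h3
      subst h3
      simp only [IsTopmost, PPP.strip, Set.mem_ofPred_eq] at h1
      rcases le_or_gt i (-1) with hi | hi
      · have := P.stripUp_mono hi
        omega
      · have a1 := P.stripUp_mono (show (0 : ℤ) ≤ i by omega)
        omega
    · have b1 := (P.strip_step j).2.1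
      have b2 := (P.strip_step j).2.2
      simp only [IsTopmost, IsRightmost, PPP.strip, Set.mem_ofPred_eq] at hj h2
      omega
  have hh : P.height = P.width := by omega
  intro j
  obtain ⟨i, q, rfl⟩ := P.exists_index j
  rw [P.stripLow_add_width, P.stripUp_add_width, P.stripLow_coe, P.stripUp_coe, hh,
    (hT i).1, (hT i).2]
  exact ⟨rfl, by ring⟩

theorem IsTrunk.rotation_eq {T : PPPStar} {k : ℕ} (h : IsTrunk T k) : columnRotation T = T := by
  have e := h.strip_eq
  refine Subtype.ext (PPP.ext_strip rfl ?_ ?_)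
  · ext j
    show (T.1.shift 1).stripLow j = _
    simp [PPP.shift_stripLow, e]
  · ext j
    show (T.1.shift 1).stripUp j = _
    simp only [PPP.shift_stripUp, e]
    ring

theorem HasThickness.rotation_iff (P : PPPStar) (k : ℕ) :
    HasThickness (columnRotation P) k ↔ HasThickness P k := by
  constructor
  · rintro ⟨T, hPT, hT⟩
    rcases Relation.ReflTransGen.cases_head hPT with h | ⟨Q, hQ, hQT⟩
    · refine ⟨T, ?_, hT⟩
      have : P = T := columnRotation.injective (h.trans hT.rotation_eq.symm)
      rw [this]
    · refine ⟨T, Relation.ReflTransGen.head ?_ hQT, hT⟩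
      refine PruneStep.of_translate (P := columnRotation P) (P' := P) (P.1.shift_width 1).symm
        (P.1.shift_height 1).symm (-1) (-P.1.stripLow 1) (fun j y => ?_) hQ
      show _ ↔ _ ∈ (P.1.shift 1).strip
      simp [PPP.mem_shift_strip]
  · rintro ⟨T, hPT, hT⟩
    rcases Relation.ReflTransGen.cases_head hPT with h | ⟨Q, hQ, hQT⟩
    · subst h
      exact ⟨P, by rw [hT.rotation_eq], hT⟩
    · refine ⟨T, Relation.ReflTransGen.head ?_ hQT, hT⟩
      exact hQ.of_translate (P' := columnRotation P) (P.1.shift_width 1) (P.1.shift_height 1)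
        1 (P.1.stripLow 1) fun j y => P.1.mem_shift_strip 1 j y

/-- A statistic that is invariant under the rotation is constant on strips. -/
theorem eq_of_orbitRel {α : Type} (f : PPPStar → α) (hf : ∀ P, f (columnRotation P) = f P)
    (P Q : PPPStar) (h : MulAction.orbitRel (Subgroup.zpowers columnRotation) PPPStar P Q) :
    f P = f Q := by
  obtain ⟨⟨g, hg⟩, rfl⟩ := h
  obtain ⟨n, rfl⟩ := Subgroup.mem_zpowers_iff.1 hg
  show f ((columnRotation ^ n) Q) = f Q
  induction n using Int.induction_on with
  | zero => rfl
  | succ n ih =>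
    rw [add_comm, zpow_add, zpow_one, Equiv.Perm.mul_apply, hf]
    exact ih ⟨n, rfl⟩
  | pred n ih =>
    rw [← hf, ← Equiv.Perm.mul_apply, ← zpow_one_add, add_sub_cancel]
    exact ih ⟨-n, rfl⟩

/-- The semi-perimeter of a strip. -/
def Strip.semiPerimeter (b : Strip) : ℕ :=
  Quotient.lift (fun P : PPPStar => P.1.semiPerimeter)
    (eq_of_orbitRel _ fun P => by
      show P.1.width + ((P.1.shift 1).height).toNat = P.1.width + P.1.height.toNat
      rw [PPP.shift_height]) b

/-- The intrinsic thickness of a strip. -/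
noncomputable def Strip.thickness (b : Strip) : ℕ :=
  Quotient.lift PPPStar.thickness
    (eq_of_orbitRel _ fun P => by simp only [PPPStar.thickness, HasThickness.rotation_iff]) b

/-! ### Generating functions

A series in `z` is an element of `ℚ⟦X⟧` with `X = z`, and a series in `z` and `t` is an element of
`ℚ⟦X⟧⟦X⟧`, whose outer variable is `t`. -/

/-- `B(z, t) = ∑ t ^ it(b) z ^ sp(b)`, the sum being over all strips `b`. -/
noncomputable def stripSeries : ℚ⟦X⟧⟦X⟧ :=
  PowerSeries.mk fun k => PowerSeries.mk fun n =>
    (Nat.card {b : Strip // b.thickness = k ∧ b.semiPerimeter = n} : ℚ)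

/-- Ordered (plane) trees: a root with an ordered list of subtrees. -/
inductive OrderedTree : Type
  | node (children : List OrderedTree) : OrderedTree

/-- The number of non-root vertices of an ordered tree. -/
def OrderedTree.nonRoot : OrderedTree → ℕ
  | .node cs => (cs.map fun c => c.nonRoot + 1).sum

/-- `A(z)`: the generating function of ordered trees by number of non-root vertices. -/
noncomputable def treeSeries : ℚ⟦X⟧ :=
  PowerSeries.mk fun n => (Nat.card {T : OrderedTree // T.nonRoot = n} : ℚ)

/-- `√(1 - 4z)`, the binomial series `(1 + x) ^ (1 / 2)` at `x = -4z`. -/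
noncomputable def sqrtOneSubFourX : ℚ⟦X⟧ :=
  PowerSeries.rescale (-4 : ℚ) (PowerSeries.binomialSeries ℚ (1 / 2 : ℚ))

/-- `G(z) = z² A(z)⁴`. -/
noncomputable def tupleSeries : ℚ⟦X⟧ := PowerSeries.X ^ 2 * treeSeries ^ 4

/-- `(φ(i) / i) log (1 - G(z ^ i))`. -/
noncomputable def logTerm (i : ℕ+) : ℚ⟦X⟧ :=
  PowerSeries.C ((Nat.totient i : ℚ) / (i : ℕ)) *
    PowerSeries.logOf (1 - PowerSeries.expand (i : ℕ) i.ne_zero tupleSeries)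

/-!
The proof translates polyominoes into maps of the integers. Unrolled along the infinite strip, the
graph `Φ(P)` has as vertices the columns and the rows, two copies of `ℤ`, and it is given by two
monotone father maps between these copies which commute with the period (`PeriodicForest`). Such
a pair of maps comes from a polyomino if and only if every column lies strictly to the left of its
grandfather (`PPPStar.exists_forest_eq`), and two polyominoes lie on the same strip if and only if
their forests differ by a renumbering of the columns and of the rows (`PPPStar.orbitRel_iff`).

The vertices on bi-infinite branches form the core. Between consecutive core vertices the father
maps shift the core by constants, and the core is unique (`PeriodicForest.IsCore.unique`). Pruning
a leaf does not change it, and pruning ends at a forest that is its own core, so the thickness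
exists, is unique, and is the shift of the core in two generations (`PPPStar.hasThickness_iff`).

A strip of thickness `k` is therefore an orbit of forests with a marked core vertex under moving the
mark (`MarkedForest.nonempty_orbits_equiv`). The number of marked forests with `l` core vertices of
each kind in a period does not depend on the shift of the core
(`MarkedForest.nonempty_ofSize_equiv`): the trees that hang at the core can be reattached
along a core with another shift. This is made precise by reordering the vertices lexicographically
by the core vertex next to which they lie, their depth with a sign for the side of the core, and
their old position. It is convenient to take the shift `0`, although this is not the shift of a
polyomino. Then the graphs of the two father maps are lattice paths that meet at the core vertices.
Reading both paths simultaneously yields a walk on `ℤ` with one up step, one down step and two level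
steps, in which the core vertices are the steps `0 → 1`. First passage decompositions show that the
closed walks that start with such a step and have `l` of them are counted by `𝒢(z) ^ l`
(`MarkedForest.card_ofSize`).

Finally, the orbits are counted by Burnside's lemma (`card_orbits_mul_eq_sum`). A marked forest that
is fixed by moving the mark by `s` core vertices is one with `gcd (l, s)` core vertices of each
kind, read with a multiple of its period (`MarkedForest.card_move_fixed`). Hence the strips of a
fixed thickness with `l` core vertices of each kind have the generating function
`1 / l * ∑ φ(i) 𝒢(z ^ i) ^ (l / i)`, the sum being over the divisors `i` of `l`. The sum over `l` is
the expansion of the logarithms.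
-/

/-! ### Ordered trees -/

namespace OrderedTree

/-- The binary tree of an ordered tree: the left subtree encodes the first child of the root, the
right one what is left when this child is removed. -/
def toBinary : OrderedTree → BinaryTree Unit
  | .node [] => .nil
  | .node (c :: cs) => .node () c.toBinary (OrderedTree.node cs).toBinary

/-- The list of the subtrees at the root. -/
def children : OrderedTree → List OrderedTree
  | .node cs => cs

/-- The ordered tree encoded by a binary tree; the inverse of `OrderedTree.toBinary`. -/
def ofBinary : BinaryTree Unit → OrderedTree
  | .nil => .node []
  | .node _ a b => .node (ofBinary a :: (ofBinary b).children)

theorem toBinary_ofBinary : ∀ t, (ofBinary t).toBinary = t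
  | .nil => by rw [ofBinary, toBinary]
  | .node _ a b => by
    rw [ofBinary, toBinary, toBinary_ofBinary a,
      show OrderedTree.node (ofBinary b).children = ofBinary b by
        cases ofBinary b; rfl, toBinary_ofBinary b]

theorem ofBinary_toBinary : ∀ T : OrderedTree, ofBinary T.toBinary = T
  | .node [] => by rw [toBinary, ofBinary]
  | .node (c :: cs) => by
    rw [toBinary, ofBinary, ofBinary_toBinary c, ofBinary_toBinary (.node cs), children]

theorem numNodes_toBinary : ∀ T : OrderedTree, T.toBinary.numNodes = T.nonRoot
  | .node [] => by simp [toBinary, nonRoot]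
  | .node (c :: cs) => by
    rw [toBinary, BinaryTree.numNodes, numNodes_toBinary c, numNodes_toBinary (.node cs)]
    simp only [nonRoot, List.map_cons, List.sum_cons]
    omega

theorem card_nonRoot_eq (n : ℕ) : Nat.card {T : OrderedTree // T.nonRoot = n} = catalan n := by
  rw [← BinaryTree.treesOfNumNodesEq_card_eq_catalan n, ← Nat.card_eq_finsetCard]
  refine Nat.card_congr
    (Equiv.subtypeEquiv ⟨toBinary, ofBinary, ofBinary_toBinary, toBinary_ofBinary⟩ fun T => ?_)
  simp [numNodes_toBinary]

end OrderedTree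

theorem treeSeries_eq : treeSeries = 1 + PowerSeries.X * treeSeries ^ 2 := by
  have h : treeSeries = PowerSeries.map (Nat.castRingHom ℚ) PowerSeries.catalanSeries := by
    ext n
    simp [treeSeries, OrderedTree.card_nonRoot_eq]
  rw [h]
  conv_lhs => rw [← PowerSeries.catalanSeries_sq_mul_X_add_one]
  simp only [map_add, map_mul, map_pow, map_one, PowerSeries.map_X]
  ring

theorem sqrtOneSubFourX_sq : sqrtOneSubFourX ^ 2 = 1 - 4 * PowerSeries.X := by
  have h : PowerSeries.binomialSeries ℚ (1 / 2 : ℚ) ^ 2 = 1 + PowerSeries.X := by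
    rw [sq, ← PowerSeries.binomialSeries_add]
    have := PowerSeries.binomialSeries_nat (R := ℚ) (A := ℚ) 1
    norm_num at this ⊢
    exact this
  rw [sqrtOneSubFourX, ← map_pow, h, map_add, map_one, PowerSeries.rescale_X]
  rw [map_neg, sub_eq_add_neg, neg_mul]
  rfl

theorem two_mul_X_mul_treeSeries : 2 * PowerSeries.X * treeSeries = 1 - sqrtOneSubFourX := by
  have h1 : (1 - 2 * PowerSeries.X * treeSeries) ^ 2 = sqrtOneSubFourX ^ 2 := by
    rw [sqrtOneSubFourX_sq]
    linear_combination (-4 * PowerSeries.X : ℚ⟦X⟧) * treeSeries_eq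
  rcases sq_eq_sq_iff_eq_or_eq_neg.1 h1 with h | h
  · linear_combination -h
  · have := congrArg PowerSeries.constantCoeff h
    have h0 : PowerSeries.constantCoeff sqrtOneSubFourX = 1 := by
      rw [sqrtOneSubFourX, ← PowerSeries.coeff_zero_eq_constantCoeff_apply,
        PowerSeries.coeff_rescale, PowerSeries.coeff_zero_eq_constantCoeff_apply,
        PowerSeries.binomialSeries_constantCoeff, pow_zero, mul_one]
    simp only [map_sub, map_mul, map_one, PowerSeries.constantCoeff_X, map_neg, h0] at this
    norm_num at this

/-! ### Enumerations of linear orders by the integers -/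

theorem exists_orderIso_int {α : Type*} [LinearOrder α] (hfin : ∀ a b : α, (Set.Icc a b).Finite)
    (hmax : ∀ a : α, ∃ b, a < b) (hmin : ∀ a : α, ∃ b, b < a) (a₀ : α) :
    ∃ ψ : α ≃o ℤ, ψ a₀ = 0 := by
  classical
  let _ : LocallyFiniteOrder α := LocallyFiniteOrder.ofFiniteIcc hfin
  let _ : SuccOrder α := LinearLocallyFiniteOrder.succOrder α
  let _ : PredOrder α := LinearLocallyFiniteOrder.predOrder α
  have : NoMaxOrder α := ⟨hmax⟩
  have : NoMinOrder α := ⟨hmin⟩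
  have : Nonempty α := ⟨a₀⟩
  let e : α ≃o ℤ := orderIsoIntOfLinearSuccPredArch
  exact ⟨e.trans (OrderIso.addRight (-e a₀)), by simp⟩

theorem strictMono_int_eq_shift {x y : ℤ → ℤ} (hx : StrictMono x) (hy : StrictMono y)
    (h : Set.range x = Set.range y) : ∃ a, ∀ i, y i = x (i + a) := by
  have h1 : ∀ i, ∃ j, x j = y i := fun i => by
    have : y i ∈ Set.range x := h ▸ Set.mem_range_self i
    exact this
  choose g hg using h1
  have hgm : StrictMono g := fun i j hij => hx.lt_iff_lt.1 (by rw [hg, hg]; exact hy hij)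
  have hgs : Function.Surjective g := fun j => by
    obtain ⟨i, hi⟩ : x j ∈ Set.range y := h ▸ Set.mem_range_self j
    exact ⟨i, hx.injective (by rw [hg, hi])⟩
  have hstep : ∀ i, g (i + 1) = g i + 1 := fun i => by
    obtain ⟨j, hj⟩ := hgs (g i + 1)
    have h2 := hgm (show i < i + 1 by omega)
    have h3 : i < j := hgm.lt_iff_lt.1 (by omega)
    have h4 := hgm.monotone (show i + 1 ≤ j by omega)
    omega
  have hall : ∀ i, g i = i + g 0 := fun i => by
    induction i using Int.induction_on with
    | zero => simp
    | succ i ih => rw [hstep, ih]; ring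
    | pred i ih =>
      have := hstep (-i - 1)
      rw [sub_add_cancel, ih] at this
      omega
  exact ⟨g 0, fun i => by rw [← hall, hg]⟩

open Classical in
/-- A nonempty periodic set of integers is enumerated increasingly by a map that is periodic as
well; its period is the number of elements of the set in a period of the set. -/
theorem exists_periodic_enumeration {Q : Set ℤ} {n : ℕ} (hn : 0 < n)
    (hQ : ∀ j : ℤ, j + n ∈ Q ↔ j ∈ Q) {q : ℤ} (hq : q ∈ Q) :
    ∃ x : ℤ → ℤ, StrictMono x ∧ Set.range x = Q ∧ x 0 = q ∧
      ∀ i, x (i + ((Finset.Ico q (q + n)).filter (· ∈ Q)).card) = x i + n := by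
  have hQ' : ∀ j : ℤ, j - n ∈ Q ↔ j ∈ Q := fun j => by rw [← hQ, sub_add_cancel]
  obtain ⟨ψ, hψ⟩ := exists_orderIso_int (α := Q)
    (fun a b => Set.Finite.of_injOn (f := Subtype.val) (t := Set.Icc a.1 b.1)
      (fun c hc => hc) Subtype.val_injective.injOn (Set.finite_Icc _ _))
    (fun a => ⟨⟨a + n, (hQ _).2 a.2⟩, by rw [← Subtype.coe_lt_coe]; dsimp only; omega⟩)
    (fun a => ⟨⟨a - n, (hQ' _).2 a.2⟩, by rw [← Subtype.coe_lt_coe]; dsimp only; omega⟩) ⟨q, hq⟩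
  let x : ℤ → ℤ := fun i => ψ.symm i
  have hx : StrictMono x := fun i j hij => ψ.symm.strictMono hij
  have hr : Set.range x = Q := by
    ext j
    constructor
    · rintro ⟨i, rfl⟩
      exact (ψ.symm i).2
    · intro hj
      exact ⟨ψ ⟨j, hj⟩, by simp [x]⟩
  have hx0 : x 0 = q := by simp [x, ← hψ]
  obtain ⟨a, ha⟩ := strictMono_int_eq_shift hx (y := fun i => x i + n)
    (fun i j hij => by have := hx hij; dsimp only; omega) (by
      ext j
      rw [hr]
      constructor
      · intro hj
        obtain ⟨i, hi⟩ : j - n ∈ Set.range x := hr ▸ (hQ' _).2 hj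
        exact ⟨i, by dsimp only; omega⟩
      · rintro ⟨i, rfl⟩
        exact (hQ _).2 (hr ▸ Set.mem_range_self i))
  refine ⟨x, hx, hr, hx0, fun i => ?_⟩
  have ha0 := ha 0
  rw [zero_add, hx0] at ha0
  have hapos : 0 < a := hx.lt_iff_lt.1 (by rw [hx0]; omega)
  have hcard : (Finset.Ico q (q + n)).filter (· ∈ Q) = (Finset.Ico 0 a).image x := by
    ext j
    simp only [Finset.mem_filter, Finset.mem_Ico, Finset.mem_image]
    constructor
    · rintro ⟨⟨h1, h2⟩, h3⟩
      obtain ⟨i, rfl⟩ : j ∈ Set.range x := hr ▸ h3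
      exact ⟨i, ⟨hx.le_iff_le.1 (by omega), hx.lt_iff_lt.1 (by omega)⟩, rfl⟩
    · rintro ⟨i, ⟨h1, h2⟩, rfl⟩
      have := hx.monotone h1
      have := hx h2
      exact ⟨⟨by omega, by omega⟩, hr ▸ Set.mem_range_self i⟩
  rw [hcard, Finset.card_image_of_injective _ hx.injective, Int.card_Ico, sub_zero,
    Int.toNat_of_nonneg hapos.le, ← ha]

/-- A monotone unbounded map between integers has a lower adjoint. -/
theorem exists_lowerAdjoint {g : ℤ → ℤ} (hg : Monotone g) (h1 : ∀ j, ∃ y, j ≤ g y)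
    (h2 : ∀ j, ∃ y, g y < j) : ∃ L : ℤ → ℤ, ∀ j y, L j ≤ y ↔ j ≤ g y := by
  have key : ∀ j, ∃ m, ∀ y, m ≤ y ↔ j ≤ g y := fun j => by
    obtain ⟨b, hb⟩ := h2 j
    obtain ⟨m, hm, hmin⟩ := Int.exists_least_of_bdd (P := fun y => j ≤ g y)
      ⟨b, fun z hz => by
        by_contra hlt
        have := hg (show z ≤ b by omega)
        omega⟩ (h1 j)
    exact ⟨m, fun y => ⟨fun h => hm.trans (hg h), hmin y⟩⟩
  choose L hL using key
  exact ⟨L, hL⟩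

/-- A monotone unbounded map between integers has an upper adjoint. -/
theorem exists_upperAdjoint {L : ℤ → ℤ} (hL : Monotone L) (h1 : ∀ y, ∃ j, y < L j)
    (h2 : ∀ y, ∃ j, L j ≤ y) : ∃ g : ℤ → ℤ, ∀ j y, L j ≤ y ↔ j ≤ g y := by
  have key : ∀ y, ∃ m, ∀ j, L j ≤ y ↔ j ≤ m := fun y => by
    obtain ⟨b, hb⟩ := h1 y
    obtain ⟨m, hm, hmax⟩ := Int.exists_greatest_of_bdd (P := fun j => L j ≤ y)
      ⟨b, fun z hz => by
        by_contra hlt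
        have := hL (show b ≤ z by omega)
        omega⟩ (h2 y)
    exact ⟨m, fun j => ⟨hmax j, fun h => (hL h).trans hm⟩⟩
  choose g hg using key
  exact ⟨g, fun j y => hg y j⟩

/-! ### Periodic forests -/

/-- The father map of an ordered cyclic forest, unrolled along the infinite strip.  The columns and
the rows are two copies of `ℤ`, indexed by `false` and `true`; the father of the vertex `j` of kind
`b` is the vertex `father b j` of the other kind, and everything is invariant under the translation
by `period`. -/
@[ext] structure PeriodicForest where
  period : Bool → ℕ
  father : Bool → ℤ → ℤ
  period_pos : ∀ b, 0 < period b
  mono : ∀ b, Monotone (father b)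
  father_add : ∀ b j, father b (j + period b) = father b j + period (!b)

namespace PeriodicForest

variable (F : PeriodicForest)

/-- The father of a vertex, as a self-map of the set of all vertices. -/
def step (v : Bool × ℤ) : Bool × ℤ := (!v.1, F.father v.1 v.2)

/-- `x b i` enumerates the core of the forest, that is, the vertices on the bi-infinite branches.
The core has `l` vertices of each kind in a period, the father of the `i`-th core vertex of kind
`b` is the core vertex of the other kind with the index `i + k b`, and every vertex has a core
vertex among its ancestors. -/
structure IsCore (k : Bool → ℤ) (l : ℕ) (x : Bool → ℤ → ℤ) : Prop where
  strictMono : ∀ b, StrictMono (x b)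
  add_period : ∀ b i, x b (i + l) = x b i + F.period b
  father_core : ∀ b i, F.father b (x b i) = x (!b) (i + k b)
  reach : ∀ v, ∃ m i, (F.step^[m] v).2 = x (F.step^[m] v).1 i

/-- The number of generations between a vertex and its first ancestor in the core `x`. -/
noncomputable def depth (x : Bool → ℤ → ℤ) (v : Bool × ℤ) : ℕ :=
  sInf {m | ∃ i, (F.step^[m] v).2 = x (F.step^[m] v).1 i}

/-- The index of the first ancestor in the core `x`. -/
noncomputable def rootIndex (x : Bool → ℤ → ℤ) (v : Bool × ℤ) : ℤ :=
  Classical.epsilon fun i =>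
    (F.step^[F.depth x v] v).2 = x (F.step^[F.depth x v] v).1 i

/-- The total shift of the core index along `m` generations that start with the kind `b`. -/
def shiftSum (κ : Bool → ℤ) : Bool → ℕ → ℤ
  | _, 0 => 0
  | b, m + 1 => κ b + shiftSum κ (!b) m

/-- The index of the core vertex next to which a vertex lies if the core is shifted by `κ`: the
core vertex that has, after sufficiently many generations, the same ancestor. -/
noncomputable def level (κ : Bool → ℤ) (x : Bool → ℤ → ℤ) (v : Bool × ℤ) : ℤ :=
  F.rootIndex x v - shiftSum κ v.1 (F.depth x v)

/-- The depth, with a negative sign for the vertices that precede the core vertex of the same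
level. -/
noncomputable def signedDepth (k : Bool → ℤ) (x : Bool → ℤ → ℤ) (v : Bool × ℤ) : ℤ :=
  if v.2 < x v.1 (F.level k x v) then -(F.depth x v : ℤ) else F.depth x v

theorem step_add_period (b : Bool) (j : ℤ) :
    F.step (b, j + F.period b) = (!b, F.father b j + F.period (!b)) := by
  simp [step, F.father_add]

namespace IsCore

variable {F} {k : Bool → ℤ} {l : ℕ} {x : Bool → ℤ → ℤ} (h : F.IsCore k l x)
include h

theorem l_pos : 0 < l := by
  rcases Nat.eq_zero_or_pos l with rfl | hl
  · have h1 := h.add_period true 0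
    have h2 := F.period_pos true
    simp only [Nat.cast_zero, add_zero] at h1
    omega
  · exact hl

theorem depth_eq_zero_iff (v : Bool × ℤ) : F.depth x v = 0 ↔ ∃ i, v.2 = x v.1 i := by
  unfold depth
  rw [Nat.sInf_eq_zero]
  constructor
  · rintro (h1 | h1)
    · exact h1
    · obtain ⟨m, hm⟩ := h.reach v
      exact absurd h1 (Set.Nonempty.ne_empty ⟨m, hm⟩)
  · intro h1
    exact Or.inl h1

theorem depth_core (b : Bool) (i : ℤ) : F.depth x (b, x b i) = 0 :=
  (h.depth_eq_zero_iff _).2 ⟨i, rfl⟩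

theorem step_core (b : Bool) (i : ℤ) : F.step (b, x b i) = (!b, x (!b) (i + k b)) := by
  simp [step, h.father_core]

theorem depth_step (v : Bool × ℤ) : F.depth x (F.step v) = F.depth x v - 1 := by
  rcases Nat.eq_zero_or_pos (F.depth x v) with h0 | h0
  · obtain ⟨i, hi⟩ := (h.depth_eq_zero_iff v).1 h0
    have hv : v = (v.1, x v.1 i) := by rw [← hi]
    rw [hv, h.step_core, h.depth_core, h.depth_core]
  · have hmem := Nat.sInf_mem (s := {m | ∃ i, (F.step^[m] v).2 = x (F.step^[m] v).1 i}) (h.reach v)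
    obtain ⟨m, hm⟩ : ∃ m, F.depth x v = m + 1 := ⟨F.depth x v - 1, by omega⟩
    change F.depth x v ∈ _ at hmem
    rw [hm] at hmem ⊢
    refine le_antisymm (Nat.sInf_le hmem) ?_
    have hmem' := Nat.sInf_mem
      (s := {m | ∃ i, (F.step^[m] (F.step v)).2 = x (F.step^[m] (F.step v)).1 i})
      (h.reach (F.step v))
    change F.depth x (F.step v) ∈ _ at hmem'
    have : F.depth x v ≤ F.depth x (F.step v) + 1 := Nat.sInf_le hmem'
    omega

theorem rootIndex_core (b : Bool) (i : ℤ) : F.rootIndex x (b, x b i) = i := by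
  unfold rootIndex
  rw [h.depth_core]
  have : ∃ j, (F.step^[0] (b, x b i)).2 = x (F.step^[0] (b, x b i)).1 j := ⟨i, rfl⟩
  exact ((h.strictMono b).injective (Classical.epsilon_spec this)).symm

theorem rootIndex_step {v : Bool × ℤ} (hv : F.depth x v ≠ 0) :
    F.rootIndex x (F.step v) = F.rootIndex x v := by
  have h1 := h.depth_step v
  obtain ⟨m, hm⟩ : ∃ m, F.depth x v = m + 1 := ⟨F.depth x v - 1, by omega⟩
  unfold rootIndex
  rw [h1, hm]
  rfl

theorem level_core (κ : Bool → ℤ) (b : Bool) (i : ℤ) : F.level κ x (b, x b i) = i := by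
  simp [level, h.rootIndex_core, h.depth_core, shiftSum]

theorem level_step_of_ne (κ : Bool → ℤ) {v : Bool × ℤ} (hv : F.depth x v ≠ 0) :
    F.level κ x (F.step v) = F.level κ x v + κ v.1 := by
  have h1 := h.depth_step v
  obtain ⟨m, hm⟩ : ∃ m, F.depth x v = m + 1 := ⟨F.depth x v - 1, by omega⟩
  unfold level
  rw [h.rootIndex_step hv, h1, hm, shiftSum, Nat.add_sub_cancel]
  simp only [step]
  ring

/-- For the shift `k` of the core itself, the level is shifted at core vertices as well. -/
theorem level_step (v : Bool × ℤ) : F.level k x (F.step v) = F.level k x v + k v.1 := by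
  by_cases hv : F.depth x v = 0
  · obtain ⟨i, hi⟩ := (h.depth_eq_zero_iff v).1 hv
    have hv : v = (v.1, x v.1 i) := by rw [← hi]
    rw [hv, h.step_core, h.level_core, h.level_core]
  · exact h.level_step_of_ne k hv

theorem level_mono (b : Bool) : Monotone fun j => F.level k x (b, j) := by
  have key : ∀ (m : ℕ) (b : Bool) (i j : ℤ), F.depth x (b, i) ≤ m → F.depth x (b, j) ≤ m →
      i ≤ j → F.level k x (b, i) ≤ F.level k x (b, j) := by
    intro m
    induction m with
    | zero =>
      intro b i j hi hj hij
      obtain ⟨i', hi'⟩ := (h.depth_eq_zero_iff _).1 (Nat.le_zero.1 hi)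
      obtain ⟨j', hj'⟩ := (h.depth_eq_zero_iff _).1 (Nat.le_zero.1 hj)
      simp only at hi' hj'
      subst hi' hj'
      rw [h.level_core, h.level_core]
      exact (h.strictMono b).le_iff_le.1 hij
    | succ m ih =>
      intro b i j hi hj hij
      have h1 := h.depth_step (b, i)
      have h2 := h.depth_step (b, j)
      have h3 := h.level_step (b, i)
      have h4 := h.level_step (b, j)
      have := ih (!b) (F.father b i) (F.father b j) (by simp only [step] at h1; omega)
        (by simp only [step] at h2; omega) (F.mono b hij)
      simp only [step] at h3 h4
      omega
  intro i j hij
  exact key (max (F.depth x (b, i)) (F.depth x (b, j))) b i j (le_max_left _ _) (le_max_right _ _)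
    hij

theorem core_add_period (v : Bool × ℤ) :
    (∃ i, v.2 + F.period v.1 = x v.1 i) ↔ ∃ i, v.2 = x v.1 i := by
  constructor
  · rintro ⟨i, hi⟩
    refine ⟨i - l, ?_⟩
    have := h.add_period v.1 (i - l)
    rw [sub_add_cancel] at this
    omega
  · rintro ⟨i, hi⟩
    exact ⟨i + l, by rw [h.add_period, hi]⟩

theorem depth_add_period (b : Bool) (j : ℤ) :
    F.depth x (b, j + F.period b) = F.depth x (b, j) := by
  have key : ∀ (m : ℕ) (b : Bool) (j : ℤ), F.depth x (b, j) = m →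
      F.depth x (b, j + F.period b) = m := by
    intro m
    induction m with
    | zero =>
      intro b j hj
      rw [h.depth_eq_zero_iff] at hj ⊢
      exact (h.core_add_period (b, j)).2 hj
    | succ m ih =>
      intro b j hj
      have h1 := h.depth_step (b, j)
      have h2 := h.depth_step (b, j + F.period b)
      rw [F.step_add_period, ih _ _ (by simp only [step] at h1; omega)] at h2
      have h3 : F.depth x (b, j + F.period b) ≠ 0 := by
        intro h0
        rw [h.depth_eq_zero_iff] at h0
        have := (h.depth_eq_zero_iff _).2 ((h.core_add_period (b, j)).1 h0)
        omega
      omega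
  exact key _ b j rfl

theorem depth_add_mul_period (b : Bool) (j q : ℤ) :
    F.depth x (b, j + q * F.period b) = F.depth x (b, j) := by
  induction q using Int.induction_on with
  | zero => simp
  | succ q ih => rw [← ih, ← h.depth_add_period b (j + q * F.period b)]; ring_nf
  | pred q ih => rw [← ih, ← h.depth_add_period b]; ring_nf

theorem exists_depth_le : ∃ M, ∀ v, F.depth x v ≤ M := by
  have key : ∀ b, ∃ M, ∀ j, F.depth x (b, j) ≤ M := fun b => by
    obtain ⟨M, hM⟩ := ((Set.finite_Ico (0 : ℤ) (F.period b)).image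
      fun j => F.depth x (b, j)).bddAbove
    refine ⟨M, fun j => ?_⟩
    have hp := F.period_pos b
    rw [← Int.emod_add_mul_ediv j (F.period b), mul_comm, h.depth_add_mul_period]
    exact hM ⟨_, ⟨Int.emod_nonneg _ (by omega), Int.emod_lt_of_pos _ (by omega)⟩, rfl⟩
  obtain ⟨M, hM⟩ := key false
  obtain ⟨M', hM'⟩ := key true
  refine ⟨max M M', ?_⟩
  rintro ⟨_ | _, j⟩
  · exact (hM j).trans (le_max_left _ _)
  · exact (hM' j).trans (le_max_right _ _)

theorem depth_iterate (m : ℕ) (v : Bool × ℤ) : F.depth x (F.step^[m] v) = F.depth x v - m := by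
  induction m generalizing v with
  | zero => rfl
  | succ m ih =>
    rw [Function.iterate_succ_apply, ih, h.depth_step]
    omega

theorem exists_iterate_eq_core (m : ℕ) (b : Bool) (i : ℤ) : ∃ v, F.step^[m] v = (b, x b i) := by
  induction m generalizing b i with
  | zero => exact ⟨_, rfl⟩
  | succ m ih =>
    obtain ⟨v, hv⟩ := ih (!b) (i - k (!b))
    refine ⟨v, ?_⟩
    rw [Function.iterate_succ_apply', hv, h.step_core]
    simp

theorem range_subset {k' : Bool → ℤ} {l' : ℕ} {x' : Bool → ℤ → ℤ} (h' : F.IsCore k' l' x')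
    (b : Bool) : Set.range (x b) ⊆ Set.range (x' b) := by
  rintro _ ⟨i, rfl⟩
  obtain ⟨M, hM⟩ := h'.exists_depth_le
  obtain ⟨v, hv⟩ := h.exists_iterate_eq_core M b i
  have h1 := h'.depth_iterate M v
  rw [hv, Nat.sub_eq_zero_of_le (hM v), h'.depth_eq_zero_iff] at h1
  obtain ⟨j, hj⟩ := h1
  exact ⟨j, hj.symm⟩

/-- The core of a forest is unique up to the choice of the vertex with the index `0`. -/
theorem unique {k' : Bool → ℤ} {l' : ℕ} {x' : Bool → ℤ → ℤ} (h' : F.IsCore k' l' x')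
    (hk : k false = k' false) :
    k = k' ∧ l = l' ∧ ∃ d, ∀ b i, x' b i = x b (i + d) := by
  have hex : ∀ b, ∃ d, ∀ i, x' b i = x b (i + d) := fun b =>
    strictMono_int_eq_shift (h.strictMono b) (h'.strictMono b)
      ((h.range_subset h' b).antisymm (h'.range_subset h b))
  choose d hd using hex
  have hrel : ∀ b, k' b + d (!b) = k b + d b := fun b => by
    have h1 := h'.father_core b 0
    rw [hd, hd, h.father_core] at h1
    have := (h.strictMono _).injective h1
    omega
  have h1 := hrel false
  have h2 := hrel true
  simp only [Bool.not_false, Bool.not_true] at h1 h2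
  have hdd : d true = d false := by omega
  refine ⟨?_, ?_, d false, ?_⟩
  · ext b
    cases b
    · exact hk
    · omega
  · have h3 := h'.add_period false 0
    rw [hd, hd, ← h.add_period] at h3
    have := (h.strictMono _).injective h3
    omega
  · intro b i
    cases b
    · exact hd _ _
    · rw [hd, hdd]

end IsCore

end PeriodicForest

/-! ### Independence of the shift of the core -/

namespace PeriodicForest

/-- A step towards `0`. -/
def towardsZero (s : ℤ) : ℤ := if s < 0 then s + 1 else if s = 0 then 0 else s - 1

/-- The vertices of one kind, ordered lexicographically by this key, form the forest in which the
shift of the core is replaced by `κ`. -/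
noncomputable def key (F : PeriodicForest) (κ k : Bool → ℤ) (x : Bool → ℤ → ℤ) (v : Bool × ℤ) :
    ℤ ×ₗ (ℤ ×ₗ ℤ) :=
  toLex (F.level κ x v, toLex (F.signedDepth k x v, v.2))

/-- The father map in which the shift of the core is replaced by `κ`. -/
noncomputable def newFather (F : PeriodicForest) (κ : Bool → ℤ) (x : Bool → ℤ → ℤ) (b : Bool)
    (j : ℤ) : ℤ :=
  if F.depth x (b, j) = 0 then x (!b) (F.level κ x (b, j) + κ b) else F.father b j

theorem key_le_iff (F : PeriodicForest) (κ k : Bool → ℤ) (x : Bool → ℤ → ℤ) (v w : Bool × ℤ) :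
    F.key κ k x v ≤ F.key κ k x w ↔ F.level κ x v < F.level κ x w ∨
      F.level κ x v = F.level κ x w ∧ (F.signedDepth k x v < F.signedDepth k x w ∨
        F.signedDepth k x v = F.signedDepth k x w ∧ v.2 ≤ w.2) := by
  simp [key, Prod.Lex.le_iff]

theorem key_lt_iff (F : PeriodicForest) (κ k : Bool → ℤ) (x : Bool → ℤ → ℤ) (v w : Bool × ℤ) :
    F.key κ k x v < F.key κ k x w ↔ F.level κ x v < F.level κ x w ∨
      F.level κ x v = F.level κ x w ∧ (F.signedDepth k x v < F.signedDepth k x w ∨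
        F.signedDepth k x v = F.signedDepth k x w ∧ v.2 < w.2) := by
  simp [key, Prod.Lex.lt_iff]

theorem key_injective (F : PeriodicForest) (κ k : Bool → ℤ) (x : Bool → ℤ → ℤ) (b : Bool) :
    Function.Injective fun j => F.key κ k x (b, j) := by
  intro i j hij
  have h1 := (F.key_le_iff κ k x (b, i) (b, j)).1 (le_of_eq hij)
  have h2 := (F.key_le_iff κ k x (b, j) (b, i)).1 (le_of_eq hij.symm)
  simp only at h1 h2
  omega

namespace IsCore

variable {F : PeriodicForest} {k : Bool → ℤ} {l : ℕ} {x : Bool → ℤ → ℤ} (h : F.IsCore k l x)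
include h

theorem eq_core_of_depth {v : Bool × ℤ} (hv : F.depth x v = 0) (κ : Bool → ℤ) :
    v.2 = x v.1 (F.level κ x v) := by
  obtain ⟨i, hi⟩ := (h.depth_eq_zero_iff v).1 hv
  have hv : v = (v.1, x v.1 i) := by rw [← hi]
  rw [hv, h.level_core]

omit h in
theorem natAbs_signedDepth (v : Bool × ℤ) : (F.signedDepth k x v).natAbs = F.depth x v := by
  unfold signedDepth
  split_ifs <;> simp

theorem signedDepth_core (b : Bool) (i : ℤ) : F.signedDepth k x (b, x b i) = 0 := by
  rw [← Int.natAbs_eq_zero, natAbs_signedDepth, h.depth_core]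

theorem signedDepth_neg_iff (v : Bool × ℤ) :
    F.signedDepth k x v < 0 ↔ v.2 < x v.1 (F.level k x v) := by
  unfold signedDepth
  split_ifs with h1
  · refine ⟨fun _ => h1, fun _ => ?_⟩
    have : F.depth x v ≠ 0 := fun h0 => h1.ne (h.eq_core_of_depth h0 k)
    omega
  · refine ⟨fun h2 => by omega, fun h2 => absurd h2 h1⟩

theorem signedDepth_pos_iff (v : Bool × ℤ) :
    0 < F.signedDepth k x v ↔ x v.1 (F.level k x v) < v.2 := by
  have h1 := h.signedDepth_neg_iff v
  have h2 := natAbs_signedDepth (F := F) (k := k) (x := x) v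
  have h3 : F.depth x v = 0 ↔ v.2 = x v.1 (F.level k x v) :=
    ⟨fun h0 => h.eq_core_of_depth h0 k, fun h0 => (h.depth_eq_zero_iff v).2 ⟨_, h0⟩⟩
  omega

theorem level_core_eq_step (v : Bool × ℤ) :
    x (F.step v).1 (F.level k x (F.step v)) = F.father v.1 (x v.1 (F.level k x v)) := by
  rw [h.level_step, h.father_core]
  rfl

theorem signedDepth_step (v : Bool × ℤ) :
    F.signedDepth k x (F.step v) = towardsZero (F.signedDepth k x v) := by
  have h1 := h.signedDepth_neg_iff v
  have h2 := h.signedDepth_neg_iff (F.step v)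
  have h3 := h.signedDepth_pos_iff v
  have h4 := h.signedDepth_pos_iff (F.step v)
  have h5 := natAbs_signedDepth (F := F) (k := k) (x := x) v
  have h6 := natAbs_signedDepth (F := F) (k := k) (x := x) (F.step v)
  have h7 := h.depth_step v
  rw [h.level_core_eq_step] at h2 h4
  have h8 : v.2 ≤ x v.1 (F.level k x v) →
      (F.step v).2 ≤ F.father v.1 (x v.1 (F.level k x v)) := fun h => F.mono v.1 h
  have h9 : x v.1 (F.level k x v) ≤ v.2 →
      F.father v.1 (x v.1 (F.level k x v)) ≤ (F.step v).2 := fun h => F.mono v.1 h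
  unfold towardsZero
  split_ifs <;> omega

theorem depth_le_of_le_core {b : Bool} {i j c : ℤ} (hij : i ≤ j) (hi : F.level k x (b, i) = c)
    (hj : j ≤ x b c) : F.depth x (b, j) ≤ F.depth x (b, i) := by
  have key : ∀ (m : ℕ) (b : Bool) (i j c : ℤ), F.depth x (b, i) = m → i ≤ j →
      F.level k x (b, i) = c → j ≤ x b c → F.depth x (b, j) ≤ m := by
    intro m
    induction m with
    | zero =>
      intro b i j c hm hij hi hj
      have h1 := h.eq_core_of_depth hm k
      rw [hi] at h1
      simp only at h1
      rw [show j = x b c by omega, h.depth_core]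
    | succ m ih =>
      intro b i j c hm hij hi hj
      have h1 := h.depth_step (b, i)
      have h2 := h.depth_step (b, j)
      have h3 := h.level_step (b, i)
      have h4 := F.mono b hj
      rw [h.father_core] at h4
      have := ih (!b) (F.father b i) (F.father b j) (c + k b) (by simp only [step] at h1; omega)
        (F.mono b hij) (by simp only [step] at h3; omega) h4
      simp only [step] at h2
      omega
  exact key _ b i j c rfl hij hi hj

theorem depth_le_of_core_le {b : Bool} {i j c : ℤ} (hij : i ≤ j) (hj : F.level k x (b, j) = c)
    (hi : x b c ≤ i) : F.depth x (b, i) ≤ F.depth x (b, j) := by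
  have key : ∀ (m : ℕ) (b : Bool) (i j c : ℤ), F.depth x (b, j) = m → i ≤ j →
      F.level k x (b, j) = c → x b c ≤ i → F.depth x (b, i) ≤ m := by
    intro m
    induction m with
    | zero =>
      intro b i j c hm hij hj hi
      have h1 := h.eq_core_of_depth hm k
      rw [hj] at h1
      simp only at h1
      rw [show i = x b c by omega, h.depth_core]
    | succ m ih =>
      intro b i j c hm hij hj hi
      have h1 := h.depth_step (b, j)
      have h2 := h.depth_step (b, i)
      have h3 := h.level_step (b, j)
      have h4 := F.mono b hi
      rw [h.father_core] at h4
      have := ih (!b) (F.father b i) (F.father b j) (c + k b) (by simp only [step] at h1; omega)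
        (F.mono b hij) (by simp only [step] at h3; omega) h4
      simp only [step] at h2
      omega
  exact key _ b i j c rfl hij hj hi

theorem signedDepth_mono {b : Bool} {i j : ℤ} (hij : i ≤ j)
    (hl : F.level k x (b, i) = F.level k x (b, j)) :
    F.signedDepth k x (b, i) ≤ F.signedDepth k x (b, j) := by
  have h1 := h.signedDepth_neg_iff (b, i)
  have h2 := h.signedDepth_neg_iff (b, j)
  have h3 := h.signedDepth_pos_iff (b, i)
  have h4 := h.signedDepth_pos_iff (b, j)
  have h5 := natAbs_signedDepth (F := F) (k := k) (x := x) (b, i)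
  have h6 := natAbs_signedDepth (F := F) (k := k) (x := x) (b, j)
  have h7 := h.depth_le_of_le_core hij hl
  have h8 := h.depth_le_of_core_le hij hl.symm
  rw [hl] at h1 h3 h8
  simp only at h1 h2 h3 h4
  omega

/-- For the shift of the core itself the order given by the key is the original one. -/
theorem key_self_le_iff (b : Bool) (i j : ℤ) :
    F.key k k x (b, i) ≤ F.key k k x (b, j) ↔ i ≤ j := by
  have key : StrictMono fun j => F.key k k x (b, j) := by
    intro i j hij
    refine (F.key_lt_iff _ _ _ _ _).2 ?_
    rcases (h.level_mono b hij.le).lt_or_eq with h1 | h1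
    · exact Or.inl h1
    · have := h.signedDepth_mono hij.le h1
      simp only at h1 ⊢
      omega
  exact key.le_iff_le

omit h in
theorem level_eq_of_level_eq {κ κ' : Bool → ℤ} {b : Bool} {i j : ℤ}
    (hl : F.level κ x (b, i) = F.level κ x (b, j))
    (hs : F.signedDepth k x (b, i) = F.signedDepth k x (b, j)) :
    F.level κ' x (b, i) = F.level κ' x (b, j) := by
  have hd : F.depth x (b, i) = F.depth x (b, j) := by
    rw [← natAbs_signedDepth (k := k), hs, natAbs_signedDepth]
  unfold level at hl ⊢
  rw [hd] at hl ⊢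
  simp only at hl ⊢
  omega

theorem level_newFather (κ : Bool → ℤ) (b : Bool) (j : ℤ) :
    F.level κ x (!b, F.newFather κ x b j) = F.level κ x (b, j) + κ b := by
  unfold newFather
  split_ifs with h0
  · rw [h.level_core]
  · exact h.level_step_of_ne κ h0

theorem signedDepth_newFather (κ : Bool → ℤ) (b : Bool) (j : ℤ) :
    F.signedDepth k x (!b, F.newFather κ x b j) = towardsZero (F.signedDepth k x (b, j)) := by
  unfold newFather
  split_ifs with h0
  · rw [h.signedDepth_core]
    have := natAbs_signedDepth (F := F) (k := k) (x := x) (b, j)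
    rw [show F.signedDepth k x (b, j) = 0 by omega]
    rfl
  · exact h.signedDepth_step (b, j)

theorem newFather_key_mono (κ : Bool → ℤ) {b : Bool} {i j : ℤ}
    (hij : F.key κ k x (b, i) ≤ F.key κ k x (b, j)) :
    F.key κ k x (!b, F.newFather κ x b i) ≤ F.key κ k x (!b, F.newFather κ x b j) := by
  rw [key_le_iff] at hij ⊢
  have h1 := h.level_newFather κ b i
  have h2 := h.level_newFather κ b j
  have h3 := h.signedDepth_newFather κ b i
  have h4 := h.signedDepth_newFather κ b j
  rcases hij with hij | ⟨hl, hs⟩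
  · exact Or.inl (by omega)
  · refine Or.inr ⟨by omega, ?_⟩
    have hmono : ∀ s t : ℤ, s ≤ t → towardsZero s ≤ towardsZero t := fun s t hst => by
      unfold towardsZero
      split_ifs <;> omega
    -- two new fathers of depth `0` and of the same level coincide
    have hzero : F.signedDepth k x (!b, F.newFather κ x b i) = 0 →
        F.signedDepth k x (!b, F.newFather κ x b j) = 0 →
        F.newFather κ x b i = F.newFather κ x b j := fun hi hj => by
      rw [← Int.natAbs_eq_zero, natAbs_signedDepth] at hi hj
      have hi' := h.eq_core_of_depth hi κ
      have hj' := h.eq_core_of_depth hj κ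
      rw [h1] at hi'
      rw [h2, ← hl] at hj'
      exact hi'.trans hj'.symm
    rcases hs with hs | ⟨hs, hle⟩
    · have h5 := hmono _ _ hs.le
      rw [← h3, ← h4] at h5
      rcases h5.lt_or_eq with h6 | h6
      · exact Or.inl h6
      · refine Or.inr ⟨h6, ?_⟩
        have h7 : F.signedDepth k x (!b, F.newFather κ x b i) = 0 := by
          rw [h3, h4] at h6
          rw [h3]
          unfold towardsZero at h6 ⊢
          split_ifs at h6 ⊢ <;> omega
        exact (hzero h7 (h6 ▸ h7)).le
    · refine Or.inr ⟨by rw [h3, h4, hs], ?_⟩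
      have hd : F.depth x (b, i) = F.depth x (b, j) := by
        rw [← natAbs_signedDepth (k := k), hs, natAbs_signedDepth]
      unfold newFather
      rw [hd, hl]
      split_ifs
      · exact le_rfl
      · exact F.mono b hle

theorem rootIndex_add_period (b : Bool) (j : ℤ) :
    F.rootIndex x (b, j + F.period b) = F.rootIndex x (b, j) + l := by
  have key : ∀ (m : ℕ) (b : Bool) (j : ℤ), F.depth x (b, j) = m →
      F.rootIndex x (b, j + F.period b) = F.rootIndex x (b, j) + l := by
    intro m
    induction m with
    | zero =>
      intro b j hj
      obtain ⟨i, hi⟩ := (h.depth_eq_zero_iff _).1 hj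
      simp only at hi
      rw [hi, ← h.add_period, h.rootIndex_core, h.rootIndex_core]
    | succ m ih =>
      intro b j hj
      have h1 := h.depth_step (b, j)
      have h3 : F.depth x (b, j + F.period b) ≠ 0 := by
        rw [h.depth_add_period]
        omega
      rw [← h.rootIndex_step h3, F.step_add_period, ih _ _ (by simp only [step] at h1; omega),
        ← h.rootIndex_step (v := (b, j)) (by omega)]
      rfl
  exact key _ b j rfl

theorem level_add_period (κ : Bool → ℤ) (b : Bool) (j : ℤ) :
    F.level κ x (b, j + F.period b) = F.level κ x (b, j) + l := by
  unfold level
  rw [h.rootIndex_add_period, h.depth_add_period]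
  ring

theorem signedDepth_add_period (b : Bool) (j : ℤ) :
    F.signedDepth k x (b, j + F.period b) = F.signedDepth k x (b, j) := by
  unfold signedDepth
  rw [h.level_add_period, h.depth_add_period]
  simp only [h.add_period, add_lt_add_iff_right]

theorem newFather_add_period (κ : Bool → ℤ) (b : Bool) (j : ℤ) :
    F.newFather κ x b (j + F.period b) = F.newFather κ x b j + F.period (!b) := by
  unfold newFather
  rw [h.depth_add_period, h.level_add_period, F.father_add, add_right_comm, h.add_period]
  split_ifs <;> rfl

/-- The new order on the vertices of one kind is that of the integers. -/
theorem exists_newOrder (κ : Bool → ℤ) (b : Bool) : ∃ ψ : ℤ ≃ ℤ,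
    (∀ i j, ψ i ≤ ψ j ↔ F.key κ k x (b, i) ≤ F.key κ k x (b, j)) ∧ ψ (x b 0) = 0 := by
  obtain ⟨M, hM⟩ := h.exists_depth_le
  -- the levels for the two shifts differ by a bounded amount
  obtain ⟨C, hC⟩ : ∃ C, ∀ j, |F.level κ x (b, j) - F.level k x (b, j)| ≤ C := by
    obtain ⟨C, hC⟩ := ((Set.finite_Iic M).image
      fun m => |shiftSum k b m - shiftSum κ b m|).bddAbove
    refine ⟨C, fun j => hC ⟨F.depth x (b, j), hM _, ?_⟩⟩
    simp only [level]
    congr 1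
    ring
  let e := Equiv.ofInjective _ (F.key_injective κ k x b)
  suffices hex : ∃ ψ : (Set.range fun j => F.key κ k x (b, j)) ≃o ℤ, ψ (e (x b 0)) = 0 by
    obtain ⟨ψ, hψ⟩ := hex
    exact ⟨e.trans ψ.toEquiv, fun i j => ψ.le_iff_le, hψ⟩
  refine exists_orderIso_int ?_ ?_ ?_ _
  · rintro ⟨_, u, rfl⟩ ⟨_, w, rfl⟩
    refine (((Set.finite_Icc (x b (F.level κ x (b, u) - C - 1))
      (x b (F.level κ x (b, w) + C + 1))).image e).subset ?_)
    rintro ⟨_, z, rfl⟩ ⟨h1, h2⟩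
    refine ⟨z, ?_, rfl⟩
    have h1' := (F.key_le_iff _ _ _ _ _).1 h1
    have h2' := (F.key_le_iff _ _ _ _ _).1 h2
    have h3 := abs_le.1 (hC z)
    constructor
    · by_contra hlt
      have := h.level_mono b (not_le.1 hlt).le
      simp only [h.level_core] at this
      omega
    · by_contra hlt
      have := h.level_mono b (not_le.1 hlt).le
      simp only [h.level_core] at this
      omega
  · rintro ⟨_, u, rfl⟩
    refine ⟨e (x b (F.level κ x (b, u) + 1)), (F.key_lt_iff _ _ _ _ _).2 (Or.inl ?_)⟩
    rw [h.level_core]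
    omega
  · rintro ⟨_, u, rfl⟩
    refine ⟨e (x b (F.level κ x (b, u) - 1)), (F.key_lt_iff _ _ _ _ _).2 (Or.inl ?_)⟩
    rw [h.level_core]
    omega

end IsCore

end PeriodicForest

/-- A bijection between the integers that conjugates two translations preserves their length. -/
theorem period_le_of_conj {p a : ℕ} (ha : 0 < a) (ψ : ℤ ≃ ℤ)
    (h : ∀ j, ψ (j + p) = ψ j + a) : p ≤ a := by
  have hmul : ∀ q j : ℤ, ψ (j + q * p) = ψ j + q * a := fun q j => by
    induction q using Int.induction_on with
    | zero => simp
    | succ q ih =>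
      rw [show j + ((q : ℤ) + 1) * p = j + q * p + p by ring, h, ih]
      ring
    | pred q ih =>
      have := h (j + (-(q : ℤ) - 1) * p)
      rw [show j + (-(q : ℤ) - 1) * p + p = j + -q * p by ring, ih] at this
      linarith
  have hinj : Set.InjOn (fun j => ψ j % a) (Finset.Ico (0 : ℤ) p) := by
    intro i hi j hj hij
    simp only [Finset.coe_Ico, Set.mem_Ico] at hi hj
    obtain ⟨q, hq⟩ := Int.ModEq.dvd hij
    have h1 : j = i + q * p := ψ.injective (by rw [hmul]; linarith)
    have h2 : q = 0 := by
      rcases lt_trichotomy q 0 with h | h | h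
      · nlinarith
      · exact h
      · nlinarith
    rw [h1, h2]
    ring
  have := Finset.card_le_card_of_injOn (s := Finset.Ico (0 : ℤ) p) (t := Finset.Ico (0 : ℤ) a)
    (fun j => ψ j % a) (fun j _ => by
      simp only [Finset.coe_Ico, Set.mem_Ico]
      exact ⟨Int.emod_nonneg _ (by omega), Int.emod_lt_of_pos _ (by omega)⟩) hinj
  simpa using this

/-- A periodic forest with a distinguished core vertex of each kind, normalised so that these two
vertices have the coordinate `0`. -/
structure MarkedForest (k : Bool → ℤ) where
  forest : PeriodicForest
  coreLen : ℕ
  core : Bool → ℤ → ℤ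
  isCore : forest.IsCore k coreLen core
  core_zero : ∀ b, core b 0 = 0

namespace MarkedForest

variable {k k' : Bool → ℤ}

theorem ext' {S S' : MarkedForest k} (h1 : S.forest.period = S'.forest.period)
    (h2 : S.forest.father = S'.forest.father) (h3 : S.coreLen = S'.coreLen)
    (h4 : S.core = S'.core) : S = S' := by
  obtain ⟨⟨p, f, _, _, _⟩, l, x, _, _⟩ := S
  obtain ⟨⟨p', f', _, _, _⟩, l', x', _, _⟩ := S'
  simp only at h1 h2 h3 h4
  subst h1 h2 h3 h4
  rfl

/-- `ψ` identifies the vertices of `S` with those of `S'` in such a way that `S'` arises from `S`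
by reattaching the trees that hang at the core, after its shift has been changed from `k` to
`k'`. -/
structure Reshift (S : MarkedForest k) (S' : MarkedForest k') (ψ : Bool → ℤ ≃ ℤ) : Prop where
  period_eq : S.forest.period = S'.forest.period
  coreLen_eq : S.coreLen = S'.coreLen
  le_iff : ∀ b i j, ψ b i ≤ ψ b j ↔
    S.forest.key k' k S.core (b, i) ≤ S.forest.key k' k S.core (b, j)
  map_core : ∀ b i, ψ b (S.core b i) = S'.core b i
  map_father : ∀ b j, S.forest.depth S.core (b, j) ≠ 0 →
    S'.forest.father b (ψ b j) = ψ (!b) (S.forest.father b j)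

/-- The forest for the new shift of the core exists: the vertices of each kind are renumbered in the
order given by the key. -/
theorem exists_reshift (k' : Bool → ℤ) (S : MarkedForest k) :
    ∃ (S' : MarkedForest k') (ψ : Bool → ℤ ≃ ℤ), Reshift S S' ψ := by
  obtain ⟨F, l, x, h, hx⟩ := S
  choose ψ hψ hψ0 using h.exists_newOrder k'
  have hlt : ∀ b i j, ψ b i < ψ b j ↔ F.key k' k x (b, i) < F.key k' k x (b, j) := fun b i j => by
    rw [← not_le, hψ, not_le]
  have hperiod : ∀ b j, ψ b (j + F.period b) = ψ b j + F.period b := fun b => by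
    have hmono : StrictMono fun i => ψ b ((ψ b).symm i + F.period b) := fun i j hij => by
      have h1 : ψ b ((ψ b).symm i) < ψ b ((ψ b).symm j) := by simpa using hij
      rw [hlt, PeriodicForest.key_lt_iff] at h1
      rw [hlt, PeriodicForest.key_lt_iff]
      simp only [h.level_add_period, h.signedDepth_add_period] at h1 ⊢
      omega
    obtain ⟨a, ha⟩ := strictMono_int_eq_shift (x := fun i => i) (fun i j hij => hij) hmono (by
      ext j
      refine ⟨fun _ => ⟨ψ b ((ψ b).symm j - F.period b), by simp⟩, fun _ => ⟨j, rfl⟩⟩)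
    have ha' : ∀ j, ψ b (j + F.period b) = ψ b j + a := fun j => by simpa using ha (ψ b j)
    have hpos : 0 < a := by
      have h1 : ψ b 0 < ψ b (0 + F.period b) := by
        rw [hlt, PeriodicForest.key_lt_iff, h.level_add_period]
        have := h.l_pos
        omega
      rw [ha'] at h1
      omega
    lift a to ℕ using hpos.le
    have h1 := period_le_of_conj (by omega) (ψ b) ha'
    have h2 := period_le_of_conj (F.period_pos b) (ψ b).symm fun j => by
      rw [Equiv.symm_apply_eq, ha', Equiv.apply_symm_apply]
    rwa [← le_antisymm h1 h2] at ha'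
  let F' : PeriodicForest :=
    { period := F.period
      father := fun b j => ψ (!b) (F.newFather k' x b ((ψ b).symm j))
      period_pos := F.period_pos
      mono := fun b i j hij => by
        rw [hψ]
        apply h.newFather_key_mono
        rw [← hψ]
        simpa using hij
      father_add := fun b j => by
        have : (ψ b).symm (j + F.period b) = (ψ b).symm j + F.period b := by
          rw [Equiv.symm_apply_eq, hperiod, Equiv.apply_symm_apply]
        rw [this, h.newFather_add_period, hperiod] }
  have hf : ∀ b j, F.depth x (b, j) ≠ 0 → F'.father b (ψ b j) = ψ (!b) (F.father b j) :=
    fun b j hj => by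
      simp only [F', Equiv.symm_apply_apply, PeriodicForest.newFather, if_neg hj]
  refine ⟨⟨F', l, fun b i => ψ b (x b i), ⟨?_, ?_, ?_, ?_⟩, ?_⟩, ψ, rfl, rfl, hψ, fun _ _ => rfl,
    hf⟩
  · intro b i j hij
    rw [hlt, PeriodicForest.key_lt_iff]
    simp only [h.level_core]
    exact Or.inl hij
  · intro b i
    rw [h.add_period, hperiod]
  · intro b i
    simp only [F', Equiv.symm_apply_apply, PeriodicForest.newFather, h.depth_core, if_true,
      h.level_core]
  · have key : ∀ (m : ℕ) (b : Bool) (j : ℤ), F.depth x (b, j) = m →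
        ∃ n i, (F'.step^[n] (b, ψ b j)).2 =
          ψ (F'.step^[n] (b, ψ b j)).1 (x (F'.step^[n] (b, ψ b j)).1 i) := by
      intro m
      induction m with
      | zero =>
        intro b j hj
        obtain ⟨i, hi⟩ := (h.depth_eq_zero_iff _).1 hj
        exact ⟨0, i, congrArg (ψ b) hi⟩
      | succ m ih =>
        intro b j hj
        have h1 := h.depth_step (b, j)
        obtain ⟨n, i, hi⟩ := ih (!b) (F.father b j)
          (by simp only [PeriodicForest.step] at h1; omega)
        refine ⟨n + 1, i, ?_⟩
        have : F'.step (b, ψ b j) = (!b, ψ (!b) (F.father b j)) := by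
          simp only [PeriodicForest.step, hf b j (by omega)]
        rw [Function.iterate_succ_apply, this]
        exact hi
    rintro ⟨b, j⟩
    simpa using key _ b ((ψ b).symm j) rfl
  · exact hψ0

namespace Reshift

variable {S : MarkedForest k} {S' : MarkedForest k'} {ψ : Bool → ℤ ≃ ℤ} (h : Reshift S S' ψ)
include h

theorem depth_eq_and_rootIndex_eq (b : Bool) (j : ℤ) :
    S'.forest.depth S'.core (b, ψ b j) = S.forest.depth S.core (b, j) ∧
      S'.forest.rootIndex S'.core (b, ψ b j) = S.forest.rootIndex S.core (b, j) := by
  have key : ∀ (m : ℕ) (b : Bool) (j : ℤ), S.forest.depth S.core (b, j) = m →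
      S'.forest.depth S'.core (b, ψ b j) = m ∧
        S'.forest.rootIndex S'.core (b, ψ b j) = S.forest.rootIndex S.core (b, j) := by
    intro m
    induction m with
    | zero =>
      intro b j hj
      obtain ⟨i, hi⟩ := (S.isCore.depth_eq_zero_iff _).1 hj
      simp only at hi
      subst hi
      rw [h.map_core, S'.isCore.depth_core, S'.isCore.rootIndex_core, S.isCore.rootIndex_core]
      exact ⟨rfl, rfl⟩
    | succ m ih =>
      intro b j hj
      have h1 := S.isCore.depth_step (b, j)
      have h2 := S'.isCore.depth_step (b, ψ b j)
      have h3 : S'.forest.step (b, ψ b j) = (!b, ψ (!b) (S.forest.father b j)) := by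
        simp only [PeriodicForest.step, h.map_father b j (by omega)]
      obtain ⟨h4, h5⟩ := ih (!b) (S.forest.father b j)
        (by simp only [PeriodicForest.step] at h1; omega)
      have h6 : S'.forest.depth S'.core (b, ψ b j) ≠ 0 := by
        intro h0
        obtain ⟨i, hi⟩ := (S'.isCore.depth_eq_zero_iff _).1 h0
        simp only [← h.map_core] at hi
        have := (S.isCore.depth_eq_zero_iff (b, j)).2 ⟨i, (ψ b).injective hi⟩
        omega
      have h7 := S'.isCore.rootIndex_step h6
      have h8 := S.isCore.rootIndex_step (v := (b, j)) (by omega)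
      rw [h3] at h2 h7
      refine ⟨by omega, ?_⟩
      rw [← h7, ← h8, h5]
      rfl
  obtain ⟨h1, h2⟩ := key _ b j rfl
  exact ⟨h1, h2⟩

theorem level_eq (κ : Bool → ℤ) (b : Bool) (j : ℤ) :
    S'.forest.level κ S'.core (b, ψ b j) = S.forest.level κ S.core (b, j) := by
  obtain ⟨h1, h2⟩ := h.depth_eq_and_rootIndex_eq b j
  simp only [PeriodicForest.level, h1, h2]

theorem signedDepth_eq (b : Bool) (j : ℤ) :
    S'.forest.signedDepth k' S'.core (b, ψ b j) = S.forest.signedDepth k S.core (b, j) := by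
  have h1 : S'.forest.signedDepth k' S'.core (b, ψ b j) < 0 ↔
      ψ b j < ψ b (S.core b (S.forest.level k' S.core (b, j))) := by
    rw [S'.isCore.signedDepth_neg_iff, h.level_eq, h.map_core]
  have h2 := PeriodicForest.IsCore.natAbs_signedDepth (F := S'.forest) (k := k') (x := S'.core)
    (b, ψ b j)
  have h3 := PeriodicForest.IsCore.natAbs_signedDepth (F := S.forest) (k := k) (x := S.core) (b, j)
  have h4 := (h.depth_eq_and_rootIndex_eq b j).1
  have h5 : ψ b j < ψ b (S.core b (S.forest.level k' S.core (b, j))) ↔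
      S.forest.signedDepth k S.core (b, j) < 0 := by
    rw [← not_le, h.le_iff, not_le, PeriodicForest.key_lt_iff, S.isCore.level_core,
      S.isCore.signedDepth_core]
    simp only [lt_self_iff_false, true_and, false_or]
    have h6 : S.forest.signedDepth k S.core (b, j) = 0 →
        j = S.core b (S.forest.level k' S.core (b, j)) := fun h0 =>
      S.isCore.eq_core_of_depth (v := (b, j)) (by omega) k'
    omega
  omega

theorem symm : Reshift S' S fun b => (ψ b).symm where
  period_eq := h.period_eq.symm
  coreLen_eq := h.coreLen_eq.symm
  le_iff b i j := by
    obtain ⟨i, rfl⟩ := (ψ b).surjective i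
    obtain ⟨j, rfl⟩ := (ψ b).surjective j
    have h1 := h.le_iff b i j
    rw [Equiv.symm_apply_apply, Equiv.symm_apply_apply, ← S.isCore.key_self_le_iff b,
      PeriodicForest.key_le_iff, PeriodicForest.key_le_iff]
    rw [PeriodicForest.key_le_iff] at h1
    simp only [h.level_eq, h.signedDepth_eq] at h1 ⊢
    have h2 : S.forest.level k S.core (b, i) = S.forest.level k S.core (b, j) →
        S.forest.signedDepth k S.core (b, i) = S.forest.signedDepth k S.core (b, j) →
        S.forest.level k' S.core (b, i) = S.forest.level k' S.core (b, j) :=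
      PeriodicForest.IsCore.level_eq_of_level_eq
    omega
  map_core b i := by rw [Equiv.symm_apply_eq, h.map_core]
  map_father b j hj := by
    obtain ⟨j, rfl⟩ := (ψ b).surjective j
    rw [(h.depth_eq_and_rootIndex_eq b j).1] at hj
    rw [h.map_father b j hj, Equiv.symm_apply_apply, Equiv.symm_apply_apply]

theorem unique {S'' : MarkedForest k'} {ψ' : Bool → ℤ ≃ ℤ} (h' : Reshift S S'' ψ') : S' = S'' := by
  have hψ : ψ = ψ' := by
    ext b j
    obtain ⟨a, ha⟩ := strictMono_int_eq_shift (x := fun i => i) (y := fun i => ψ b ((ψ' b).symm i))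
      (fun i j hij => hij) (fun i j hij => by
        have h1 : ψ' b ((ψ' b).symm i) < ψ' b ((ψ' b).symm j) := by simpa using hij
        rw [← not_le, h'.le_iff, ← h.le_iff, not_le] at h1
        exact h1)
      (by
        ext j
        exact ⟨fun _ => ⟨ψ' b ((ψ b).symm j), by simp⟩, fun _ => ⟨j, rfl⟩⟩)
    have h0 : ψ b ((ψ' b).symm (ψ' b (S.core b 0))) = ψ' b (S.core b 0) + a := ha _
    rw [Equiv.symm_apply_apply, h.map_core, h'.map_core, S'.core_zero, S''.core_zero] at h0
    have h1 : ψ b ((ψ' b).symm (ψ' b j)) = ψ' b j + a := ha _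
    simp only [Equiv.symm_apply_apply] at h1
    omega
  subst hψ
  have hcore : S'.core = S''.core := by
    ext b i
    rw [← h.map_core, ← h'.map_core]
  refine ext' (h.period_eq.symm.trans h'.period_eq) ?_ (h.coreLen_eq.symm.trans h'.coreLen_eq)
    hcore
  ext b j
  obtain ⟨j, rfl⟩ := (ψ b).surjective j
  by_cases hj : S.forest.depth S.core (b, j) = 0
  · obtain ⟨i, hi⟩ := (S.isCore.depth_eq_zero_iff _).1 hj
    simp only at hi
    subst hi
    rw [h.map_core, S'.isCore.father_core, hcore, S''.isCore.father_core]
  · rw [h.map_father b j hj, h'.map_father b j hj]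

end Reshift

/-- The marked forests with `l` core vertices of each kind and `n` vertices in a period. -/
def OfSize (k : Bool → ℤ) (l n : ℕ) : Type :=
  {S : MarkedForest k // S.coreLen = l ∧ S.forest.period false + S.forest.period true = n}

/-- The marked forests for different shifts of the core are in bijection. -/
theorem nonempty_ofSize_equiv (k k' : Bool → ℤ) (l n : ℕ) :
    Nonempty (OfSize k l n ≃ OfSize k' l n) := by
  choose T ψ h using fun S : MarkedForest k => exists_reshift k' S
  choose T' ψ' h' using fun S : MarkedForest k' => exists_reshift k S
  refine ⟨⟨fun S => ⟨T S.1, ?_⟩, fun S => ⟨T' S.1, ?_⟩, fun S => ?_, fun S => ?_⟩⟩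
  · rw [← (h S.1).coreLen_eq, ← (h S.1).period_eq]
    exact S.2
  · rw [← (h' S.1).coreLen_eq, ← (h' S.1).period_eq]
    exact S.2
  · exact Subtype.ext ((h' _).unique (h _).symm)
  · exact Subtype.ext ((h _).unique (h' _).symm)

end MarkedForest

/-! ### Walks with four kinds of steps -/

/-- The increment of a walk at a letter. There are one up step `(true, true)`, one down step
`(false, false)` and two level steps. -/
def walkStep (a : Bool × Bool) : ℤ := a.1.toNat + a.2.toNat - 1

/-- The number of steps `0 → 1` among the first `n` steps of the walk that starts at `d` and has
the letters `g`. -/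
def upCrossings (d : ℤ) (g : ℕ → Bool × Bool) (n : ℕ) : ℕ :=
  ((Finset.range n).filter fun t =>
    g t = (true, true) ∧ d + ∑ s ∈ Finset.range t, walkStep (g s) = 0).card

/-- The extension of a finite word by the letter `(false, false)`. -/
def extendWord {n : ℕ} (g : Fin n → Bool × Bool) (t : ℕ) : Bool × Bool :=
  if h : t < n then g ⟨t, h⟩ else (false, false)

/-- The words of length `n` whose walk leads from `d` to `0` with `l` steps `0 → 1`. -/
def IsWalk (d : ℤ) (l : ℕ) {n : ℕ} (g : Fin n → Bool × Bool) : Prop :=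
  d + ∑ s ∈ Finset.range n, walkStep (extendWord g s) = 0 ∧ upCrossings d (extendWord g) n = l

theorem upCrossings_succ (d : ℤ) (g : ℕ → Bool × Bool) (n : ℕ) :
    upCrossings d g (n + 1) = (if g 0 = (true, true) ∧ d = 0 then 1 else 0) +
      upCrossings (d + walkStep (g 0)) (fun t => g (t + 1)) n := by
  simp only [upCrossings, Finset.card_filter]
  rw [Finset.sum_range_succ']
  simp only [Finset.sum_range_succ', Finset.range_zero, Finset.sum_empty, add_zero, add_assoc]
  rw [add_comm]
  simp only [add_comm (walkStep (g 0))]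

theorem extendWord_cons_zero {n : ℕ} (a : Bool × Bool) (g : Fin n → Bool × Bool) :
    extendWord (Fin.cons a g : Fin (n + 1) → Bool × Bool) 0 = a := by
  simp [extendWord]

theorem extendWord_cons_succ {n : ℕ} (a : Bool × Bool) (g : Fin n → Bool × Bool) (t : ℕ) :
    extendWord (Fin.cons a g : Fin (n + 1) → Bool × Bool) (t + 1) = extendWord g t := by
  unfold extendWord
  by_cases h : t < n
  · rw [dif_pos h, dif_pos (by omega)]
    exact Fin.cons_succ (α := fun _ => Bool × Bool) a g ⟨t, h⟩
  · rw [dif_neg h, dif_neg (by omega)]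

theorem isWalk_cons {n : ℕ} (d : ℤ) (l : ℕ) (a : Bool × Bool) (g : Fin n → Bool × Bool) :
    IsWalk d l (Fin.cons a g : Fin (n + 1) → Bool × Bool) ↔
      if a = (true, true) ∧ d = 0 then ∃ l', l = l' + 1 ∧ IsWalk 1 l' g
        else IsWalk (d + walkStep a) l g := by
  unfold IsWalk
  rw [Finset.sum_range_succ', upCrossings_succ]
  simp only [extendWord_cons_zero, extendWord_cons_succ]
  split_ifs with h
  · obtain ⟨rfl, rfl⟩ := h
    have h1 : walkStep (true, true) = 1 := rfl
    rw [h1, zero_add, add_comm _ (1 : ℤ)]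
    constructor
    · rintro ⟨h2, h3⟩
      exact ⟨_, (h3.symm.trans (add_comm _ _)), h2, rfl⟩
    · rintro ⟨l', rfl, h2, h3⟩
      exact ⟨h2, (add_comm _ _).trans (congrArg (· + 1) h3)⟩
  · rw [zero_add, add_assoc, add_comm (walkStep a)]

theorem card_fin_succ_fun {α : Type*} [Fintype α] {n : ℕ} (P : (Fin (n + 1) → α) → Prop) :
    Nat.card {g // P g} = ∑ a, Nat.card {g : Fin n → α // P (Fin.cons a g)} := by
  rw [← Nat.card_sigma]
  refine Nat.card_congr ⟨fun g => ⟨g.1 0, fun i => g.1 i.succ, ?_⟩,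
    fun g => ⟨Fin.cons g.1 g.2.1, g.2.2⟩, fun g => ?_, fun g => ?_⟩
  · have := Fin.cons_self_tail (α := fun _ => α) g.1
    unfold Fin.tail at this
    rw [this]
    exact g.2
  · exact Subtype.ext (Fin.cons_self_tail (α := fun _ => α) g.1)
  · rfl

/-- The series `z A(z) ^ 2`. It counts the walks from `1` that stop at the first visit to `0`, the
letters being the steps of the walk. -/
noncomputable def passageSeries : ℚ⟦X⟧ := PowerSeries.X * treeSeries ^ 2

theorem treeSeries_eq_one_add : treeSeries = 1 + passageSeries := treeSeries_eq

theorem passageSeries_eq : passageSeries = PowerSeries.X * (1 + passageSeries) ^ 2 := by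
  rw [← treeSeries_eq_one_add]
  rfl

theorem tupleSeries_eq : tupleSeries = passageSeries ^ 2 := by
  unfold tupleSeries passageSeries
  ring

theorem constantCoeff_passageSeries : PowerSeries.constantCoeff passageSeries = 0 := by
  simp [passageSeries]

theorem constantCoeff_tupleSeries : PowerSeries.constantCoeff tupleSeries = 0 := by
  simp [tupleSeries]

/-- A walk from `d` to `0` consists of `|d|` first passages, a walk from `0` to `0` without positive
levels, and, for each step `0 → 1`, this step, a first passage from `1` to `0` and again a walk from
`0` to `0` without positive levels. The latter walks are counted by `A(z) ^ 2`. The identity is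
checked by splitting off the first letter. -/
theorem card_isWalk (n : ℕ) (d : ℤ) (l : ℕ) :
    (Nat.card {g : Fin n → Bool × Bool // IsWalk d l g} : ℚ) =
      PowerSeries.coeff n (passageSeries ^ d.natAbs * treeSeries ^ 2 * tupleSeries ^ l) := by
  induction n generalizing d l with
  | zero =>
    rw [PowerSeries.coeff_zero_eq_constantCoeff_apply]
    simp only [map_mul, map_pow, constantCoeff_passageSeries, constantCoeff_tupleSeries]
    have hA : PowerSeries.constantCoeff treeSeries = 1 := by
      rw [treeSeries_eq_one_add, map_add, constantCoeff_passageSeries]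
      simp
    rw [hA, one_pow, mul_one]
    by_cases hdl : d = 0 ∧ l = 0
    · obtain ⟨rfl, rfl⟩ := hdl
      have : ∀ g : Fin 0 → Bool × Bool, IsWalk 0 0 g := fun g => by simp [IsWalk, upCrossings]
      simp [this]
    · have : ∀ g : Fin 0 → Bool × Bool, ¬ IsWalk d l g := fun g hg => by
        simp [IsWalk, upCrossings] at hg
        exact hdl ⟨hg.1, hg.2.symm⟩
      simp only [this]
      by_cases hd : d = 0
      · have hl : l ≠ 0 := fun hl => hdl ⟨hd, hl⟩
        simp [hl]
      · simp [hd]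
  | succ n ih =>
    have ih' : ∀ (d : ℤ) (l e : ℕ), d.natAbs = e →
        (Nat.card {g : Fin n → Bool × Bool // IsWalk d l g} : ℚ) =
          PowerSeries.coeff n (passageSeries ^ e * treeSeries ^ 2 * tupleSeries ^ l) := by
      rintro d l _ rfl
      exact ih d l
    have hC := passageSeries_eq
    have hG := tupleSeries_eq
    have hA := treeSeries_eq_one_add
    have w1 : walkStep (true, true) = 1 := rfl
    have w2 : walkStep (true, false) = 0 := rfl
    have w3 : walkStep (false, true) = 0 := rfl
    have w4 : walkStep (false, false) = -1 := rfl
    rw [card_fin_succ_fun]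
    simp only [Fintype.sum_prod_type, Fintype.sum_bool, isWalk_cons, w1, w2, w3, w4]
    push_cast
    rcases Int.lt_trichotomy d 0 with hd | rfl | hd
    · obtain ⟨e, rfl⟩ : ∃ e : ℕ, d = -(e + 1 : ℕ) := ⟨(-d - 1).toNat, by omega⟩
      have hd : ¬ (-((e + 1 : ℕ) : ℤ) = 0) := by omega
      simp only [hd, and_false, if_false]
      rw [ih' _ l e (by omega), ih' _ l (e + 1) (by omega), ih' _ l (e + 2) (by omega),
        ← map_add, ← map_add, ← map_add, ← PowerSeries.coeff_succ_X_mul,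
        show (-((e + 1 : ℕ) : ℤ)).natAbs = e + 1 by omega]
      congr 1
      linear_combination (-passageSeries ^ e * treeSeries ^ 2 * tupleSeries ^ l) * hC
    · rcases l with _ | l
      · have hno : ∀ g : Fin n → Bool × Bool, ¬ ∃ l', 0 = l' + 1 ∧ IsWalk 1 l' g :=
          fun g ⟨l', h, _⟩ => by omega
        simp only [Prod.mk.injEq, and_true, if_true, Bool.false_eq_true, and_false,
          if_false, hno, Nat.card_of_isEmpty, Nat.cast_zero, zero_add]
        rw [ih' _ 0 0 (by omega), ih' _ 0 1 (by omega), ← map_add, ← map_add,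
          ← PowerSeries.coeff_succ_X_mul, Int.natAbs_zero]
        have key : passageSeries ^ 0 * treeSeries ^ 2 * tupleSeries ^ 0 =
            1 + PowerSeries.X * (passageSeries ^ 0 * treeSeries ^ 2 * tupleSeries ^ 0 +
              (passageSeries ^ 0 * treeSeries ^ 2 * tupleSeries ^ 0 +
                passageSeries ^ 1 * treeSeries ^ 2 * tupleSeries ^ 0)) := by
          rw [hA]
          linear_combination (2 + passageSeries) * hC
        conv_rhs => rw [key]
        rw [map_add, PowerSeries.coeff_one, if_neg (by omega), zero_add]
      · simp only [Prod.mk.injEq, and_true, if_true, Bool.false_eq_true, and_false, if_false,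
          add_left_inj, exists_eq_left']
        rw [ih' _ l 1 (by omega), ih' _ (l + 1) 0 (by omega), ih' _ (l + 1) 1 (by omega),
          ← map_add, ← map_add, ← map_add, ← PowerSeries.coeff_succ_X_mul, Int.natAbs_zero]
        congr 1
        linear_combination (-treeSeries ^ 2 * tupleSeries ^ l * passageSeries) * hC -
          treeSeries ^ 2 * tupleSeries ^ l *
            (1 - 2 * PowerSeries.X - PowerSeries.X * passageSeries) * hG
    · obtain ⟨e, rfl⟩ : ∃ e : ℕ, d = (e + 1 : ℕ) := ⟨(d - 1).toNat, by omega⟩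
      have hd : ¬ (((e + 1 : ℕ) : ℤ) = 0) := by omega
      simp only [hd, and_false, if_false]
      rw [ih' _ l (e + 2) (by omega), ih' _ l (e + 1) (by omega), ih' _ l e (by omega),
        ← map_add, ← map_add, ← map_add, ← PowerSeries.coeff_succ_X_mul, Int.natAbs_natCast]
      congr 1
      linear_combination (-passageSeries ^ e * treeSeries ^ 2 * tupleSeries ^ l) * hC

/-! ### Forests whose core is not shifted -/

namespace PeriodicForest

/-- The time at which the path of the vertices of kind `b` passes the vertex `j`: the graphs of
`father false` and, transposed, `father true` are two lattice paths, and the vertex `j` of kind `b`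
is a step of the corresponding path that starts on the antidiagonal `j + father b j`. -/
def time (F : PeriodicForest) (b : Bool) (j : ℤ) : ℤ := j + F.father b j

open Classical in
/-- The word of a forest: the letter at `t` says which of the two kinds has a vertex of time
`t`. -/
noncomputable def letter (F : PeriodicForest) (t : ℕ) : Bool × Bool :=
  (decide (∃ j, F.time false j = t), decide (∃ j, F.time true j = t))

variable (F : PeriodicForest)

theorem time_strictMono (b : Bool) : StrictMono (F.time b) := fun i j hij => by
  have := F.mono b hij.le
  unfold time
  omega

theorem time_add_period (b : Bool) (j : ℤ) :
    F.time b (j + F.period b) = F.time b j + (F.period false + F.period true : ℕ) := by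
  have := F.father_add b j
  unfold time
  cases b <;> simp only [Bool.not_false, Bool.not_true] at this <;> push_cast <;> omega

/-- The core of a forest whose two vertices `0` are fathers of each other: the vertices that are
their own grandfathers. -/
def fixedVertices : Set ℤ := {j | F.father true (F.father false j) = j}

theorem grandfather_add_period (j : ℤ) :
    F.father true (F.father false (j + F.period false)) =
      F.father true (F.father false j) + F.period false := by
  rw [F.father_add, Bool.not_false, F.father_add, Bool.not_true]

theorem add_period_mem_fixedVertices (j : ℤ) :
    j + F.period false ∈ F.fixedVertices ↔ j ∈ F.fixedVertices := by
  simp only [fixedVertices, Set.mem_ofPred_eq, F.grandfather_add_period]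
  omega

end PeriodicForest

theorem Monotone.exists_iterate_fixed {G : ℤ → ℤ} (hG : Monotone G) {a c j : ℤ} (ha : G a = a)
    (hc : G c = c) (h1 : a ≤ j) (h2 : j ≤ c) : ∃ m, G (G^[m] j) = G^[m] j := by
  have up : ∀ (N : ℕ) (j : ℤ), (c - j).toNat = N → j ≤ c → j ≤ G j →
      ∃ m, G (G^[m] j) = G^[m] j := by
    intro N
    induction N using Nat.strong_induction_on with
    | _ N ih =>
      intro j hN hj hle
      by_cases he : G j = j
      · exact ⟨0, he⟩
      · have h3 := hG hj
        obtain ⟨m, hm⟩ := ih (c - G j).toNat (by omega) (G j) rfl (by omega) (hG hle)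
        exact ⟨m + 1, hm⟩
  have down : ∀ (N : ℕ) (j : ℤ), (j - a).toNat = N → a ≤ j → G j ≤ j →
      ∃ m, G (G^[m] j) = G^[m] j := by
    intro N
    induction N using Nat.strong_induction_on with
    | _ N ih =>
      intro j hN hj hle
      by_cases he : G j = j
      · exact ⟨0, he⟩
      · have h3 := hG hj
        obtain ⟨m, hm⟩ := ih (G j - a).toNat (by omega) (G j) rfl (by omega) (hG hle)
        exact ⟨m + 1, hm⟩
  rcases le_total j (G j) with h | h
  · exact up _ j rfl h2 h
  · exact down _ j rfl h1 h

namespace PeriodicForest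

variable (F : PeriodicForest)

theorem step_iterate_two_mul (m : ℕ) (j : ℤ) :
    F.step^[2 * m] (false, j) =
      (false, (fun i => F.father true (F.father false i))^[m] j) := by
  induction m generalizing j with
  | zero => rfl
  | succ m ih =>
    rw [show 2 * (m + 1) = 2 * m + 1 + 1 by ring, Function.iterate_succ_apply,
      Function.iterate_succ_apply, Function.iterate_succ_apply, ← ih]
    rfl

theorem mul_period_mem_fixedVertices (h0 : 0 ∈ F.fixedVertices) (q : ℤ) :
    q * F.period false ∈ F.fixedVertices := by
  induction q using Int.induction_on with
  | zero => simpa using h0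
  | succ q ih => rwa [add_mul, one_mul, F.add_period_mem_fixedVertices]
  | pred q ih =>
    rwa [← F.add_period_mem_fixedVertices, sub_mul, one_mul, sub_add_cancel]

theorem exists_iterate_mem_fixedVertices (h0 : 0 ∈ F.fixedVertices) (j : ℤ) :
    ∃ m, (F.step^[2 * m] (false, j)).2 ∈ F.fixedVertices := by
  have hp := F.period_pos false
  have h1 := Int.emod_nonneg j (b := (F.period false : ℤ)) (by omega)
  have h2 := Int.emod_lt_of_pos j (b := (F.period false : ℤ)) (by omega)
  have h3 := Int.emod_add_mul_ediv j (F.period false)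
  obtain ⟨m, hm⟩ := Monotone.exists_iterate_fixed (j := j) ((F.mono true).comp (F.mono false))
    (F.mul_period_mem_fixedVertices h0 (j / F.period false))
    (F.mul_period_mem_fixedVertices h0 (j / F.period false + 1)) (by linarith) (by linarith)
  exact ⟨m, by rw [step_iterate_two_mul]; exact hm⟩

theorem exists_isCore_zero (h0 : ∀ b, F.father b 0 = 0) :
    ∃ l x, F.IsCore 0 l x ∧ ∀ b, x b 0 = 0 := by
  have hQ : (0 : ℤ) ∈ F.fixedVertices := by
    simp [fixedVertices, h0]
  obtain ⟨y, hy, hr, hy0, hyp⟩ := exists_periodic_enumeration (F.period_pos false)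
    F.add_period_mem_fixedVertices hQ
  have hfix : ∀ i, F.father true (F.father false (y i)) = y i := fun i => by
    have : y i ∈ F.fixedVertices := hr ▸ Set.mem_range_self i
    exact this
  obtain ⟨d, hyp⟩ : ∃ d : ℕ, ∀ i, y (i + d) = y i + F.period false := ⟨_, hyp⟩
  let x : Bool → ℤ → ℤ := fun b i => match b with
    | false => y i
    | true => F.father false (y i)
  refine ⟨d, x, ⟨?_, ?_, ?_, ?_⟩, ?_⟩
  · rintro (_ | _)
    · exact hy
    · refine ((F.mono false).comp hy.monotone).strictMono_of_injective fun i j hij => ?_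
      apply hy.injective
      rw [← hfix i, ← hfix j]
      exact congrArg _ hij
  · rintro (_ | _) i
    · exact hyp i
    · dsimp only [x]
      rw [hyp, F.father_add]
      rfl
  · rintro (_ | _) i
    · simp [x]
    · simp [x, hfix]
  · have hfalse : ∀ j, ∃ m i, (F.step^[m] (false, j)).2 = x (F.step^[m] (false, j)).1 i :=
        fun j => by
      obtain ⟨m, hm⟩ := F.exists_iterate_mem_fixedVertices hQ j
      rw [← hr] at hm
      obtain ⟨i, hi⟩ := hm
      refine ⟨2 * m, i, ?_⟩
      rw [step_iterate_two_mul] at hi ⊢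
      exact hi.symm
    rintro ⟨_ | _, j⟩
    · exact hfalse j
    · obtain ⟨m, i, hm⟩ := hfalse (F.father true j)
      exact ⟨m + 1, i, hm⟩
  · rintro (_ | _)
    · exact hy0
    · dsimp only [x]
      rw [hy0, h0]

namespace IsCore

variable {F} {l : ℕ} {x : Bool → ℤ → ℤ} (h : F.IsCore 0 l x)
include h

theorem range_core_false : Set.range (x false) = F.fixedVertices := by
  ext j
  constructor
  · rintro ⟨i, rfl⟩
    have h1 := h.father_core false i
    have h2 := h.father_core true i
    simp only [Pi.zero_apply, add_zero, Bool.not_true, Bool.not_false] at h1 h2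
    simp only [fixedVertices, Set.mem_ofPred_eq]
    rw [h1, h2]
  · intro hj
    have h1 := h.depth_iterate (2 * F.depth x (false, j)) (false, j)
    have h2 : ∀ m, (fun i => F.father true (F.father false i))^[m] j = j := fun m =>
      Function.iterate_fixed (f := fun i => F.father true (F.father false i)) hj m
    rw [F.step_iterate_two_mul, h2] at h1
    obtain ⟨i, hi⟩ := (h.depth_eq_zero_iff (false, j)).1 (by omega)
    exact ⟨i, hi.symm⟩

open Classical in
theorem coreLen_eq_card (hx : x false 0 = 0) :
    l = ((Finset.Ico (0 : ℤ) (F.period false)).filter (· ∈ F.fixedVertices)).card := by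
  have hl : x false l = F.period false := by
    have := h.add_period false 0
    rwa [hx, zero_add, zero_add] at this
  have himg : (Finset.Ico (0 : ℤ) (F.period false)).filter (· ∈ F.fixedVertices) =
      (Finset.Ico (0 : ℤ) l).image (x false) := by
    ext j
    simp only [Finset.mem_filter, Finset.mem_Ico, Finset.mem_image, ← h.range_core_false]
    constructor
    · rintro ⟨⟨h1, h2⟩, i, rfl⟩
      rw [← hx, (h.strictMono false).le_iff_le] at h1
      rw [← hl, (h.strictMono false).lt_iff_lt] at h2
      exact ⟨i, ⟨h1, h2⟩, rfl⟩
    · rintro ⟨i, ⟨h1, h2⟩, rfl⟩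
      refine ⟨⟨?_, ?_⟩, i, rfl⟩
      · rwa [← hx, (h.strictMono false).le_iff_le]
      · rwa [← hl, (h.strictMono false).lt_iff_lt]
  rw [himg, Finset.card_image_of_injective _ (h.strictMono false).injective, Int.card_Ico]
  omega

end IsCore

/-- Among the times `0, …, t - 1`, where `t` is the time of `j`, those of vertices of the same kind
are the times of `0, …, j - 1`. -/
theorem sum_letter_eq {b : Bool} (h0 : F.father b 0 = 0) {j : ℤ} (hj : 0 ≤ j) {t : ℕ}
    (ht : F.time b j = t) :
    ∑ s ∈ Finset.range t, ((bif b then (F.letter s).2 else (F.letter s).1).toNat : ℤ) = j := by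
  classical
  have ht0 : F.time b 0 = 0 := by simp [time, h0]
  have h1 : ∀ s, (bif b then (F.letter s).2 else (F.letter s).1).toNat =
      if ∃ j, F.time b j = s then 1 else 0 := fun s => by
    cases b <;> simp only [letter, cond_true, cond_false] <;> split_ifs with h <;> simp [h]
  have h2 : ∑ s ∈ Finset.range t, (bif b then (F.letter s).2 else (F.letter s).1).toNat =
      (Finset.Ico 0 j).card := by
    simp only [h1]
    rw [← Finset.card_filter]
    symm
    refine Finset.card_nbij (fun i => (F.time b i).toNat) ?_ ?_ ?_
    · intro i hi
      simp only [Finset.coe_Ico, Set.mem_Ico] at hi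
      have h3 := (F.time_strictMono b).monotone hi.1
      have h4 := (F.time_strictMono b) hi.2
      simp only [Finset.coe_filter, Finset.mem_range, Set.mem_ofPred_eq]
      exact ⟨by omega, i, by omega⟩
    · intro i hi i' hi' he
      simp only [Finset.coe_Ico, Set.mem_Ico] at hi hi'
      have h3 := (F.time_strictMono b).monotone hi.1
      have h4 := (F.time_strictMono b).monotone hi'.1
      exact (F.time_strictMono b).injective (by simp only at he; omega)
    · intro s hs
      simp only [Finset.coe_filter, Finset.mem_range, Set.mem_ofPred_eq] at hs
      obtain ⟨hs, i, hi⟩ := hs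
      refine ⟨i, ?_, by simp only; omega⟩
      simp only [Finset.coe_Ico, Set.mem_Ico]
      rw [← (F.time_strictMono b).le_iff_le, ← (F.time_strictMono b).lt_iff_lt]
      omega
  rw [← Nat.cast_sum, h2, Int.card_Ico]
  omega

end PeriodicForest

namespace PeriodicForest

variable {F : PeriodicForest}

theorem time_zero (h0 : ∀ b, F.father b 0 = 0) (b : Bool) : F.time b 0 = 0 := by
  simp [time, h0]

theorem time_period (h0 : ∀ b, F.father b 0 = 0) (b : Bool) :
    F.time b (F.period b) = (F.period false + F.period true : ℕ) := by
  have := F.time_add_period b 0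
  rwa [time_zero h0, zero_add, zero_add] at this

/-- Where both paths have a step, the level of the walk is the difference of their positions. -/
theorem sum_walkStep_letter (h0 : ∀ b, F.father b 0 = 0) {i j : ℤ} {t : ℕ} (hi : F.time false i = t)
    (hj : F.time true j = t) : ∑ s ∈ Finset.range t, walkStep (F.letter s) = i + j - t := by
  have hi0 : 0 ≤ i := by
    rw [← (F.time_strictMono false).le_iff_le, time_zero h0]
    omega
  have hj0 : 0 ≤ j := by
    rw [← (F.time_strictMono true).le_iff_le, time_zero h0]
    omega
  have h1 := F.sum_letter_eq (h0 false) hi0 hi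
  have h2 := F.sum_letter_eq (h0 true) hj0 hj
  simp only [cond_false, cond_true] at h1 h2
  simp only [walkStep, Finset.sum_sub_distrib, Finset.sum_add_distrib, h1, h2]
  simp

open Classical in
theorem upCrossings_letter (h0 : ∀ b, F.father b 0 = 0) :
    upCrossings 0 F.letter (F.period false + F.period true) =
      ((Finset.Ico (0 : ℤ) (F.period false)).filter (· ∈ F.fixedVertices)).card := by
  have t0 := time_zero h0
  symm
  unfold upCrossings
  refine Finset.card_nbij (fun i => (F.time false i).toNat) ?_ ?_ ?_
  · intro i hi
    simp only [Finset.coe_filter, Finset.mem_Ico, Set.mem_ofPred_eq] at hi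
    obtain ⟨⟨h1, h2⟩, h3⟩ := hi
    change F.father true (F.father false i) = i at h3
    have h4 := (F.time_strictMono false).monotone h1
    have h5 := F.time_strictMono false h2
    rw [time_period h0] at h5
    rw [t0] at h4
    have h6 : F.time false i = (F.time false i).toNat := by omega
    have h7 : F.time true (F.father false i) = (F.time false i).toNat := by
      rw [← h6, time, time, h3, add_comm]
    simp only [Finset.coe_filter, Finset.mem_range, Set.mem_ofPred_eq]
    refine ⟨by omega, ?_, ?_⟩
    · simp only [letter, Prod.mk.injEq, decide_eq_true_eq]
      exact ⟨⟨_, h6⟩, ⟨_, h7⟩⟩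
    · rw [zero_add, sum_walkStep_letter h0 h6 h7, ← h6, time]
      ring
  · intro i hi i' hi' he
    simp only [Finset.coe_filter, Finset.mem_Ico, Set.mem_ofPred_eq] at hi hi'
    have h3 := (F.time_strictMono false).monotone hi.1.1
    have h4 := (F.time_strictMono false).monotone hi'.1.1
    rw [t0] at h3 h4
    exact (F.time_strictMono false).injective (by simp only at he; omega)
  · intro t ht
    simp only [Finset.coe_filter, Finset.mem_range, Set.mem_ofPred_eq, letter, Prod.mk.injEq,
      decide_eq_true_eq] at ht
    obtain ⟨h1, ⟨⟨i, hi⟩, ⟨j, hj⟩⟩, h3⟩ := ht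
    have h4 := sum_walkStep_letter h0 hi hj
    simp only [letter] at h4
    rw [zero_add, h4] at h3
    refine ⟨i, ?_, by simp only; omega⟩
    simp only [Finset.coe_filter, Finset.mem_Ico, Set.mem_ofPred_eq]
    refine ⟨⟨?_, ?_⟩, ?_⟩
    · rw [← (F.time_strictMono false).le_iff_le, t0]
      omega
    · rw [← (F.time_strictMono false).lt_iff_lt, time_period h0]
      omega
    · have h5 : F.father false i = j := by
        unfold time at hi
        omega
      change F.father true (F.father false i) = i
      rw [h5]
      unfold time at hj
      omega

end PeriodicForest

theorem extendWord_apply {n : ℕ} (g : ℕ → Bool × Bool) {t : ℕ} (ht : t < n) :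
    extendWord (fun i : Fin n => g i) t = g t := by
  simp [extendWord, ht]

theorem isWalk_iff {n : ℕ} (d : ℤ) (l : ℕ) (g : ℕ → Bool × Bool) :
    IsWalk d l (fun i : Fin n => g i) ↔
      d + ∑ s ∈ Finset.range n, walkStep (g s) = 0 ∧ upCrossings d g n = l := by
  have h1 : ∀ t ≤ n, ∑ s ∈ Finset.range t, walkStep (extendWord (fun i : Fin n => g i) s) =
      ∑ s ∈ Finset.range t, walkStep (g s) := fun t ht =>
    Finset.sum_congr rfl fun s hs => by
      rw [extendWord_apply g (by have := Finset.mem_range.1 hs; omega)]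
  have h2 : upCrossings d (extendWord (fun i : Fin n => g i)) n = upCrossings d g n := by
    unfold upCrossings
    congr 1
    refine Finset.filter_congr fun t ht => ?_
    have := Finset.mem_range.1 ht
    rw [h1 t (by omega), extendWord_apply g this]
  unfold IsWalk
  rw [h1 n le_rfl, h2]

namespace MarkedForest

theorem father_zero (S : MarkedForest 0) (b : Bool) : S.forest.father b 0 = 0 := by
  have := S.isCore.father_core b 0
  simpa [S.core_zero] using this

/-- A marked forest is determined by its forest, since the mark is at the coordinate `0` and the
core is unique. -/
theorem eq_of_forest_eq {k : Bool → ℤ} {S S' : MarkedForest k} (h : S.forest = S'.forest) :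
    S = S' := by
  obtain ⟨F, l, x, hx, h0⟩ := S
  obtain ⟨F', l', x', hx', h0'⟩ := S'
  simp only at h
  subst h
  obtain ⟨-, rfl, d, hd⟩ := hx.unique hx' rfl
  have h1 : x false 0 = x false (0 + d) := by rw [← hd, h0, h0']
  have h2 := (hx.strictMono false).injective h1
  obtain rfl : d = 0 := by omega
  refine ext' rfl rfl rfl ?_
  ext b i
  exact ((hd b i).trans (by rw [add_zero])).symm

open Classical in
theorem isWalk_letter {l n : ℕ} (S : OfSize 0 l n) :
    IsWalk 0 l (fun i : Fin n => S.1.forest.letter i) := by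
  obtain ⟨S, rfl, rfl⟩ := S
  rw [isWalk_iff]
  refine ⟨?_, ?_⟩
  · rw [PeriodicForest.sum_walkStep_letter S.father_zero
      (PeriodicForest.time_period S.father_zero false)
      (PeriodicForest.time_period S.father_zero true)]
    push_cast
    ring
  · rw [PeriodicForest.upCrossings_letter S.father_zero,
      S.isCore.coreLen_eq_card (S.core_zero false)]

theorem letter_zero (S : MarkedForest 0) : S.forest.letter 0 = (true, true) := by
  have := PeriodicForest.time_zero S.father_zero
  simp only [PeriodicForest.letter, Prod.mk.injEq, decide_eq_true_eq]
  exact ⟨⟨0, by simp [this]⟩, ⟨0, by simp [this]⟩⟩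

/-- The word of a forest on one period determines the times of its vertices. -/
theorem range_time_eq {n : ℕ} {S S' : MarkedForest 0}
    (hS : S.forest.period false + S.forest.period true = n)
    (hS' : S'.forest.period false + S'.forest.period true = n)
    (h : ∀ t < n, S.forest.letter t = S'.forest.letter t) (b : Bool) :
    Set.range (S.forest.time b) ⊆ Set.range (S'.forest.time b) := by
  have hn : 0 < n := by
    have := S.forest.period_pos false
    omega
  have hmul : ∀ (S : MarkedForest 0), S.forest.period false + S.forest.period true = n →
      ∀ q j : ℤ, S.forest.time b (j + q * S.forest.period b) = S.forest.time b j + q * n := by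
    rintro S rfl q j
    induction q using Int.induction_on with
    | zero => simp
    | succ q ih =>
      rw [show j + ((q : ℤ) + 1) * S.forest.period b =
        j + q * S.forest.period b + S.forest.period b by ring, S.forest.time_add_period, ih]
      ring
    | pred q ih =>
      have := S.forest.time_add_period b (j + (-(q : ℤ) - 1) * S.forest.period b)
      rw [show j + (-(q : ℤ) - 1) * S.forest.period b + S.forest.period b =
        j + -q * S.forest.period b by ring, ih] at this
      linarith
  rintro _ ⟨j, rfl⟩
  have h1 := Int.emod_nonneg (S.forest.time b j) (b := (n : ℤ)) (by omega)
  have h2 := Int.emod_lt_of_pos (S.forest.time b j) (b := (n : ℤ)) (by omega)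
  have h3 := Int.emod_add_mul_ediv (S.forest.time b j) n
  obtain ⟨t, ht⟩ := Int.eq_ofNat_of_zero_le h1
  have h4 := h t (by omega)
  have h5 : ∃ i, S.forest.time b i = t := by
    refine ⟨j + -(S.forest.time b j / n) * S.forest.period b, ?_⟩
    rw [hmul S hS]
    linarith
  have h6 : ∃ i, S'.forest.time b i = t := by
    simp only [PeriodicForest.letter, Prod.mk.injEq, decide_eq_decide] at h4
    cases b
    · exact h4.1.1 h5
    · exact h4.2.1 h5
  obtain ⟨i, hi⟩ := h6
  refine ⟨i + (S.forest.time b j / n) * S'.forest.period b, ?_⟩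
  rw [hmul S' hS', hi]
  linarith

theorem eq_of_letter_eq {n : ℕ} {S S' : MarkedForest 0}
    (hS : S.forest.period false + S.forest.period true = n)
    (hS' : S'.forest.period false + S'.forest.period true = n)
    (h : ∀ t < n, S.forest.letter t = S'.forest.letter t) : S = S' := by
  have htime : ∀ b j, S'.forest.time b j = S.forest.time b j := fun b j => by
    obtain ⟨a, ha⟩ := strictMono_int_eq_shift (S.forest.time_strictMono b)
      (S'.forest.time_strictMono b) ((range_time_eq hS hS' h b).antisymm
        (range_time_eq hS' hS (fun t ht => (h t ht).symm) b))
    have h1 : S.forest.time b 0 = S.forest.time b (0 + a) := by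
      rw [← ha, PeriodicForest.time_zero S'.father_zero, PeriodicForest.time_zero S.father_zero]
    have h2 := (S.forest.time_strictMono b).injective h1
    rw [ha, show j + a = j by omega]
  apply eq_of_forest_eq
  ext b j
  · have h1 := S.forest.time_add_period b 0
    have h2 := S'.forest.time_add_period b 0
    rw [hS, ← htime, ← htime] at h1
    rw [hS', ← h1] at h2
    have := (S'.forest.time_strictMono b).injective h2
    omega
  · have := htime b j
    unfold PeriodicForest.time at this
    omega

/-- Every closed walk that starts with a step `0 → 1` is the word of a forest. -/
theorem exists_letter_eq {l n : ℕ} {g : Fin n → Bool × Bool} (hg : IsWalk 0 l g)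
    (hg0 : extendWord g 0 = (true, true)) :
    ∃ S : OfSize 0 l n, (fun i : Fin n => S.1.forest.letter i) = g := by
  classical
  have hn : 0 < n := by
    by_contra h0
    simp [extendWord, h0] at hg0
  let comp : Bool → Bool × Bool → Bool := fun b a => bif b then a.2 else a.1
  let Q : Bool → Set ℤ := fun b => {t | comp b (extendWord g (t % n).toNat) = true}
  have hQp : ∀ b (t : ℤ), t + n ∈ Q b ↔ t ∈ Q b := fun b t => by
    simp [Q]
  have hQ0 : ∀ b, (0 : ℤ) ∈ Q b := fun b => by
    simp only [Q, Set.mem_ofPred_eq, EuclideanDomain.zero_mod, Int.toNat_zero, hg0]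
    cases b <;> rfl
  have hQt : ∀ b (t : ℕ), t < n → ((t : ℤ) ∈ Q b ↔ comp b (extendWord g t) = true) :=
    fun b t ht => by
      simp only [Q, Set.mem_ofPred_eq]
      rw [Int.emod_eq_of_lt (by omega) (by omega), Int.toNat_natCast]
  choose x hx hr hx0 hxp using fun b => exists_periodic_enumeration hn (hQp b) (hQ0 b)
  obtain ⟨p, hp⟩ : ∃ p : Bool → ℕ, ∀ b,
      p b = ((Finset.Ico (0 : ℤ) (0 + n)).filter (· ∈ Q b)).card := ⟨_, fun b => rfl⟩
  have hxp' : ∀ b i, x b (i + p b) = x b i + n := fun b i => by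
    rw [hp]
    convert hxp b i
  have hpsum : ∀ b, (p b : ℤ) = ∑ t ∈ Finset.range n, ((comp b (extendWord g t)).toNat : ℤ) := by
    intro b
    have h1 : ∀ t, (comp b (extendWord g t)).toNat =
        if comp b (extendWord g t) = true then 1 else 0 :=
      fun t => by cases comp b (extendWord g t) <;> rfl
    rw [← Nat.cast_sum, hp]
    congr 1
    simp only [h1]
    rw [← Finset.card_filter, zero_add]
    symm
    refine Finset.card_nbij (fun t => (t : ℤ)) ?_ ?_ ?_
    · intro t ht
      simp only [Finset.coe_filter, Finset.mem_range, Set.mem_ofPred_eq, Finset.mem_Ico] at ht ⊢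
      exact ⟨by omega, (hQt b t ht.1).2 ht.2⟩
    · intro s _ t _ hst
      exact Int.ofNat_inj.1 hst
    · intro t ht
      simp only [Finset.coe_filter, Set.mem_ofPred_eq, Finset.mem_Ico] at ht
      obtain ⟨t, rfl⟩ := Int.eq_ofNat_of_zero_le ht.1.1
      refine ⟨t, ?_, rfl⟩
      simp only [Finset.coe_filter, Finset.mem_range, Set.mem_ofPred_eq]
      exact ⟨by omega, (hQt b t (by omega)).1 ht.2⟩
  have hpn : p false + p true = n := by
    have h1 := hg.1
    simp only [walkStep, Finset.sum_sub_distrib, Finset.sum_add_distrib] at h1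
    have h2 := hpsum false
    have h3 := hpsum true
    simp only [comp, cond_false, cond_true] at h2 h3
    rw [← h2, ← h3] at h1
    simp only [Finset.sum_const, Finset.card_range, nsmul_eq_mul, mul_one] at h1
    omega
  have hpos : ∀ b, 0 < p b := fun b => by
    by_contra h0
    have := hxp' b 0
    rw [show p b = 0 by omega] at this
    simp only [Nat.cast_zero, add_zero] at this
    omega
  let F : PeriodicForest :=
    { period := p
      father := fun b j => x b j - j
      period_pos := hpos
      mono := fun b => monotone_int_of_le_succ fun j => by
        have := hx b (show j < j + 1 by omega)
        omega
      father_add := fun b j => by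
        rw [hxp']
        cases b <;> simp only [Bool.not_true, Bool.not_false] <;> omega }
  have hF0 : ∀ b, F.father b 0 = 0 := fun b => by
    simp only [F, hx0]
    rfl
  obtain ⟨l', y, hy, hy0⟩ := F.exists_isCore_zero hF0
  have htime : ∀ b j, F.time b j = x b j := fun b j => by
    simp [F, PeriodicForest.time]
  have hletter : (fun i : Fin n => F.letter i) = g := by
    ext i
    all_goals
      have h1 : ∀ b, (∃ j, F.time b j = ((i : ℕ) : ℤ)) ↔ comp b (g i) = true := fun b => by
        have h2 := hQt b i i.2
        rw [← hr, extendWord, dif_pos i.2] at h2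
        simpa [htime] using h2
      simp [PeriodicForest.letter, h1, comp]
  have hS : F.period false + F.period true = n := hpn
  have hwalk := isWalk_letter (l := l') (n := n) ⟨⟨F, l', y, hy, hy0⟩, rfl, hS⟩
  simp only [hletter] at hwalk
  exact ⟨⟨⟨F, l', y, hy, hy0⟩, hwalk.2.symm.trans hg.2, hS⟩, hletter⟩

/-- The marked forests whose core is not shifted correspond to the closed walks that start with a
step `0 → 1`; the length of the walk is the number of vertices in a period. -/
theorem nonempty_equiv_walks (l n : ℕ) : Nonempty (OfSize 0 l n ≃
    {g : Fin n → Bool × Bool // IsWalk 0 l g ∧ extendWord g 0 = (true, true)}) := by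
  have hpos : ∀ S : OfSize 0 l n, 0 < n := fun S => by
    have := S.1.forest.period_pos false
    have := S.2.2
    omega
  refine ⟨Equiv.ofBijective (fun S => ⟨fun i : Fin n => S.1.forest.letter i, isWalk_letter S, ?_⟩)
    ⟨fun S S' h => ?_, fun g => ?_⟩⟩
  · rw [extendWord_apply _ (hpos S), letter_zero]
  · refine Subtype.ext (eq_of_letter_eq S.2.2 S'.2.2 fun t ht => ?_)
    exact congrFun (congrArg Subtype.val h) ⟨t, ht⟩
  · obtain ⟨S, hS⟩ := exists_letter_eq g.2.1 g.2.2
    exact ⟨S, Subtype.ext hS⟩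

theorem finite_ofSize (k : Bool → ℤ) (l n : ℕ) : Finite (OfSize k l n) := by
  obtain ⟨e⟩ := nonempty_ofSize_equiv k 0 l n
  obtain ⟨e'⟩ := nonempty_equiv_walks l n
  exact Finite.of_equiv _ (e.trans e').symm

theorem card_ofSize (k : Bool → ℤ) {l : ℕ} (hl : 0 < l) (n : ℕ) :
    (Nat.card (OfSize k l n) : ℚ) = PowerSeries.coeff n (tupleSeries ^ l) := by
  obtain ⟨e⟩ := nonempty_ofSize_equiv k 0 l n
  obtain ⟨e'⟩ := nonempty_equiv_walks l n
  rw [Nat.card_congr (e.trans e')]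
  obtain ⟨l, rfl⟩ : ∃ l', l = l' + 1 := ⟨l - 1, by omega⟩
  rcases n with _ | n
  · have : IsEmpty {g : Fin 0 → Bool × Bool //
        IsWalk 0 (l + 1) g ∧ extendWord g 0 = (true, true)} :=
      ⟨fun g => by simpa [extendWord] using g.2.2⟩
    rw [Nat.card_of_isEmpty, PowerSeries.coeff_zero_eq_constantCoeff_apply, map_pow,
      constantCoeff_tupleSeries]
    simp
  · rw [card_fin_succ_fun]
    simp only [extendWord_cons_zero, isWalk_cons]
    rw [Finset.sum_eq_single (true, true)]
    · simp only [and_self, if_true, add_left_inj, exists_eq_left', and_true]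
      rw [card_isWalk, ← PowerSeries.coeff_succ_X_mul]
      congr 1
      rw [pow_succ, tupleSeries_eq, passageSeries]
      simp only [Int.natAbs_one]
      ring
    · intro a _ ha
      simp only [ha, and_false, Nat.card_of_isEmpty]
    · simp

end MarkedForest

/-! ### Pruning periodic forests -/

namespace PeriodicForest

/-- The forest in which the vertices of kind `b` are renumbered by subtracting `a b`. -/
def translate (F : PeriodicForest) (a : Bool → ℤ) : PeriodicForest where
  period := F.period
  father b j := F.father b (j + a b) - a (!b)
  period_pos := F.period_pos
  mono b i j hij := sub_le_sub_right (F.mono b (by omega)) _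
  father_add b j := by
    rw [add_right_comm, F.father_add]
    ring

theorem translate_translate (F : PeriodicForest) (a a' : Bool → ℤ) :
    (F.translate a).translate a' = F.translate fun b => a b + a' b := by
  ext b j
  · rfl
  · simp only [translate]
    rw [show j + a' b + a b = j + (a b + a' b) by ring]
    ring

theorem IsCore.translate {F : PeriodicForest} {k : Bool → ℤ} {l : ℕ} {x : Bool → ℤ → ℤ}
    (h : F.IsCore k l x) (a : Bool → ℤ) :
    (F.translate a).IsCore k l fun b i => x b i - a b where
  strictMono b i j hij := sub_lt_sub_right (h.strictMono b hij) _
  add_period b i := by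
    rw [h.add_period]
    simp only [PeriodicForest.translate]
    ring
  father_core b i := by
    simp [PeriodicForest.translate, h.father_core]
  reach := by
    have key : ∀ (m : ℕ) (v : Bool × ℤ), (F.translate a).step^[m] (v.1, v.2 - a v.1) =
        ((F.step^[m] v).1, (F.step^[m] v).2 - a (F.step^[m] v).1) := by
      intro m
      induction m with
      | zero => intro v; rfl
      | succ m ih =>
        intro v
        rw [Function.iterate_succ_apply, Function.iterate_succ_apply, ← ih]
        simp [step, PeriodicForest.translate]
    rintro ⟨b, j⟩
    obtain ⟨m, i, hm⟩ := h.reach (b, j + a b)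
    refine ⟨m, i, ?_⟩
    have := key m (b, j + a b)
    simp only [add_sub_cancel_right] at this
    rw [this, hm]

/-- The forest `G` arises from `F` by deleting the leaf `z` of kind `b` and its translates; `c`
enumerates the remaining vertices. -/
structure Prunes (F G : PeriodicForest) (b : Bool) (z : ℤ) (c : Bool → ℤ → ℤ) : Prop where
  leaf : ∀ j, F.father (!b) j ≠ z
  strictMono : ∀ b', StrictMono (c b')
  range_eq : Set.range (c b) = {j | ¬ (F.period b : ℤ) ∣ j - z}
  range_not_eq : Set.range (c (!b)) = Set.univ
  period_eq : G.period b + 1 = F.period b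
  period_not_eq : G.period (!b) = F.period (!b)
  map_father : ∀ b' j, F.father b' (c b' j) = c (!b') (G.father b' j)

theorem father_add_mul (F : PeriodicForest) (b : Bool) (j q : ℤ) :
    F.father b (j + q * F.period b) = F.father b j + q * F.period (!b) := by
  induction q using Int.induction_on with
  | zero => simp
  | succ q ih =>
    rw [show j + ((q : ℤ) + 1) * F.period b = j + q * F.period b + F.period b by ring,
      F.father_add, ih]
    ring
  | pred q ih =>
    have := F.father_add b (j + (-(q : ℤ) - 1) * F.period b)
    rw [show j + (-(q : ℤ) - 1) * F.period b + F.period b = j + -q * F.period b by ring, ih]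
      at this
    linarith

/-- A translate of a leaf is a leaf. -/
theorem not_dvd_of_leaf {F : PeriodicForest} {b : Bool} {z : ℤ} (hz : ∀ j, F.father (!b) j ≠ z)
    (j : ℤ) : ¬ (F.period b : ℤ) ∣ F.father (!b) j - z := by
  rintro ⟨q, hq⟩
  apply hz (j + -q * F.period (!b))
  rw [F.father_add_mul, Bool.not_not]
  linarith

theorem exists_enumeration_not_dvd {p : ℕ} {z q : ℤ} (hp : 0 < p) (hq : ¬ (p : ℤ) ∣ q - z) :
    ∃ x : ℤ → ℤ, StrictMono x ∧ Set.range x = {j | ¬ (p : ℤ) ∣ j - z} ∧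
      ∀ i, x (i + (p - 1 : ℕ)) = x i + p := by
  classical
  obtain ⟨x, hx, hr, -, hxp⟩ := exists_periodic_enumeration (Q := {j | ¬ (p : ℤ) ∣ j - z}) hp
    (fun j => by
      simp only [Set.mem_ofPred_eq]
      rw [show j + p - z = j - z + p by ring, dvd_add_self_right]) hq
  have hxp' : ∀ i, x (i + ((Finset.Ico q (q + p)).filter
      fun j => j ∈ {j : ℤ | ¬ (p : ℤ) ∣ j - z}).card) = x i + p := fun i => by
    convert hxp i
  have h1 := Finset.card_filter_add_card_filter_not (s := Finset.Ico q (q + p))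
    (fun j => j ∈ {j : ℤ | ¬ (p : ℤ) ∣ j - z})
  have h2 : ((Finset.Ico q (q + p)).filter
      fun j => ¬ j ∈ {j : ℤ | ¬ (p : ℤ) ∣ j - z}).card = 1 := by
    refine Finset.card_eq_one.2 ⟨q + (z - q) % p, ?_⟩
    have h3 := Int.emod_nonneg (z - q) (b := (p : ℤ)) (by omega)
    have h4 := Int.emod_lt_of_pos (z - q) (b := (p : ℤ)) (by omega)
    have h5 := Int.emod_add_mul_ediv (z - q) p
    ext j
    simp only [Finset.mem_filter, Finset.mem_Ico, Set.mem_ofPred_eq, not_not,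
      Finset.mem_singleton]
    constructor
    · rintro ⟨⟨h6, h7⟩, m, hm⟩
      have h8 : (z - q) % p = (j - q) % p := by
        rw [show j - q = z - q + p * m by linarith, Int.add_mul_emod_self_left]
      rw [h8, Int.emod_eq_of_lt (by omega) (by omega)]
      ring
    · rintro rfl
      exact ⟨⟨by omega, by omega⟩, -((z - q) / p), by linarith⟩
  rw [h2, Int.card_Ico] at h1
  have h3 : (q + p - q).toNat = p := by omega
  rw [h3] at h1
  rw [Nat.eq_sub_of_add_eq h1] at hxp'
  exact ⟨x, hx, hr, hxp'⟩

namespace Prunes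

variable {F G : PeriodicForest} {b : Bool} {z : ℤ} {c : Bool → ℤ → ℤ} (h : Prunes F G b z c)
include h

theorem map_add_period (b' : Bool) (j : ℤ) : c b' (j + G.period b') = c b' j + F.period b' := by
  have hb : ∀ j, c b (j + G.period b) = c b j + F.period b := fun j => by
    obtain ⟨x, hx, hr, hp⟩ := exists_enumeration_not_dvd (F.period_pos b) (not_dvd_of_leaf h.leaf 0)
    obtain ⟨a, ha⟩ := strictMono_int_eq_shift hx (h.strictMono b) (hr.trans h.range_eq.symm)
    have := h.period_eq
    rw [ha, ha, ← hp, show F.period b - 1 = G.period b by omega]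
    ring_nf
  have hnb : ∀ j, c (!b) (j + G.period (!b)) = c (!b) j + F.period (!b) := fun j => by
    obtain ⟨a, ha⟩ := strictMono_int_eq_shift (x := fun i => i) (fun i j hij => hij)
      (h.strictMono (!b)) (by
        rw [h.range_not_eq]
        ext j
        exact ⟨fun _ => trivial, fun _ => ⟨j, rfl⟩⟩)
    rw [ha, ha, h.period_not_eq]
    ring
  cases b <;> cases b'
  · exact hb j
  · exact hnb j
  · exact hnb j
  · exact hb j

theorem father_mem_range (b' : Bool) (j : ℤ) : F.father b' j ∈ Set.range (c (!b')) := by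
  by_cases hb : b' = b
  · subst hb
    rw [h.range_not_eq]
    trivial
  · obtain rfl : b' = !b := by cases b <;> cases b' <;> simp_all
    rw [Bool.not_not, h.range_eq]
    exact not_dvd_of_leaf h.leaf j

/-- Pruning does not change the core. -/
theorem isCore {k : Bool → ℤ} {l : ℕ} {x : Bool → ℤ → ℤ} (hx : G.IsCore k l x) :
    F.IsCore k l fun b i => c b (x b i) where
  strictMono b := (h.strictMono b).comp (hx.strictMono b)
  add_period b i := by rw [hx.add_period, h.map_add_period]
  father_core b i := by rw [h.map_father, hx.father_core]
  reach := by
    have key : ∀ (m : ℕ) (v : Bool × ℤ), F.step^[m] (v.1, c v.1 v.2) =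
        ((G.step^[m] v).1, c (G.step^[m] v).1 (G.step^[m] v).2) := by
      intro m
      induction m with
      | zero => intro v; rfl
      | succ m ih =>
        intro v
        rw [Function.iterate_succ_apply, Function.iterate_succ_apply, ← ih]
        simp [step, h.map_father]
    rintro ⟨b', j⟩
    obtain ⟨i, hi⟩ := h.father_mem_range b' j
    obtain ⟨m, i', hm⟩ := hx.reach (!b', i)
    refine ⟨m + 1, i', ?_⟩
    have h1 := key m (!b', i)
    rw [Function.iterate_succ_apply, step, ← hi, h1, hm]

theorem translate (a : Bool → ℤ) : Prunes F (G.translate a) b z fun b' j => c b' (j + a b') where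
  leaf := h.leaf
  strictMono b' i j hij := h.strictMono b' (by omega)
  range_eq := by
    rw [← h.range_eq]
    exact (Equiv.addRight (a b)).surjective.range_comp (c b)
  range_not_eq := by
    rw [← h.range_not_eq]
    exact (Equiv.addRight (a (!b))).surjective.range_comp (c (!b))
  period_eq := h.period_eq
  period_not_eq := h.period_not_eq
  map_father b' j := by
    rw [h.map_father]
    simp [PeriodicForest.translate]

end Prunes

theorem exists_prunes {F : PeriodicForest} {b : Bool} {z : ℤ} (hz : ∀ j, F.father (!b) j ≠ z) :
    ∃ G c, Prunes F G b z c := by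
  have hq := not_dvd_of_leaf hz 0
  obtain ⟨x, hx, hr, hp⟩ := exists_enumeration_not_dvd (F.period_pos b) hq
  have hp2 : 2 ≤ F.period b := by
    have h1 := F.period_pos b
    by_contra h2
    rw [show F.period b = 1 by omega] at hq
    exact hq (by simp)
  let c : Bool → ℤ → ℤ := fun b' => if b' = b then x else id
  let p : Bool → ℕ := fun b' => if b' = b then F.period b - 1 else F.period b'
  have hcb : c b = x := if_pos rfl
  have hcnb : c (!b) = id := if_neg (by cases b <;> simp)
  have hpb : p b = F.period b - 1 := if_pos rfl
  have hpnb : p (!b) = F.period (!b) := if_neg (by cases b <;> simp)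
  have hall : ∀ {P : Bool → Prop}, P b → P (!b) → ∀ b', P b' := fun {P} h1 h2 b' => by
    cases b <;> cases b' <;> assumption
  have hc : ∀ b', StrictMono (c b') := hall (by rwa [hcb]) (by rw [hcnb]; exact strictMono_id)
  have hcp : ∀ b' j, c b' (j + p b') = c b' j + F.period b' :=
    hall (by rw [hcb, hpb]; exact hp) (by rw [hcnb, hpnb]; exact fun j => rfl)
  have hmem : ∀ b' j, F.father b' j ∈ Set.range (c (!b')) := by
    refine hall (fun j => ?_) (fun j => ?_)
    · rw [hcnb]
      exact ⟨_, rfl⟩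
    · rw [Bool.not_not, hcb, hr]
      exact not_dvd_of_leaf hz j
  choose g hg using fun b' j => hmem b' (c b' j)
  let G : PeriodicForest :=
    { period := p
      father := g
      period_pos := hall (by omega) (by rw [hpnb]; exact F.period_pos _)
      mono := fun b' i j hij => by
        rw [← (hc (!b')).le_iff_le, hg, hg]
        exact F.mono b' ((hc b').monotone hij)
      father_add := fun b' j => (hc (!b')).injective (by
        rw [hg, hcp, F.father_add, hcp, hg]) }
  refine ⟨G, c, hz, hc, by rw [hcb, hr], by rw [hcnb, Set.range_id], ?_, hpnb,
    fun b' j => (hg b' j).symm⟩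
  show p b + 1 = _
  omega

/-- If no vertex is a leaf then the father maps are translations. -/
theorem father_eq_of_surjective {F : PeriodicForest} (h : ∀ b, Function.Surjective (F.father b)) :
    F.period false = F.period true ∧ ∀ b j, F.father b j = j + F.father b 0 := by
  have hstep : ∀ b j, F.father b (j + 1) ≤ F.father b j + 1 := fun b j => by
    obtain ⟨i, hi⟩ := h b (F.father b j + 1)
    have h1 : j + 1 ≤ i := by
      by_contra h2
      have := F.mono b (show i ≤ j by omega)
      omega
    have := F.mono b h1
    omega
  have hsteps : ∀ b j (m : ℕ), F.father b (j + m) ≤ F.father b j + m := fun b j m => by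
    induction m with
    | zero => simp
    | succ m ih =>
      have := hstep b (j + m)
      push_cast
      rw [← add_assoc]
      omega
  have hle : ∀ b, F.period (!b) ≤ F.period b := fun b => by
    have h1 := hsteps b 0 (F.period b)
    rw [F.father_add] at h1
    omega
  have heq : F.period false = F.period true := le_antisymm (hle true) (hle false)
  have hsucc : ∀ b j, F.father b (j + 1) = F.father b j + 1 := fun b j => by
    have h1 := F.period_pos b
    have h2 := hsteps b (j + 1) (F.period b - 1)
    rw [show j + 1 + ((F.period b - 1 : ℕ) : ℤ) = j + F.period b by omega, F.father_add] at h2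
    have h3 := hstep b j
    have h4 : F.period (!b) = F.period b := by
      cases b
      · exact heq.symm
      · exact heq
    omega
  refine ⟨heq, fun b j => ?_⟩
  induction j using Int.induction_on with
  | zero => simp
  | succ j ih => rw [hsucc, ih]; ring
  | pred j ih =>
    have := hsucc b (-j - 1)
    rw [sub_add_cancel, ih] at this
    linarith

end PeriodicForest

/-! ### The forest of a periodic parallelogram polyomino -/

namespace PPPStar

theorem height_pos (P : PPPStar) : 0 < P.1.height := by
  have h1 := P.2
  rw [PPP.isDegenerate_iff] at h1
  have := P.1.height_nonneg
  omega

theorem exists_rowEnd (P : PPPStar) : ∃ g : ℤ → ℤ, ∀ j y, P.1.stripLow j ≤ y ↔ j ≤ g y := by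
  have hmul : ∀ q : ℤ, P.1.stripLow (q * P.1.width) = q * P.1.height := fun q => by
    have := P.1.stripLow_add_width 0 q
    rwa [zero_add, P.1.stripLow_zero, zero_add] at this
  have hh := P.height_pos
  refine exists_upperAdjoint P.1.stripLow_mono (fun y => ⟨(|y| + 1) * P.1.width, ?_⟩)
    fun y => ⟨-|y| * P.1.width, ?_⟩
  · rw [hmul]
    nlinarith [le_abs_self y, abs_nonneg y]
  · rw [hmul]
    nlinarith [neg_abs_le y, abs_nonneg y]

/-- The column of the rightmost cell of a row of the infinite strip. -/
noncomputable def rowEnd (P : PPPStar) : ℤ → ℤ := P.exists_rowEnd.choose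

theorem stripLow_le_iff (P : PPPStar) (j y : ℤ) : P.1.stripLow j ≤ y ↔ j ≤ P.rowEnd y :=
  P.exists_rowEnd.choose_spec j y

/-- The ordered cyclic forest of a polyomino: the vertex `j` of kind `false` is the topmost cell of
the column `j` and the vertex `y` of kind `true` is the rightmost cell of the row `y`. -/
noncomputable def forest (P : PPPStar) : PeriodicForest where
  period b := match b with
    | false => P.1.width
    | true => P.1.height.toNat
  father b j := match b with
    | false => P.1.stripUp j - 1
    | true => P.rowEnd j
  period_pos := by
    rintro (_ | _)
    · exact P.1.width_pos
    · have := P.height_pos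
      dsimp only
      omega
  mono := by
    rintro (_ | _) i j hij
    · exact sub_le_sub_right (P.1.stripUp_mono hij) 1
    · exact (P.stripLow_le_iff _ _).1 (((P.stripLow_le_iff _ _).2 le_rfl).trans hij)
  father_add := by
    have hh := P.height_pos
    rintro (_ | _) j
    · have := P.1.stripUp_add_width j 1
      simp only [one_mul] at this
      simp only [Bool.not_false, this]
      omega
    · simp only [Bool.not_true]
      rw [Int.toNat_of_nonneg hh.le]
      refine eq_of_forall_le_iff fun i => ?_
      have h1 := P.1.stripLow_add_width (i - P.1.width) 1
      rw [one_mul, one_mul, sub_add_cancel] at h1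
      have h2 := P.stripLow_le_iff i (j + P.1.height)
      have h3 := P.stripLow_le_iff (i - P.1.width) j
      omega

theorem forest_period_true (P : PPPStar) : (P.forest.period true : ℤ) = P.1.height :=
  Int.toNat_of_nonneg P.height_pos.le

theorem lt_grandfather (P : PPPStar) (j : ℤ) :
    j < P.forest.father true (P.forest.father false j) := by
  have h1 := (P.1.strip_step j).2.2
  have h2 := (P.stripLow_le_iff (j + 1) (P.1.stripUp j - 1)).1 (by omega)
  show j < P.rowEnd (P.1.stripUp j - 1)
  omega

theorem mem_strip_iff (P : PPPStar) (j y : ℤ) :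
    (j, y) ∈ P.1.strip ↔ j ≤ P.forest.father true y ∧ y ≤ P.forest.father false j := by
  show P.1.stripLow j ≤ y ∧ y < P.1.stripUp j ↔ j ≤ P.rowEnd y ∧ y ≤ P.1.stripUp j - 1
  rw [P.stripLow_le_iff]
  omega

theorem lt_grandfather' (P : PPPStar) (y : ℤ) :
    y < P.forest.father false (P.forest.father true y) := by
  by_contra h
  have h1 := P.forest.mono true (not_lt.1 h)
  have h2 := P.lt_grandfather (P.forest.father true y)
  omega

theorem isTopmost_iff (P : PPPStar) (s : ℤ × ℤ) :
    IsTopmost P.1.strip s ↔ s.2 = P.forest.father false s.1 := by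
  obtain ⟨j, y⟩ := s
  simp only [IsTopmost, mem_strip_iff]
  have h1 := P.forest.mono true (show y ≤ y + 1 by omega)
  constructor
  · rintro ⟨h2, h3⟩
    omega
  · rintro rfl
    have := P.lt_grandfather j
    omega

theorem isRightmost_iff (P : PPPStar) (s : ℤ × ℤ) :
    IsRightmost P.1.strip s ↔ s.1 = P.forest.father true s.2 := by
  obtain ⟨j, y⟩ := s
  simp only [IsRightmost, mem_strip_iff]
  have h1 := P.forest.mono false (show j ≤ j + 1 by omega)
  constructor
  · rintro ⟨h2, h3⟩
    omega
  · rintro rfl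
    have := P.lt_grandfather' y
    omega

theorem isLeaf_iff (P : PPPStar) (s : ℤ × ℤ) : IsLeaf P.1.strip s ↔
    (s.2 = P.forest.father false s.1 ∧ ∀ y, P.forest.father true y ≠ s.1) ∨
      (s.1 = P.forest.father true s.2 ∧ ∀ j, P.forest.father false j ≠ s.2) := by
  obtain ⟨j, y⟩ := s
  have hno : ¬ (y = P.forest.father false j ∧ j = P.forest.father true y) := by
    rintro ⟨rfl, h⟩
    have := P.lt_grandfather j
    omega
  simp only [IsLeaf, IsFather, isTopmost_iff, isRightmost_iff]
  constructor
  · rintro ⟨h1 | h1, h2⟩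
    · refine Or.inl ⟨h1, fun y' hy' => h2 (j, y') (Or.inr ⟨hy'.symm, h1, rfl⟩)⟩
    · refine Or.inr ⟨h1, fun j' hj' => h2 (j', y) (Or.inl ⟨hj'.symm, h1, rfl⟩)⟩
  · rintro (⟨h1, h2⟩ | ⟨h1, h2⟩)
    · refine ⟨Or.inl h1, ?_⟩
      rintro ⟨j', y'⟩ (⟨_, h4, _⟩ | ⟨h3, _, h5⟩)
      · exact hno ⟨h1, h4⟩
      · simp only at h3 h5
        exact h2 y' (by omega)
    · refine ⟨Or.inr h1, ?_⟩
      rintro ⟨j', y'⟩ (⟨h3, _, h5⟩ | ⟨_, h4, _⟩)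
      · simp only at h3 h5
        exact h2 j' (by omega)
      · exact hno ⟨h4, h1⟩

/-- An embedding of strips whose image is closed under fathers respects the father maps. -/
theorem father_eq_of_embedding {P Q : PPPStar} {c r : ℤ ↪o ℤ}
    (h : ∀ j y, (j, y) ∈ Q.1.strip ↔ (c j, r y) ∈ P.1.strip)
    (h1 : ∀ j, P.forest.father false (c j) ∈ Set.range r)
    (h2 : ∀ y, P.forest.father true (r y) ∈ Set.range c) :
    (∀ j, P.forest.father false (c j) = r (Q.forest.father false j)) ∧
      ∀ y, P.forest.father true (r y) = c (Q.forest.father true y) := by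
  constructor
  · intro j
    obtain ⟨y, hy⟩ := h1 j
    have htop : IsTopmost Q.1.strip (j, y) := by
      refine ⟨(h _ _).2 ((P.isTopmost_iff (c j, r y)).2 hy).1, fun hmem => ?_⟩
      have h3 : r (y + 1) ≤ P.forest.father false (c j) :=
        ((P.mem_strip_iff _ _).1 ((h _ _).1 hmem)).2
      have h4 := r.strictMono (show y < y + 1 by omega)
      omega
    rw [← hy, ← (Q.isTopmost_iff (j, y)).1 htop]
  · intro y
    obtain ⟨j, hj⟩ := h2 y
    have hright : IsRightmost Q.1.strip (j, y) := by
      refine ⟨(h _ _).2 ((P.isRightmost_iff (c j, r y)).2 hj).1, fun hmem => ?_⟩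
      have h3 : c (j + 1) ≤ P.forest.father true (r y) :=
        ((P.mem_strip_iff _ _).1 ((h _ _).1 hmem)).1
      have h4 := c.strictMono (show j < j + 1 by omega)
      omega
    rw [← hj, ← (Q.isRightmost_iff (j, y)).1 hright]

theorem exists_prunes_of_pruneStep {P Q : PPPStar} (h : PruneStep P Q) :
    ∃ b z c, P.forest.Prunes Q.forest b z c := by
  obtain ⟨⟨sx, sy⟩, hs, c, r, hcr, h⟩ := h
  have hP := P.forest_period_true
  have hQ := Q.forest_period_true
  have hno : sy = P.forest.father false sx → sx = P.forest.father true sy → False := by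
    intro h1 h2
    have := P.lt_grandfather sx
    rw [← h1, ← h2] at this
    omega
  rw [isLeaf_iff] at hs
  simp only at hs
  rcases h with ⟨htop, hw, hc, hh, hr⟩ | ⟨hright, hw, hc, hh, hr⟩
  · rw [isTopmost_iff] at htop
    have hleaf : ∀ y, P.forest.father true y ≠ sx := by
      rcases hs with hs | hs
      · exact hs.2
      · exact (hno htop hs.1).elim
    obtain ⟨h1, h2⟩ := father_eq_of_embedding hcr (fun j => by rw [hr]; trivial)
      (fun y => by
        rw [hc]
        exact PeriodicForest.not_dvd_of_leaf (b := false) hleaf (r y))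
    refine ⟨false, sx, fun b => match b with
      | false => c
      | true => r, hleaf, ?_, hc, hr, hw, ?_, ?_⟩
    · rintro (_ | _)
      · exact c.strictMono
      · exact r.strictMono
    · simp only [Bool.not_false]
      omega
    · rintro (_ | _)
      · exact h1
      · exact h2
  · rw [isRightmost_iff] at hright
    have hleaf : ∀ j, P.forest.father false j ≠ sy := by
      rcases hs with hs | hs
      · exact (hno hs.1 hright).elim
      · exact hs.2
    obtain ⟨h1, h2⟩ := father_eq_of_embedding hcr
      (fun j => by
        rw [hr]
        have := PeriodicForest.not_dvd_of_leaf (b := true) hleaf (c j)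
        rw [hP] at this
        exact this) (fun y => by rw [hc]; trivial)
    refine ⟨true, sy, fun b => match b with
      | false => c
      | true => r, hleaf, ?_, by rw [hP]; exact hr, hc, by omega, hw, ?_⟩
    · rintro (_ | _)
      · exact c.strictMono
      · exact r.strictMono
    · rintro (_ | _)
      · exact h1
      · exact h2

theorem pruneStep_of_prunes {P Q : PPPStar} {b : Bool} {z : ℤ} {c : Bool → ℤ → ℤ}
    (h : P.forest.Prunes Q.forest b z c) : PruneStep P Q := by
  have hP := P.forest_period_true
  have hQ := Q.forest_period_true
  have hmem : ∀ j y, (j, y) ∈ Q.1.strip ↔ (c false j, c true y) ∈ P.1.strip := fun j y => by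
    have h1 := h.map_father false j
    have h2 := h.map_father true y
    simp only [Bool.not_false, Bool.not_true] at h1 h2
    rw [mem_strip_iff, mem_strip_iff, h1, h2, (h.strictMono _).le_iff_le,
      (h.strictMono _).le_iff_le]
  cases b
  · have htop := (P.isTopmost_iff (z, P.forest.father false z)).2 rfl
    exact ⟨(z, P.forest.father false z), (P.isLeaf_iff _).2 (Or.inl ⟨rfl, h.leaf⟩),
      OrderEmbedding.ofStrictMono _ (h.strictMono false),
      OrderEmbedding.ofStrictMono _ (h.strictMono true), hmem,
      Or.inl ⟨htop, h.period_eq, h.range_eq, by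
        have := h.period_not_eq
        simp only [Bool.not_false] at this
        omega, h.range_not_eq⟩⟩
  · have hright := (P.isRightmost_iff (P.forest.father true z, z)).2 rfl
    exact ⟨(P.forest.father true z, z), (P.isLeaf_iff _).2 (Or.inr ⟨rfl, h.leaf⟩),
      OrderEmbedding.ofStrictMono _ (h.strictMono false),
      OrderEmbedding.ofStrictMono _ (h.strictMono true), hmem,
      Or.inr ⟨hright, h.period_not_eq, h.range_not_eq, by
        have := h.period_eq
        omega, by
        have := h.range_eq
        rw [hP] at this
        exact this⟩⟩

/-- Every periodic forest in which the grandfather of a column is further to the right is, up to a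
renumbering of the rows, the forest of a polyomino. -/
theorem exists_forest_eq (F : PeriodicForest)
    (h : ∀ j, j < F.father true (F.father false j)) :
    ∃ (P : PPPStar) (a : Bool → ℤ), P.forest = F.translate a := by
  have hp := F.period_pos true
  have hw := F.period_pos false
  have hmul : ∀ q : ℤ, F.father true (q * F.period true) = F.father true 0 + q * F.period false :=
    fun q => by simpa using F.father_add_mul true 0 q
  obtain ⟨L, hL⟩ := exists_lowerAdjoint (F.mono true)
    (fun j => ⟨(|j| + |F.father true 0|) * F.period true, by
      rw [hmul]
      nlinarith [le_abs_self j, abs_nonneg j, abs_nonneg (F.father true 0),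
        neg_abs_le (F.father true 0)]⟩)
    (fun j => ⟨-(|j| + |F.father true 0| + 1) * F.period true, by
      rw [hmul]
      nlinarith [neg_abs_le j, abs_nonneg j, abs_nonneg (F.father true 0),
        le_abs_self (F.father true 0)]⟩)
  have hLmono : Monotone L := fun i j hij => (hL _ _).2 (hij.trans ((hL _ _).1 le_rfl))
  have hLadd : ∀ j, L (j + F.period false) = L j + F.period true := fun j =>
    eq_of_forall_ge_iff fun y => by
      have := F.father_add true (y - F.period true)
      rw [sub_add_cancel, Bool.not_true] at this
      have h1 := hL (j + F.period false) y
      have h2 := hL j (y - F.period true)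
      omega
  have hUadd : ∀ j, F.father false (j + F.period false) = F.father false j + F.period true :=
    F.father_add false
  have hLU : ∀ j, L (j + 1) ≤ F.father false j := fun j => (hL _ _).2 (h j)
  have hUm := F.mono false
  generalize hU : F.father false = U at hUadd hLU hUm
  have e3 : ((F.period false - 1 : ℕ) : ℤ) = F.period false - 1 := by omega
  have hU1 := hUadd (-1)
  rw [show -1 + (F.period false : ℤ) = F.period false - 1 by ring] at hU1
  have hL1 := hLadd (-1)
  rw [show -1 + (F.period false : ℤ) = F.period false - 1 by ring] at hL1
  have hL2 := hLadd 0
  rw [zero_add] at hL2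
  have hLU1 := hLU (-1)
  rw [neg_add_cancel] at hLU1
  let P : PPP :=
    { width := F.period false
      width_pos := hw
      low := fun i => L (i : ℕ) - L 0
      up := fun i => U (i : ℕ) + 1 - L 0
      low_mono := fun i j hij => sub_le_sub_right (hLmono (by exact_mod_cast hij)) _
      up_mono := fun i j hij => by
        have := hUm (show ((i : ℕ) : ℤ) ≤ (j : ℕ) by exact_mod_cast hij)
        dsimp only
        omega
      low_first := by simp
      low_lt_up := fun i j hij => by
        have h1 := hLU (i : ℕ)
        have h2 := hLmono (show ((j : ℕ) : ℤ) ≤ (i : ℕ) + 1 by omega)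
        omega
      mark := U (-1) + 1 - L 0
      one_le_mark := by omega
      mark_le_first := by
        have := hUm (show (-1 : ℤ) ≤ 0 by omega)
        simp [ParallelogramPolyomino.first]
        omega
      mark_le_last := by
        have := hLmono (show (F.period false : ℤ) - 1 ≤ F.period false by omega)
        simp only [ParallelogramPolyomino.last, e3]
        omega }
  have hheight : P.height = F.period true := by
    show U ((F.period false - 1 : ℕ) : ℤ) + 1 - L 0 - (U (-1) + 1 - L 0) = _
    rw [e3]
    omega
  have hmulL : ∀ j q : ℤ, L (j + q * F.period false) = L j + q * F.period true := fun j q => by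
    induction q using Int.induction_on with
    | zero => simp
    | succ q ih =>
      rw [show j + ((q : ℤ) + 1) * F.period false = j + q * F.period false + F.period false by ring,
        hLadd, ih]
      ring
    | pred q ih =>
      have := hLadd (j + (-(q : ℤ) - 1) * F.period false)
      rw [show j + (-(q : ℤ) - 1) * F.period false + F.period false =
        j + -q * F.period false by ring, ih] at this
      linarith
  have hmulU : ∀ j q : ℤ, U (j + q * F.period false) = U j + q * F.period true := fun j q => by
    rw [← hU]
    exact F.father_add_mul false j q
  have hlow : ∀ j, P.stripLow j = L j - L 0 := fun j => by
    obtain ⟨i, q, rfl⟩ := P.exists_index j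
    rw [P.stripLow_add_width, P.stripLow_coe, hheight]
    show L (i : ℕ) - L 0 + q * F.period true = L ((i : ℕ) + q * F.period false) - L 0
    rw [hmulL]
    ring
  have hup : ∀ j, P.stripUp j = U j + 1 - L 0 := fun j => by
    obtain ⟨i, q, rfl⟩ := P.exists_index j
    rw [P.stripUp_add_width, P.stripUp_coe, hheight]
    show U (i : ℕ) + 1 - L 0 + q * F.period true = U ((i : ℕ) + q * F.period false) + 1 - L 0
    rw [hmulU]
    ring
  have hdeg : ¬ P.IsDegenerate := by
    rw [PPP.isDegenerate_iff, hheight]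
    omega
  refine ⟨⟨P, hdeg⟩, fun b => bif b then L 0 else 0, ?_⟩
  ext b j
  · cases b
    · rfl
    · show P.height.toNat = _
      rw [hheight]
      rfl
  · cases b
    · show P.stripUp j - 1 = F.father false (j + 0) - L 0
      rw [hup, hU, add_zero]
      ring
    · show PPPStar.rowEnd ⟨P, hdeg⟩ j = F.father true (j + L 0) - 0
      refine eq_of_forall_le_iff fun i => ?_
      have h1 : P.stripLow i ≤ j ↔ _ := PPPStar.stripLow_le_iff ⟨P, hdeg⟩ i j
      rw [← h1, sub_zero, ← hL, hlow]
      omega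

end PPPStar

/-! ### The thickness -/

/-- The shift of the core by `k` in two generations, from columns to rows and back. -/
def rowShift (k : ℤ) (b : Bool) : ℤ := bif b then k else 0

namespace PPPStar

theorem exists_isCore_of_hasThickness {P : PPPStar} {k : ℕ} (h : HasThickness P k) :
    0 < k ∧ ∃ l x, P.forest.IsCore (rowShift k) l x := by
  obtain ⟨T, hPT, hT⟩ := h
  refine ⟨hT.1, ?_⟩
  induction hPT using Relation.ReflTransGen.head_induction_on with
  | refl =>
    have e := hT.strip_eq
    have h1 : ∀ j, T.forest.father false j = j + k := fun j => by
      show T.1.stripUp j - 1 = _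
      rw [(e j).2]
      ring
    have h2 : ∀ y, T.forest.father true y = y := fun y => by
      refine eq_of_forall_le_iff fun i => ?_
      show i ≤ T.rowEnd y ↔ _
      rw [← T.stripLow_le_iff, (e i).1]
    have h3 : T.forest.period true = T.forest.period false := by
      have h4 := T.forest.father_add false 0
      rw [h1, h1] at h4
      simp only [Bool.not_false] at h4
      omega
    refine ⟨T.forest.period false, fun b j => j + bif b then (k : ℤ) else 0,
      fun b i j hij => add_lt_add_left hij _, ?_, ?_,
      fun v => ⟨0, v.2 - bif v.1 then (k : ℤ) else 0, ?_⟩⟩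
    · rintro (_ | _) i
      · simp
      · simp only [cond_true, h3]
        ring
    · rintro (_ | _) i
      · simp [h1, rowShift]
      · simp [h2, rowShift]
    · simp
  | head hPQ _ ih =>
    obtain ⟨l, x, hx⟩ := ih
    obtain ⟨b, z, c, hc⟩ := exists_prunes_of_pruneStep hPQ
    exact ⟨l, _, hc.isCore hx⟩

theorem exists_hasThickness (P : PPPStar) : ∃ k, HasThickness P k := by
  obtain ⟨N, hN⟩ : ∃ N, P.forest.period false + P.forest.period true = N := ⟨_, rfl⟩
  induction N using Nat.strong_induction_on generalizing P with
  | _ N ih =>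
    by_cases hleaf : ∃ b z, ∀ j, P.forest.father (!b) j ≠ z
    · obtain ⟨b, z, hz⟩ := hleaf
      obtain ⟨G, c, hG⟩ := PeriodicForest.exists_prunes hz
      have hlt : ∀ j, j < G.father true (G.father false j) := fun j => by
        have h1 := hG.map_father false j
        have h2 := hG.map_father true (G.father false j)
        simp only [Bool.not_false, Bool.not_true] at h1 h2
        rw [← (hG.strictMono false).lt_iff_lt, ← h2, ← h1]
        exact P.lt_grandfather _
      obtain ⟨Q, a, hQ⟩ := exists_forest_eq G hlt
      have hPQ := hG.translate a
      rw [← hQ] at hPQ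
      obtain ⟨k, T, hQT, hT⟩ := ih _ (by
        have h1 := hPQ.period_eq
        have h2 := hPQ.period_not_eq
        rw [← hN]
        cases b <;> simp only [Bool.not_false, Bool.not_true] at h1 h2 <;> omega) Q rfl
      exact ⟨k, T, Relation.ReflTransGen.head (pruneStep_of_prunes hPQ) hQT, hT⟩
    · push Not at hleaf
      have hsurj : ∀ b, Function.Surjective (P.forest.father b) := fun b z => by
        simpa using hleaf (!b) z
      obtain ⟨-, heq⟩ := PeriodicForest.father_eq_of_surjective hsurj
      have h0 : P.forest.father true 0 = 0 := by
        have h1 := (P.stripLow_le_iff 0 0).1 P.1.stripLow_zero.le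
        have h2 := (P.stripLow_le_iff 0 (-1)).not.1 (by rw [P.1.stripLow_zero]; omega)
        have h3 : P.rowEnd (-1) = _ := heq true (-1)
        change 0 ≤ P.forest.father true 0 at h1
        omega
      have hlow : ∀ j, P.1.stripLow j = j := fun j => eq_of_forall_ge_iff fun y => by
        rw [P.stripLow_le_iff]
        show j ≤ P.forest.father true y ↔ _
        rw [heq, h0, add_zero]
      have hpos := P.lt_grandfather 0
      rw [heq true, h0, add_zero] at hpos
      obtain ⟨k, hk⟩ := Int.eq_ofNat_of_zero_le hpos.le
      refine ⟨k, P, Relation.ReflTransGen.refl, by omega, fun s hs => ?_, fun i => ⟨?_, ?_⟩⟩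
      · rw [isLeaf_iff] at hs
        rcases hs with hs | hs
        · obtain ⟨y, hy⟩ := hsurj true s.1
          exact hs.2 y hy
        · obtain ⟨j, hj⟩ := hsurj false s.2
          exact hs.2 j hj
      · rw [← P.1.stripLow_coe, hlow]
      · rw [← P.1.stripUp_coe]
        have h1 : P.1.stripUp (i : ℕ) - 1 = _ := heq false (i : ℕ)
        rw [hk] at h1
        have : (Int.ofNat k) = (k : ℤ) := rfl
        omega

theorem hasThickness_unique {P : PPPStar} {k k' : ℕ} (h : HasThickness P k)
    (h' : HasThickness P k') : k = k' := by
  obtain ⟨-, l, x, hx⟩ := exists_isCore_of_hasThickness h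
  obtain ⟨-, l', x', hx'⟩ := exists_isCore_of_hasThickness h'
  have := congrFun (hx.unique hx' rfl).1 true
  simpa [rowShift] using this

theorem existsUnique_hasThickness (P : PPPStar) : ∃! k, HasThickness P k := by
  obtain ⟨k, hk⟩ := P.exists_hasThickness
  exact ⟨k, hk, fun k' hk' => hasThickness_unique hk' hk⟩

theorem hasThickness_thickness (P : PPPStar) : HasThickness P P.thickness :=
  Nat.sInf_mem P.exists_hasThickness

theorem thickness_eq_iff (P : PPPStar) (k : ℕ) : P.thickness = k ↔ HasThickness P k :=
  ⟨fun h => h ▸ P.hasThickness_thickness, fun h => hasThickness_unique P.hasThickness_thickness h⟩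

/-- The thickness is the shift of the core, as the core is not changed by pruning and the core of
the final trunk is the whole trunk. -/
theorem hasThickness_iff (P : PPPStar) (k : ℕ) :
    HasThickness P k ↔ ∃ l x, P.forest.IsCore (rowShift k) l x := by
  refine ⟨fun h => (exists_isCore_of_hasThickness h).2, fun ⟨l, x, hx⟩ => ?_⟩
  obtain ⟨k', hk'⟩ := P.exists_hasThickness
  obtain ⟨-, l', x', hx'⟩ := exists_isCore_of_hasThickness hk'
  have := congrFun (hx.unique hx' rfl).1 true
  have hkk : k = k' := by simpa [rowShift] using this
  exact hkk ▸ hk'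

end PPPStar

/-! ### Strips as orbits of marked forests -/

namespace MarkedForest

variable {k : Bool → ℤ}

/-- The same forest with the mark moved by `i` core vertices. -/
def move (S : MarkedForest k) (i : ℤ) : MarkedForest k where
  forest := S.forest.translate fun b => S.core b i
  coreLen := S.coreLen
  core b m := S.core b (i + m) - S.core b i
  isCore :=
    { strictMono := fun b m m' h => sub_lt_sub_right (S.isCore.strictMono b (by omega)) _
      add_period := fun b m => by
        rw [← add_assoc, S.isCore.add_period]
        simp only [PeriodicForest.translate]
        ring
      father_core := fun b m => by
        rw [(S.isCore.translate _).father_core b (i + m), add_assoc]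
      reach := fun v => by
        obtain ⟨m, i', h⟩ := (S.isCore.translate fun b => S.core b i).reach v
        exact ⟨m, i' - i, by rw [h, add_sub_cancel]⟩ }
  core_zero b := by simp

theorem move_move (S : MarkedForest k) (i i' : ℤ) : (S.move i).move i' = S.move (i + i') := by
  apply eq_of_forest_eq
  simp [move, PeriodicForest.translate_translate]

theorem move_zero (S : MarkedForest k) : S.move 0 = S := by
  apply eq_of_forest_eq
  ext b j
  · rfl
  · simp [move, PeriodicForest.translate, S.core_zero]

theorem core_coreLen (S : MarkedForest k) (b : Bool) : S.core b S.coreLen = S.forest.period b := by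
  have := S.isCore.add_period b 0
  rwa [S.core_zero, zero_add, zero_add] at this

theorem move_coreLen (S : MarkedForest k) : S.move S.coreLen = S := by
  apply eq_of_forest_eq
  ext b j
  · rfl
  · simp [move, PeriodicForest.translate, S.core_coreLen, S.forest.father_add]

/-- Moving the mark to the next core vertex. -/
def moveEquiv (k : Bool → ℤ) (l n : ℕ) : Equiv.Perm (OfSize k l n) where
  toFun S := ⟨S.1.move 1, S.2⟩
  invFun S := ⟨S.1.move (-1), S.2⟩
  left_inv S := Subtype.ext (by simp [move_move, move_zero])
  right_inv S := Subtype.ext (by simp [move_move, move_zero])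

theorem moveEquiv_zpow {l n : ℕ} (s : ℤ) (S : OfSize k l n) :
    ((moveEquiv k l n ^ s) S).1 = S.1.move s := by
  induction s using Int.induction_on generalizing S with
  | zero => simp [move_zero]
  | succ s ih =>
    rw [zpow_add, zpow_one, Equiv.Perm.mul_apply, ih]
    show (S.1.move 1).move s = _
    rw [move_move, add_comm]
  | pred s ih =>
    rw [sub_eq_add_neg, zpow_add, zpow_neg_one, Equiv.Perm.mul_apply, ih]
    show (S.1.move (-1)).move _ = _
    rw [move_move, add_comm]

theorem moveEquiv_pow {l n : ℕ} (s : ℕ) (S : OfSize k l n) :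
    ((moveEquiv k l n ^ s) S).1 = S.1.move s := by
  rw [← zpow_natCast, moveEquiv_zpow]

theorem moveEquiv_pow_coreLen (l n : ℕ) : moveEquiv k l n ^ l = 1 := by
  ext1 S
  apply Subtype.ext
  have := S.1.move_coreLen
  rw [S.2.1] at this
  rw [moveEquiv_pow, this]
  rfl

/-- The forest `S` regarded as having an `i`-fold period. -/
def dilate (S : MarkedForest k) (i : ℕ) (hi : 0 < i) : MarkedForest k where
  forest :=
    { period := fun b => i * S.forest.period b
      father := S.forest.father
      period_pos := fun b => Nat.mul_pos hi (S.forest.period_pos b)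
      mono := S.forest.mono
      father_add := fun b j => by
        push_cast
        exact S.forest.father_add_mul b j i }
  coreLen := i * S.coreLen
  core := S.core
  isCore :=
    { strictMono := S.isCore.strictMono
      add_period := fun b m => by
        push_cast
        clear hi
        induction i with
        | zero => simp
        | succ i ih =>
          have := S.isCore.add_period b (m + i * S.coreLen)
          push_cast
          rw [add_mul, one_mul, ← add_assoc, this, ih]
          ring
      father_core := S.isCore.father_core
      reach := S.isCore.reach }
  core_zero := S.core_zero

theorem dilate_injective {i : ℕ} (hi : 0 < i) {S S' : MarkedForest k}
    (h : S.dilate i hi = S'.dilate i hi) : S = S' := by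
  apply eq_of_forest_eq
  have h1 := congrArg (fun T => T.forest.period) h
  have h2 := congrArg (fun T => T.forest.father) h
  ext b j
  · exact Nat.eq_of_mul_eq_mul_left hi (congrFun h1 b)
  · exact congrFun (congrFun h2 b) j

theorem dilate_move (S : MarkedForest k) {i : ℕ} (hi : 0 < i) :
    (S.dilate i hi).move S.coreLen = S.dilate i hi := by
  apply eq_of_forest_eq
  have h := congrArg MarkedForest.forest S.move_coreLen
  ext b j
  · rfl
  · exact congrFun (congrFun (congrArg PeriodicForest.father h) b) j

/-- A marked forest that is invariant under moving the mark by a divisor of the length of the core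
has a smaller period. -/
theorem exists_dilate_eq (S : MarkedForest k) {i g : ℕ} (hi : 0 < i) (hg : 0 < g)
    (hl : S.coreLen = i * g) (h : S.move g = S) :
    ∃ S' : MarkedForest k, S'.dilate i hi = S ∧ S'.coreLen = g := by
  have hcore : ∀ b m, S.core b (m + g) = S.core b m + S.core b g := fun b m => by
    have := congrFun (congrFun (congrArg MarkedForest.core h) b) m
    simp only [move] at this
    rw [add_comm m]
    linarith
  have hpos : ∀ b, 0 < S.core b g := fun b => by
    have := S.isCore.strictMono b (show (0 : ℤ) < g by omega)
    rwa [S.core_zero] at this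
  have hmul : ∀ b (q : ℕ), S.core b ((q * g : ℕ) : ℤ) = q * S.core b g := fun b q => by
    induction q with
    | zero => simp [S.core_zero]
    | succ q ih =>
      push_cast at ih ⊢
      rw [add_mul, one_mul, hcore, ih]
      ring
  have hnat : ∀ b, ((S.core b g).toNat : ℤ) = S.core b g := fun b =>
    Int.toNat_of_nonneg (hpos b).le
  refine ⟨
    { forest :=
        { period := fun b => (S.core b g).toNat
          father := S.forest.father
          period_pos := fun b => by
            have := hpos b
            omega
          mono := S.forest.mono
          father_add := fun b j => by
            have := congrFun (congrFun (congrArg (fun T => T.forest.father) h) b) j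
            simp only [move, PeriodicForest.translate] at this
            rw [hnat, hnat]
            linarith }
      coreLen := g
      core := S.core
      isCore := ⟨S.isCore.strictMono, fun b m => by rw [hnat, hcore], S.isCore.father_core,
        S.isCore.reach⟩
      core_zero := S.core_zero }, ?_, rfl⟩
  apply eq_of_forest_eq
  ext b j
  · have h1 := S.core_coreLen b
    rw [hl, hmul, ← hnat] at h1
    exact_mod_cast h1
  · rfl

/-- The marked forests that are fixed by moving the mark by `s` core vertices are fixed by moving it
by `gcd (l, s)` core vertices, so that they have a smaller period. -/
theorem card_move_fixed (l n s : ℕ) (hl : 0 < l) :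
    Nat.card {S : OfSize k l n // (moveEquiv k l n ^ s) S = S} =
      if l / l.gcd s ∣ n then Nat.card (OfSize k (l.gcd s) (n / (l / l.gcd s))) else 0 := by
  have hg : 0 < l.gcd s := Nat.gcd_pos_of_pos_left _ hl
  obtain ⟨i, hi⟩ := Nat.gcd_dvd_left l s
  have hi0 : 0 < i := Nat.pos_of_ne_zero (by rintro rfl; omega)
  have hdiv : l / l.gcd s = i := Nat.div_eq_of_eq_mul_right hg hi
  have hfix : ∀ S : OfSize k l n, (moveEquiv k l n ^ s) S = S → S.1.move (l.gcd s) = S.1 := by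
    intro S hS
    have h1 : Function.IsPeriodicPt (moveEquiv k l n) s S := by
      rw [Function.IsPeriodicPt, Equiv.Perm.iterate_eq_pow]
      exact hS
    have h2 : Function.IsPeriodicPt (moveEquiv k l n) l S := by
      rw [Function.IsPeriodicPt, Equiv.Perm.iterate_eq_pow, moveEquiv_pow_coreLen]
      rfl
    have h3 := h2.gcd h1
    rw [Function.IsPeriodicPt, Equiv.Perm.iterate_eq_pow] at h3
    rw [← moveEquiv_pow, h3]
  have hex : ∀ S : OfSize k l n, (moveEquiv k l n ^ s) S = S → ∃ S' : MarkedForest k,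
      S'.dilate i hi0 = S.1 ∧ S'.coreLen = l.gcd s := fun S hS =>
    S.1.exists_dilate_eq hi0 hg (by rw [S.2.1, mul_comm]; exact hi) (hfix S hS)
  rw [hdiv]
  split_ifs with hin
  · obtain ⟨m, rfl⟩ := hin
    rw [Nat.mul_div_cancel_left _ hi0]
    symm
    refine Nat.card_congr (Equiv.ofBijective (fun S => ⟨⟨S.1.dilate i hi0, ?_, ?_⟩, ?_⟩)
      ⟨fun S S' h => ?_, ?_⟩)
    · show i * S.1.coreLen = l
      rw [S.2.1, mul_comm]
      exact hi.symm
    · show i * S.1.forest.period false + i * S.1.forest.period true = i * m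
      rw [← mul_add]
      exact congrArg (i * ·) S.2.2
    · apply Subtype.ext
      obtain ⟨q, hq⟩ := Nat.gcd_dvd_right l s
      have hfix' : ∀ q : ℕ, (S.1.dilate i hi0).move ((l.gcd s * q : ℕ) : ℤ) = S.1.dilate i hi0 := by
        intro q
        induction q with
        | zero => simp [move_zero]
        | succ q ih =>
          have h1 := S.1.dilate_move hi0
          rw [S.2.1] at h1
          rw [mul_add, mul_one, Nat.cast_add, ← move_move, ih, h1]
      refine (moveEquiv_pow s _).trans ?_
      have := hfix' q
      rwa [← hq] at this
    · have := congrArg (fun T => T.1.1) h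
      exact Subtype.ext (dilate_injective hi0 this)
    · rintro ⟨S, hS⟩
      obtain ⟨S', h1, h2⟩ := hex S hS
      refine ⟨⟨S', h2, ?_⟩, Subtype.ext (Subtype.ext h1)⟩
      have h3 : i * S'.forest.period false + i * S'.forest.period true = i * m := by
        have := S.2.2
        rwa [← h1] at this
      rw [← mul_add] at h3
      exact Nat.eq_of_mul_eq_mul_left hi0 h3
  · have : IsEmpty {S : OfSize k l n // (moveEquiv k l n ^ s) S = S} := ⟨fun S => by
      obtain ⟨S', h1, -⟩ := hex S.1 S.2
      have h3 : i * S'.forest.period false + i * S'.forest.period true = n := by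
        have := S.1.2.2
        rwa [← h1] at this
      exact hin ⟨_, by rw [← h3, mul_add]⟩⟩
    exact Nat.card_of_isEmpty

theorem add_le_core (S : MarkedForest k) (b : Bool) {i j : ℤ} (hij : i ≤ j) :
    S.core b i - i ≤ S.core b j - j :=
  monotone_int_of_le_succ (f := fun i => S.core b i - i) (fun i => by
    have := S.isCore.strictMono b (show i < i + 1 by omega)
    omega) hij

theorem coreLen_le_period (S : MarkedForest k) : S.coreLen ≤ S.forest.period false := by
  have h1 := S.add_le_core false (show (0 : ℤ) ≤ S.coreLen by omega)
  rw [S.core_coreLen, S.core_zero] at h1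
  omega

/-- In a forest whose core is shifted by `k > 0`, every column precedes its grandfather: it lies
between two consecutive core columns, and the grandfather of the first of these is not before the
second one. -/
theorem lt_grandfather {k : ℤ} (hk : 0 < k) (S : MarkedForest (rowShift k)) (j : ℤ) :
    j < S.forest.father true (S.forest.father false j) := by
  have h0 := S.core_zero false
  obtain ⟨L, hL⟩ := exists_lowerAdjoint (S.isCore.strictMono false).monotone
    (fun j => ⟨|j|, by
      have := S.add_le_core false (abs_nonneg j)
      have := le_abs_self j
      omega⟩)
    (fun j => ⟨-|j| - 1, by
      have := S.add_le_core false (show -|j| - 1 ≤ 0 by have := abs_nonneg j; omega)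
      have := neg_abs_le j
      omega⟩)
  -- the core vertices with the indices `L (j + 1) - 1` and `L (j + 1)` enclose `j`
  have h1 := (hL (j + 1) _).1 le_rfl
  have h2 := (hL (j + 1) (L (j + 1) - 1)).not.1 (by omega)
  have h3 := S.forest.mono true (S.forest.mono false
    (show S.core false (L (j + 1) - 1) ≤ j by omega))
  have e : ∀ i, S.forest.father true (S.forest.father false (S.core false i)) =
      S.core false (i + k) := fun i => by
    have h := S.isCore.father_core false i
    have h' := S.isCore.father_core true (i + rowShift k false)
    simp only [Bool.not_false, Bool.not_true, rowShift, cond_false, cond_true, add_zero] at h h'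
    rw [h, h']
  rw [e] at h3
  have h4 := (S.isCore.strictMono false).monotone
    (show L (j + 1) ≤ L (j + 1) - 1 + k by omega)
  omega

end MarkedForest

namespace PeriodicForest

theorem eq_translate_of_eq_translate {F G H : PeriodicForest} {a a' : Bool → ℤ}
    (h : G = F.translate a) (h' : H = F.translate a') : H = G.translate fun b => a' b - a b := by
  rw [h, h', translate_translate]
  simp

theorem translate_zero (F : PeriodicForest) : F.translate (fun _ => 0) = F := by
  ext b j
  · rfl
  · simp [translate]

end PeriodicForest

namespace PPPStar

theorem columnRotation_zpow (P : PPPStar) (s : ℤ) : ((columnRotation ^ s) P).1 = P.1.shift s := by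
  induction s using Int.induction_on generalizing P with
  | zero => simp [PPP.shift_zero]
  | succ s ih =>
    rw [zpow_add, zpow_one, Equiv.Perm.mul_apply, ih]
    show (P.1.shift 1).shift s = _
    rw [PPP.shift_shift, add_comm]
  | pred s ih =>
    rw [sub_eq_add_neg, zpow_add, zpow_neg_one, Equiv.Perm.mul_apply, ih]
    show (P.1.shift (-1)).shift _ = _
    rw [PPP.shift_shift, add_comm]

theorem forest_zpow (P : PPPStar) (s : ℤ) : ∃ a, ((columnRotation ^ s) P).forest =
    P.forest.translate a := by
  have h := P.columnRotation_zpow s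
  refine ⟨fun b => bif b then P.1.stripLow s else s, ?_⟩
  ext b j
  · cases b
    · show (((columnRotation ^ s) P).1).width = P.1.width
      rw [h]
      rfl
    · show (PPP.height _).toNat = P.1.height.toNat
      rw [h, PPP.shift_height]
  · cases b
    · show PPP.stripUp _ j - 1 = P.1.stripUp (j + s) - 1 - P.1.stripLow s
      rw [h, PPP.shift_stripUp, add_comm s]
      ring
    · show rowEnd _ j = P.rowEnd (j + P.1.stripLow s) - s
      refine eq_of_forall_le_iff fun i => ?_
      have h1 := P.stripLow_le_iff (s + i) (j + P.1.stripLow s)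
      rw [← stripLow_le_iff, h, PPP.shift_stripLow]
      omega

/-- Two polyominoes lie on the same strip if and only if their forests differ by a renumbering of
the columns and of the rows. -/
theorem orbitRel_iff (P Q : PPPStar) :
    MulAction.orbitRel (Subgroup.zpowers columnRotation) PPPStar P Q ↔
      ∃ a, P.forest = Q.forest.translate a := by
  constructor
  · rintro ⟨⟨g, hg⟩, rfl⟩
    obtain ⟨s, rfl⟩ := Subgroup.mem_zpowers_iff.1 hg
    exact Q.forest_zpow s
  · rintro ⟨a, ha⟩
    refine ⟨⟨columnRotation ^ a false, a false, rfl⟩, ?_⟩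
    show (columnRotation ^ a false) Q = P
    refine Subtype.ext ?_
    rw [columnRotation_zpow]
    have hlow : ∀ j, P.1.stripLow j = Q.1.stripLow (a false + j) - a true := fun j => by
      refine eq_of_forall_ge_iff fun y => ?_
      have h1 : P.rowEnd y = Q.rowEnd (y + a true) - a false :=
        congrFun (congrFun (congrArg PeriodicForest.father ha) true) y
      have h2 := Q.stripLow_le_iff (a false + j) (y + a true)
      rw [stripLow_le_iff, h1]
      omega
    have h0 := hlow 0
    rw [P.1.stripLow_zero, add_zero] at h0
    refine PPP.ext_strip ?_ ?_ ?_
    · exact (congrFun (congrArg PeriodicForest.period ha) false).symm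
    · ext j
      rw [PPP.shift_stripLow, hlow]
      omega
    · ext j
      have h1 : P.1.stripUp j - 1 = Q.1.stripUp (j + a false) - 1 - a true :=
        congrFun (congrFun (congrArg PeriodicForest.father ha) false) j
      rw [PPP.shift_stripUp, add_comm (a false)]
      omega

end PPPStar

namespace MarkedForest

open PPPStar

/-- The polyomino whose forest is, up to a renumbering, a given marked forest. -/
noncomputable def polyomino {k : ℤ} (hk : 0 < k) (S : MarkedForest (rowShift k)) : PPPStar :=
  (exists_forest_eq S.forest (S.lt_grandfather hk)).choose

theorem polyomino_forest {k : ℤ} (hk : 0 < k) (S : MarkedForest (rowShift k)) :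
    ∃ a, (S.polyomino hk).forest = S.forest.translate a :=
  (exists_forest_eq S.forest (S.lt_grandfather hk)).choose_spec

theorem polyomino_thickness {k : ℕ} (hk : (0 : ℤ) < k) (S : MarkedForest (rowShift k)) :
    (S.polyomino hk).thickness = k := by
  obtain ⟨a, ha⟩ := S.polyomino_forest hk
  rw [thickness_eq_iff, hasThickness_iff, ha]
  exact ⟨_, _, S.isCore.translate a⟩

theorem polyomino_semiPerimeter {k : ℕ} (hk : (0 : ℤ) < k) (S : MarkedForest (rowShift k)) :
    (S.polyomino hk).1.semiPerimeter = S.forest.period false + S.forest.period true := by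
  obtain ⟨a, ha⟩ := S.polyomino_forest hk
  have h1 := congrArg PeriodicForest.period ha
  exact congrArg₂ (· + ·) (congrFun h1 false) (congrFun h1 true)

theorem polyomino_orbitRel_iff {k : ℤ} (hk : 0 < k) (S S' : MarkedForest (rowShift k)) :
    MulAction.orbitRel (Subgroup.zpowers columnRotation) PPPStar (S'.polyomino hk)
      (S.polyomino hk) ↔ ∃ d, S' = S.move d := by
  obtain ⟨a, ha⟩ := S.polyomino_forest hk
  obtain ⟨a', ha'⟩ := S'.polyomino_forest hk
  rw [orbitRel_iff]
  constructor
  · rintro ⟨e, he⟩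
    rw [ha, PeriodicForest.translate_translate] at he
    have h1 : S'.forest = S.forest.translate fun b => a b + e b + (0 - a' b) :=
      (PeriodicForest.translate_zero _).symm.trans <| by
        have := PeriodicForest.eq_translate_of_eq_translate ha'
          (PeriodicForest.translate_zero S'.forest).symm
        rw [he, PeriodicForest.translate_translate] at this
        rw [PeriodicForest.translate_zero]
        exact this
    have h2 := S.isCore.translate fun b => a b + e b + (0 - a' b)
    rw [← h1] at h2
    obtain ⟨-, -, d, hd⟩ := h2.unique S'.isCore rfl
    refine ⟨d, eq_of_forest_eq ?_⟩
    show S'.forest = S.forest.translate fun b => S.core b d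
    rw [h1]
    congr 1
    ext b
    have := hd b 0
    rw [S'.core_zero, zero_add] at this
    linarith
  · rintro ⟨d, rfl⟩
    exact ⟨_, PeriodicForest.eq_translate_of_eq_translate ha
      (ha'.trans (PeriodicForest.translate_translate _ _ _))⟩

/-- A strip of positive thickness `k` is an orbit of marked forests under moving the mark. -/
theorem nonempty_orbits_equiv {k : ℕ} (hk : 0 < k) (n : ℕ) :
    Nonempty ((Σ l : Fin (n + 1), MulAction.orbitRel.Quotient
        (Subgroup.zpowers (moveEquiv (rowShift k) l n)) (OfSize (rowShift k) l n)) ≃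
      {b : Strip // b.thickness = k ∧ b.semiPerimeter = n}) := by
  have hk' : (0 : ℤ) < k := by omega
  have hrel : ∀ (l : Fin (n + 1)) (S S' : OfSize (rowShift k) l n),
      MulAction.orbitRel (Subgroup.zpowers (moveEquiv (rowShift k) l n)) _ S' S ↔
        ∃ d, S'.1 = S.1.move d := by
    intro l S S'
    constructor
    · rintro ⟨⟨g, hg⟩, rfl⟩
      obtain ⟨s, rfl⟩ := Subgroup.mem_zpowers_iff.1 hg
      exact ⟨s, moveEquiv_zpow s S⟩
    · rintro ⟨d, hd⟩
      exact ⟨⟨moveEquiv (rowShift k) l n ^ d, d, rfl⟩,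
        Subtype.ext ((moveEquiv_zpow d S).trans hd.symm)⟩
  refine ⟨Equiv.ofBijective (fun q => Quotient.lift (s := MulAction.orbitRel _ _)
    (fun S : OfSize (rowShift k) q.1 n =>
      (⟨Quotient.mk (MulAction.orbitRel _ _) (S.1.polyomino hk'), S.1.polyomino_thickness hk',
        (S.1.polyomino_semiPerimeter hk').trans S.2.2⟩ :
          {b : Strip // b.thickness = k ∧ b.semiPerimeter = n})) ?_ q.2) ⟨?_, ?_⟩⟩
  · intro S S' h
    refine Subtype.ext (Quotient.sound ?_)
    exact (polyomino_orbitRel_iff hk' S'.1 S.1).2 ((hrel q.1 S' S).1 h)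
  · rintro ⟨l, q⟩ ⟨l', q'⟩ h
    induction q using Quotient.inductionOn with | _ S =>
    induction q' using Quotient.inductionOn with | _ S' =>
    have h1 := Quotient.exact (congrArg Subtype.val h)
    obtain ⟨d, hd⟩ := (polyomino_orbitRel_iff hk' S'.1 S.1).1 h1
    have hl : l = l' := by
      apply Fin.ext
      rw [← S.2.1, ← S'.2.1, hd]
      rfl
    subst hl
    exact congrArg (Sigma.mk l) (Quotient.sound ((hrel l S' S).2 ⟨d, hd⟩))
  · rintro ⟨b, hb⟩
    induction b using Quotient.inductionOn with | _ P =>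
    obtain ⟨hbk, hbn⟩ := hb
    change P.thickness = k at hbk
    change P.1.semiPerimeter = n at hbn
    rw [thickness_eq_iff, hasThickness_iff] at hbk
    obtain ⟨l, x, hx⟩ := hbk
    let S : MarkedForest (rowShift k) := ⟨P.forest.translate fun b => x b 0, l, _,
      hx.translate _, fun b => sub_self _⟩
    have hl : l < n + 1 := by
      have h1 := S.coreLen_le_period
      have h2 : P.forest.period false + P.forest.period true = n := hbn
      change l ≤ P.forest.period false at h1
      omega
    refine ⟨⟨⟨l, hl⟩, Quotient.mk (MulAction.orbitRel _ _) ⟨S, rfl, hbn⟩⟩, Subtype.ext ?_⟩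
    refine Quotient.sound ((orbitRel_iff _ _).2 ?_)
    obtain ⟨a, ha⟩ := S.polyomino_forest hk'
    exact ⟨_, ha.trans (PeriodicForest.translate_translate _ _ _)⟩

end MarkedForest

/-! ### Counting orbits -/

/-- The orbit counting lemma for the powers of a permutation of order dividing `l`. -/
theorem card_orbits_mul_eq_sum {X : Type*} [Finite X] (ρ : Equiv.Perm X) {l : ℕ} (hl : 0 < l)
    (h : ρ ^ l = 1) :
    Nat.card (MulAction.orbitRel.Quotient (Subgroup.zpowers ρ) X) * l =
      ∑ s ∈ Finset.range l, Nat.card {x // (ρ ^ s) x = x} := by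
  classical
  have : Fintype X := Fintype.ofFinite X
  have : Fintype (Subgroup.zpowers ρ) := Fintype.ofFinite _
  have : Fintype (MulAction.orbitRel.Quotient (Subgroup.zpowers ρ) X) := Fintype.ofFinite _
  have h1 := MulAction.sum_card_fixedBy_eq_card_orbits_mul_card_group (Subgroup.zpowers ρ) X
  have hfin : IsOfFinOrder ρ := isOfFinOrder_iff_pow_eq_one.2 ⟨l, hl, h⟩
  have h2 : ∑ g : Subgroup.zpowers ρ, Fintype.card (MulAction.fixedBy X g) =
      ∑ s ∈ Finset.range (orderOf ρ), Nat.card {x // (ρ ^ s) x = x} := by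
    rw [← Fin.sum_univ_eq_sum_range (fun s => Nat.card {x // (ρ ^ s) x = x})]
    refine (Fintype.sum_equiv (finEquivZPowers hfin) _ _ fun s => ?_).symm
    rw [← Nat.card_eq_fintype_card]
    rfl
  have h3 : ∀ m, ∑ s ∈ Finset.range (orderOf ρ * m), Nat.card {x // (ρ ^ s) x = x} =
      (∑ s ∈ Finset.range (orderOf ρ), Nat.card {x // (ρ ^ s) x = x}) * m := by
    intro m
    induction m with
    | zero => simp
    | succ m ih =>
      rw [mul_add, mul_one, Finset.sum_range_add, ih, mul_add, mul_one]
      congr 1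
      refine Finset.sum_congr rfl fun s _ => ?_
      rw [pow_add, pow_mul, pow_orderOf_eq_one, one_pow, one_mul]
  obtain ⟨m, rfl⟩ := orderOf_dvd_of_pow_eq_one h
  rw [h3, ← h2, h1, ← Nat.card_eq_fintype_card, ← Nat.card_eq_fintype_card, Nat.card_zpowers]
  ring

/-- The `n`-th coefficient of `φ(i) / (i m) * G(z ^ i) ^ m`. -/
noncomputable def cycleCoeff (n i m : ℕ) : ℚ :=
  (i.totient : ℚ) / (i * m) * if i ∣ n then PowerSeries.coeff (n / i) (tupleSeries ^ m) else 0

theorem coeff_tupleSeries_pow_eq_zero {n m : ℕ} (h : n < m) :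
    PowerSeries.coeff n (tupleSeries ^ m) = 0 :=
  PowerSeries.X_pow_dvd_iff.1
    (pow_dvd_pow_of_dvd (PowerSeries.X_dvd_iff.2 constantCoeff_tupleSeries) m) n h

theorem cycleCoeff_eq_zero {n i m : ℕ} (h : n < i * m) : cycleCoeff n i m = 0 := by
  unfold cycleCoeff
  split_ifs with hin
  · rw [coeff_tupleSeries_pow_eq_zero, mul_zero]
    exact Nat.div_lt_of_lt_mul h
  · rw [mul_zero]

theorem card_orbits_moveEquiv (k : Bool → ℤ) (l n : ℕ) :
    (Nat.card (MulAction.orbitRel.Quotient (Subgroup.zpowers (MarkedForest.moveEquiv k l n))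
      (MarkedForest.OfSize k l n)) : ℚ) = ∑ p ∈ l.divisorsAntidiagonal, cycleCoeff n p.1 p.2 := by
  rcases Nat.eq_zero_or_pos l with rfl | hl
  · have : IsEmpty (MulAction.orbitRel.Quotient (Subgroup.zpowers (MarkedForest.moveEquiv k 0 n))
        (MarkedForest.OfSize k 0 n)) :=
      ⟨fun q => Quotient.inductionOn q fun S => S.1.isCore.l_pos.ne' S.2.1⟩
    simp
  have := MarkedForest.finite_ofSize k l n
  have hl' : (l : ℚ) ≠ 0 := by positivity
  have h := congrArg (Nat.cast (R := ℚ)) (card_orbits_mul_eq_sum (MarkedForest.moveEquiv k l n) hl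
    (MarkedForest.moveEquiv_pow_coreLen l n))
  rw [Nat.cast_mul, Nat.cast_sum] at h
  rw [← mul_left_inj' hl', h]
  -- the term of the power `s` depends only on `gcd (l, s)`
  have h1 : ∀ s, (Nat.card {S : MarkedForest.OfSize k l n //
      (MarkedForest.moveEquiv k l n ^ s) S = S} : ℚ) =
      (fun d => if l / d ∣ n then PowerSeries.coeff (n / (l / d)) (tupleSeries ^ d) else 0)
        (l.gcd s) := fun s => by
    rw [MarkedForest.card_move_fixed l n s hl]
    beta_reduce
    split_ifs
    · exact MarkedForest.card_ofSize k (Nat.gcd_pos_of_pos_left _ hl) _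
    · exact Nat.cast_zero
  rw [Finset.sum_congr rfl fun s _ => h1 s, ← Finset.sum_fiberwise_of_maps_to (t := l.divisors)
      (g := fun s => l.gcd s) fun s _ => Nat.mem_divisors.2 ⟨Nat.gcd_dvd_left _ _, hl.ne'⟩,
    Nat.sum_divisorsAntidiagonal' (f := fun i m => cycleCoeff n i m), Finset.sum_mul]
  refine Finset.sum_congr rfl fun d hd => ?_
  have hd := (Nat.mem_divisors.1 hd).1
  have hprod : ((l / d : ℕ) : ℚ) * d = l := by
    rw [← Nat.cast_mul, Nat.div_mul_cancel hd]
  rw [Finset.sum_congr rfl fun s hs => by rw [(Finset.mem_filter.1 hs).2], Finset.sum_const,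
    ← Nat.totient_div_of_dvd hd, nsmul_eq_mul, cycleCoeff, hprod]
  field_simp

/-- The sum over all pairs may be taken over a square, as the terms with `i m > n` vanish. -/
theorem sum_divisorsAntidiagonal_cycleCoeff (n : ℕ) :
    ∑ l ∈ Finset.Icc 1 n, ∑ p ∈ l.divisorsAntidiagonal, cycleCoeff n p.1 p.2 =
      ∑ i ∈ Finset.Icc 1 n, ∑ m ∈ Finset.Icc 1 n, cycleCoeff n i m := by
  rw [← Finset.sum_product' (Finset.Icc 1 n) (Finset.Icc 1 n) (cycleCoeff n)]
  have hsub : ∑ p ∈ (Finset.Icc 1 n ×ˢ Finset.Icc 1 n).filter (fun p => p.1 * p.2 ≤ n),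
      cycleCoeff n p.1 p.2 = ∑ p ∈ Finset.Icc 1 n ×ˢ Finset.Icc 1 n, cycleCoeff n p.1 p.2 := by
    refine Finset.sum_subset (Finset.filter_subset _ _) fun p hp hp' => cycleCoeff_eq_zero ?_
    by_contra hle
    exact hp' (Finset.mem_filter.2 ⟨hp, by omega⟩)
  rw [← hsub, ← Finset.sum_fiberwise_of_maps_to (t := Finset.Icc 1 n)
    (g := fun p : ℕ × ℕ => p.1 * p.2)]
  · refine Finset.sum_congr rfl fun l hl => Finset.sum_congr ?_ fun _ _ => rfl
    rw [Finset.mem_Icc] at hl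
    ext ⟨i, m⟩
    simp only [Nat.mem_divisorsAntidiagonal, Finset.mem_filter, Finset.mem_product,
      Finset.mem_Icc]
    constructor
    · rintro ⟨rfl, h⟩
      have hi := Nat.pos_of_mul_pos_right (Nat.pos_of_ne_zero h)
      have hm := Nat.pos_of_mul_pos_left (Nat.pos_of_ne_zero h)
      have := Nat.le_mul_of_pos_right i hm
      have := Nat.le_mul_of_pos_left m hi
      omega
    · rintro ⟨⟨-, -⟩, rfl⟩
      exact ⟨rfl, by omega⟩
  · rintro ⟨i, m⟩ hp
    simp only [Finset.mem_filter, Finset.mem_product, Finset.mem_Icc] at hp ⊢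
    exact ⟨Nat.mul_pos hp.1.1.1 hp.1.2.1, hp.2⟩

/-! ### The series of strips -/

/-- The logarithm contributes to the `n`-th coefficient only by the powers up to `n`, because
`G(z)` has no constant term. -/
theorem coeff_logTerm (n : ℕ) (i : ℕ+) :
    PowerSeries.coeff n (logTerm i) = -∑ m ∈ Finset.Icc 1 n, cycleCoeff n i m := by
  have hG : PowerSeries.constantCoeff (PowerSeries.expand (i : ℕ) i.ne_zero tupleSeries) = 0 := by
    rw [PowerSeries.constantCoeff_expand, constantCoeff_tupleSeries]
  have hpow : ∀ m, PowerSeries.coeff n (PowerSeries.expand (i : ℕ) i.ne_zero tupleSeries ^ m) =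
      if (i : ℕ) ∣ n then PowerSeries.coeff (n / i) (tupleSeries ^ m) else 0 := fun m => by
    rw [← map_pow, PowerSeries.coeff_expand]
  have hsub : PowerSeries.HasSubst (-PowerSeries.expand (i : ℕ) i.ne_zero tupleSeries) :=
    PowerSeries.HasSubst.of_constantCoeff_zero' (by rw [map_neg, hG, neg_zero])
  rw [logTerm, PowerSeries.coeff_C_mul, PowerSeries.logOf_eq, sub_sub_cancel_left,
    PowerSeries.coeff_subst' hsub, finsum_eq_sum_of_support_subset (s := Finset.Icc 1 n),
    Finset.mul_sum, ← Finset.sum_neg_distrib]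
  · refine Finset.sum_congr rfl fun m hm => ?_
    have hm : m ≠ 0 := by rw [Finset.mem_Icc] at hm; omega
    have hone : (-1 : ℚ⟦X⟧) ^ m = PowerSeries.C ((-1) ^ m) := by simp
    rw [PowerSeries.coeff_log, if_neg hm, neg_pow (PowerSeries.expand _ _ _), hone,
      PowerSeries.coeff_C_mul, hpow, cycleCoeff]
    have hs : ((-1 : ℚ) ^ m) * (-1) ^ m = 1 := by rw [← mul_pow]; simp
    have hm' : (m : ℚ) ≠ 0 := by exact_mod_cast hm
    have hi' : ((i : ℕ) : ℚ) ≠ 0 := by exact_mod_cast i.ne_zero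
    simp only [Algebra.algebraMap_self, RingHom.id_apply, smul_eq_mul, pow_succ]
    field_simp
    linear_combination -(if (i : ℕ) ∣ n then
      PowerSeries.coeff (n / i) (tupleSeries ^ m) else 0) * hs
  · intro m hm
    by_contra hm'
    rw [Finset.coe_Icc, Set.mem_Icc] at hm'
    refine hm ?_
    rcases Nat.eq_zero_or_pos m with rfl | hm0
    · simp
    · have hdvd := pow_dvd_pow_of_dvd
        (PowerSeries.X_dvd_iff.2 (show PowerSeries.constantCoeff
          (-PowerSeries.expand (i : ℕ) i.ne_zero tupleSeries) = 0 by rw [map_neg, hG, neg_zero])) m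
      beta_reduce
      rw [PowerSeries.X_pow_dvd_iff.1 hdvd n (by omega), smul_zero]

theorem hasSum_coeff_logTerm (n : ℕ) : HasSum (fun i => PowerSeries.coeff n (logTerm i))
    (-∑ i ∈ Finset.Icc 1 n, ∑ m ∈ Finset.Icc 1 n, cycleCoeff n i m) := by
  have hzero : ∀ i : ℕ, n < i → ∑ m ∈ Finset.Icc 1 n, cycleCoeff n i m = 0 := fun i hi =>
    Finset.sum_eq_zero fun m hm => cycleCoeff_eq_zero
      (hi.trans_le (Nat.le_mul_of_pos_right i (Finset.mem_Icc.1 hm).1))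
  simp only [coeff_logTerm]
  refine HasSum.neg ?_
  have h : HasSum (fun i => if i = 0 then 0 else ∑ m ∈ Finset.Icc 1 n, cycleCoeff n i m) _ :=
    hasSum_sum_of_ne_finset_zero (s := Finset.Icc 1 n) fun i hi => by
      rw [Finset.mem_Icc] at hi
      split_ifs with h0
      · rfl
      · exact hzero i (by omega)
  rw [Finset.sum_congr rfl (g := fun i => ∑ m ∈ Finset.Icc 1 n, cycleCoeff n i m) fun i hi =>
    if_neg (by rw [Finset.mem_Icc] at hi; omega)] at h
  have hinj : Function.Injective fun i : ℕ+ => (i : ℕ) := PNat.coe_injective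
  have h' := (hinj.hasSum_iff (f := fun i => if i = 0 then 0 else
    ∑ m ∈ Finset.Icc 1 n, cycleCoeff n i m) fun i hi => ?_).2 h
  · exact h'.congr_fun fun i => (if_neg i.ne_zero).symm
  exact if_pos (by by_contra h0; exact hi ⟨⟨i, Nat.pos_of_ne_zero h0⟩, rfl⟩)

theorem hasSum_logTerm : HasSum logTerm (PowerSeries.mk fun n =>
    -∑ i ∈ Finset.Icc 1 n, ∑ m ∈ Finset.Icc 1 n, cycleCoeff n i m) :=
  (PowerSeries.WithPiTopology.hasSum_iff_hasSum_coeff ℚ).2 fun n => by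
    rw [PowerSeries.coeff_mk]
    exact hasSum_coeff_logTerm n

theorem Strip.thickness_pos (b : Strip) : 0 < b.thickness := by
  induction b using Quotient.inductionOn with | _ P =>
  exact (PPPStar.exists_isCore_of_hasThickness P.hasThickness_thickness).1

theorem finite_strip (k n : ℕ) : Finite {b : Strip // b.thickness = k ∧ b.semiPerimeter = n} := by
  rcases Nat.eq_zero_or_pos k with rfl | hk
  · have : IsEmpty {b : Strip // b.thickness = 0 ∧ b.semiPerimeter = n} :=
      ⟨fun b => b.1.thickness_pos.ne' b.2.1⟩
    infer_instance
  · obtain ⟨e⟩ := MarkedForest.nonempty_orbits_equiv hk n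
    have (l : Fin (n + 1)) := MarkedForest.finite_ofSize (rowShift k) l n
    exact Finite.of_equiv _ e

theorem card_strip {k : ℕ} (hk : 0 < k) (n : ℕ) :
    (Nat.card {b : Strip // b.thickness = k ∧ b.semiPerimeter = n} : ℚ) =
      ∑ i ∈ Finset.Icc 1 n, ∑ m ∈ Finset.Icc 1 n, cycleCoeff n i m := by
  obtain ⟨e⟩ := MarkedForest.nonempty_orbits_equiv hk n
  have (l : Fin (n + 1)) := MarkedForest.finite_ofSize (rowShift k) l n
  rw [← Nat.card_congr e, Nat.card_sigma, Nat.cast_sum,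
    Finset.sum_congr rfl fun (l : Fin (n + 1)) _ => card_orbits_moveEquiv (rowShift k) l n,
    Fin.sum_univ_eq_sum_range (fun l => ∑ p ∈ l.divisorsAntidiagonal, cycleCoeff n p.1 p.2),
    ← sum_divisorsAntidiagonal_cycleCoeff]
  refine (Finset.sum_subset (fun l hl => ?_) fun l hl hl' => ?_).symm
  · rw [Finset.mem_Icc] at hl
    rw [Finset.mem_range]
    omega
  · rw [Finset.mem_range] at hl
    rw [Finset.mem_Icc] at hl'
    rw [show l = 0 by omega, Nat.divisorsAntidiagonal_zero, Finset.sum_empty]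

theorem stripSeries_eq : stripSeries =
    -(PowerSeries.X * PowerSeries.invUnitsSub 1) * PowerSeries.C (∑' i : ℕ+, logTerm i) := by
  rw [hasSum_logTerm.tsum_eq]
  ext k n
  rw [PowerSeries.coeff_mul_C, map_neg]
  rcases k with _ | k
  · have : IsEmpty {b : Strip // b.thickness = 0 ∧ b.semiPerimeter = n} :=
      ⟨fun b => b.1.thickness_pos.ne' b.2.1⟩
    rw [PowerSeries.coeff_zero_X_mul, stripSeries]
    simp
  · rw [PowerSeries.coeff_succ_X_mul, PowerSeries.coeff_invUnitsSub, stripSeries,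
      PowerSeries.coeff_mk, PowerSeries.coeff_mk, card_strip k.succ_pos]
    simp

theorem mainTheorem2 :
    -- every PPP* has a well-defined intrinsic thickness
    (∀ P : PPPStar, ∃! k : ℕ, HasThickness P k) ∧
    -- the series of strips is well defined
    (∀ k n : ℕ, Finite {b : Strip // b.thickness = k ∧ b.semiPerimeter = n}) ∧
    -- `A(z) = (1 - √(1 - 4z)) / (2z)`
    2 * PowerSeries.X * treeSeries = 1 - sqrtOneSubFourX ∧
    -- `B(z, t) = - t / (1 - t) * ∑_{i ≥ 1} (φ(i) / i) log (1 - G(z ^ i))`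
    Summable logTerm ∧
    stripSeries =
      -(PowerSeries.X * PowerSeries.invUnitsSub 1) * PowerSeries.C (∑' i : ℕ+, logTerm i) :=
  ⟨PPPStar.existsUnique_hasThickness, finite_strip, two_mul_X_mul_treeSeries,
    hasSum_logTerm.summable, stripSeries_eq⟩
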